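/- Let $\kappa>0$, $\lambda=2\pi/\kappa$, $\theta\in(-\frac{\pi}{2},\frac{\pi}{2})$, $\epsilon,d>0$, and put $\mathbb R^2_+=\{x_2>0\}$, $\Gamma_0=\{x_2=0\}$, $D_\epsilon=(0,\epsilon)\times(-d,0)$, $\Gamma_\epsilon^+=(0,\epsilon)\times\{0\}$, $\Gamma_\epsilon^-=(0,\epsilon)\times\{-d\}$, $\phi_0=1/\sqrt{\epsilon}$, $u^{\rm inc}(x)=e^{i\kappa(x_1\sin\theta-x_2\cos\theta)}$, $u^{\rm ref}(x)=e^{i\kappa(x_1\sin\theta+x_2\cos\theta)}$. A solution of the single-mode approximate PEC-PMC cavity problem is a function $v_\epsilon$ that is $C^2$ in $\mathbb R^2_+$, belongs to $H^1$ of every bounded part of $\mathbb R^2_+$, is continuous up to $\Gamma_0$ except possibly at the two end points $(0,0),(\epsilon,0)$ of the aperture, and satisfies, with $v_0^+=\int_0^\epsilon v_\epsilon(x_1,0^+)\phi_0\,dx_1$ and $v_0^-=\int_0^\epsilon v_\epsilon(x_1,-d)\phi_0\,dx_1$, $$ \begin{cases} \Delta v_\epsilon+\kappa^2v_\epsilon=0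 & \text{in }\mathbb R^2_+,\\ \partial_{x_2}v_\epsilon=0 & \text{on }\Gamma_0\setminus\overline{\Gamma_\epsilon^+},\\ \partial_{x_2}v_\epsilon=i\kappa\,\dfrac{e^{2i\kappa d}+1}{e^{2i\kappa d}-1}\,v_0^+\phi_0 & \text{on }\Gamma_\epsilon^+,\\ \sqrt r\,(\partial_r v^{\rm sc}-i\kappa v^{\rm sc})\to0 & \text{as } r=|x|\to\infty,\ x\in\mathbb R^2_+, \text{ uniformly in the direction } x/|x|, \end{cases} \qquad v^{\rm sc}=v_\epsilon-u^{\rm inc}-u^{\rm ref}, $$ where the boundary values of $\partial_{x_2}v_\epsilon$ are limits from $\mathbb R^2_+$, while $v_\epsilon=0$ on $\Gamma_\epsilon^-$ and, in the cavity $D_\epsilon$, $$ v_\epsilon(x)=\bigl(\alpha^+e^{-i\kappa x_2}+\alpha^-e^{i\kappa(x_2+d)}\bigr)\phi_0,\qquad \alpha^{+}=\frac{e^{i\kappa d}v_0^{-}-v_0^{+}}{e^{2i\kappa d}-1},\quad \alpha^{-}=\frac{e^{i\kappa d}v_0^{+}-v_0^{-}}{e^{2i\kappa d}-1}. $$ **Theorem.**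 There are constants $\delta,C_1,C_2>0$, independent of $\lambda,\epsilon,d$ (and of $\theta$), such that whenever $\epsilon\le\delta d$ and $d\le\delta\lambda$, every such solution satisfies $$\|\nabla v_\epsilon\|_{L^2(D_\epsilon)}\le C_2\sqrt{\epsilon/d},$$ and, if moreover $\epsilon\ln(\lambda/\epsilon)\le d$ (which holds, for given $\lambda$ and $d$, for all sufficiently small $\epsilon$), also $$C_1\sqrt{\epsilon/d}\le\|\nabla v_\epsilon\|_{L^2(D_\epsilon)}.$$ -/

import Mathlib

open Filter Topology MeasureTheory Bornology

namespace PECPMC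

noncomputable section

/-- The plane `ℝ²` with its Euclidean norm; a point is `x = (x₁, x₂) = (x 0, x 1)`. -/
abbrev Plane : Type := EuclideanSpace ℝ (Fin 2)

/-- The wavelength `λ = 2π/κ` of the wavenumber `κ`. -/
def wavelength (κ : ℝ) : ℝ := 2 * Real.pi / κ

/-- The open upper half-plane. -/
def upperHalf : Set Plane := {x | 0 < x 1}

/-- The open rectangular cavity `D_ε = (0, ε) × (-d, 0)`. -/
def cavity (ε d : ℝ) : Set Plane := {x | 0 < x 0 ∧ x 0 < ε ∧ -d < x 1 ∧ x 1 < 0}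

/-- The partial derivative `∂_{x_i} v`. -/
def partialDeriv (i : Fin 2) (v : Plane → ℂ) (x : Plane) : ℂ :=
  fderiv ℝ v x (EuclideanSpace.single i 1)

/-- `|∇v|² = |∂_{x₁} v|² + |∂_{x₂} v|²`. -/
def gradSq (v : Plane → ℂ) (x : Plane) : ℝ :=
  ‖partialDeriv 0 v x‖ ^ 2 + ‖partialDeriv 1 v x‖ ^ 2

/-- `‖∇v‖_{L²(S)}`. -/
def gradL2Norm (v : Plane → ℂ) (S : Set Plane) : ℝ :=
  Real.sqrt (∫ x in S, gradSq v x)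

/-- The incident plane wave `exp (i κ x·(sin θ, -cos θ))`. -/
def uInc (κ θ : ℝ) (x : Plane) : ℂ :=
  Complex.exp (Complex.I * κ * (x 0 * Real.sin θ - x 1 * Real.cos θ))

/-- The reflected plane wave `exp (i κ x·(sin θ, cos θ))`. -/
def uRef (κ θ : ℝ) (x : Plane) : ℂ :=
  Complex.exp (Complex.I * κ * (x 0 * Real.sin θ + x 1 * Real.cos θ))

/-- The scattered field `v - (u^inc + u^ref)` (used in the upper half-plane only). -/
def scattered (κ θ : ℝ) (v : Plane → ℂ) (x : Plane) : ℂ :=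
  v x - (uInc κ θ x + uRef κ θ x)

/-- The constant mode `φ₀ = 1/√ε`. -/
def phi0 (ε : ℝ) : ℂ := ((1 / Real.sqrt ε : ℝ) : ℂ)

/-- The zeroth Fourier coefficient of `v` on the segment `(0, ε) × {h}`; `h = 0` gives `v₀⁺` and
`h = -d` gives `v₀⁻`. -/
def coeff0 (ε h : ℝ) (v : Plane → ℂ) : ℂ :=
  ∫ t in (0 : ℝ)..ε, v !₂[t, h] * starRingEnd ℂ (phi0 ε)

/-- The single-mode Dirichlet-to-Neumann map
`i κ (e^{2iκd} + 1) / (e^{2iκd} - 1) v₀⁺ φ₀`, a constant function on the aperture. -/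
def dtn0 (κ ε d : ℝ) (v : Plane → ℂ) : ℂ :=
  Complex.I * κ * ((Complex.exp (Complex.I * 2 * κ * d) + 1) /
    (Complex.exp (Complex.I * 2 * κ * d) - 1)) * coeff0 ε 0 v * phi0 ε

/-- The mode coefficient `α₀⁺`. -/
def alphaPlus (κ ε d : ℝ) (v : Plane → ℂ) : ℂ :=
  (Complex.exp (Complex.I * κ * d) * coeff0 ε (-d) v - coeff0 ε 0 v) /
    (Complex.exp (Complex.I * 2 * κ * d) - 1)

/-- The mode coefficient `α₀⁻`. -/
def alphaMinus (κ ε d : ℝ) (v : Plane → ℂ) : ℂ :=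
  (Complex.exp (Complex.I * κ * d) * coeff0 ε 0 v - coeff0 ε (-d) v) /
    (Complex.exp (Complex.I * 2 * κ * d) - 1)

/-- `v` solves the single-mode approximate PEC-PMC cavity problem. On the line `x₂ = 0` the values
of `v` are its traces from above. No condition is imposed at the two end points of the aperture
(there the normal derivative of a solution jumps) other than finiteness of the local energy. -/
structure IsApproxSolution (κ θ ε d : ℝ) (v : Plane → ℂ) : Prop where
  contDiffOn : ContDiffOn ℝ 2 v upperHalf
  continuousOn : ContinuousOn v {x | 0 ≤ x 1 ∧ x ≠ !₂[0, 0] ∧ x ≠ !₂[ε, 0]}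
  /-- `v ∈ H¹` of every bounded part of the half-plane -/
  sq_integrable : ∀ R : ℝ, IntegrableOn (fun x => ‖v x‖ ^ 2) (Metric.ball 0 R ∩ upperHalf)
  gradSq_integrable : ∀ R : ℝ, IntegrableOn (gradSq v) (Metric.ball 0 R ∩ upperHalf)
  helmholtz : ∀ x ∈ upperHalf, Laplacian.laplacian v x + (κ : ℂ) ^ 2 * v x = 0
  /-- `∂_ν v = 0` on the line `x₂ = 0` outside the aperture -/
  neumann : ∀ t : ℝ, t ∉ Set.Icc 0 ε →
    Tendsto (partialDeriv 1 v) (𝓝[upperHalf] !₂[t, 0]) (𝓝 0)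
  /-- `∂_{x₂} v` equals the single-mode Dirichlet-to-Neumann map on the aperture -/
  aperture : ∀ t ∈ Set.Ioo 0 ε,
    Tendsto (partialDeriv 1 v) (𝓝[upperHalf] !₂[t, 0]) (𝓝 (dtn0 κ ε d v))
  /-- Sommerfeld radiation condition, uniformly in all upward directions -/
  radiation :
    Tendsto (fun x : Plane => (Real.sqrt ‖x‖ : ℂ) *
        (fderiv ℝ (scattered κ θ v) x (‖x‖⁻¹ • x) - Complex.I * κ * scattered κ θ v x))
      (cobounded Plane ⊓ 𝓟 upperHalf) (𝓝 0)
  /-- `v = 0` on the bottom of the cavity -/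
  bottom : ∀ t ∈ Set.Ioo 0 ε, v !₂[t, -d] = 0
  /-- `v` is the single waveguide mode in the cavity -/
  mode : ∀ x ∈ cavity ε d,
    v x = (alphaPlus κ ε d v * Complex.exp (-Complex.I * κ * x 1) +
      alphaMinus κ ε d v * Complex.exp (Complex.I * κ * (x 1 + d))) * phi0 ε

end

end PECPMC

/-!
Let `H = (π i / 2) H₀⁽¹⁾`, so that `H(κ |x - y|) / π` is the outgoing Neumann Green's function of
the half-plane for a source `y` on the boundary. Green's formula expresses the trace of a solution
through its constant normal derivative `c` on the aperture:
`v(y, 0) = 2 e^{i κ y sin θ} - (c / π) ∫_{(0, ε)} H(κ |t - y|) dt`.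
Here `c` is itself a multiple of the mean of `v` over the aperture, so averaging in `y` leaves one
scalar equation `v₀⁺ (1 + q J) = 2 φ₀ w` with `q ε² ~ ε / d` and `|w| ~ ε`. As `H(z) ~ - log z` at
`0`, the self-interaction `J` is of order `ε² log (λ / ε)`, and its real part is bounded below by
a multiple of that order up to an error of order `ε²`. Hence `|1 + q J| ~ 1 + (ε / d) log (λ / ε)`,
while the explicit cavity mode has energy comparable to `|v₀⁺|² / d`.
-/

namespace PECPMC

noncomputable section

open Complex (I)

/-! ### The Hankel function -/

/-- The analytic factor `(s² - 2i)^{-1/2}` of the Gaussian representation of the Hankel function. -/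
def hankelWeight (s : ℝ) : ℂ :=
  ((s : ℂ) ^ 2 - 2 * I) ^ (-(1 / 2) : ℂ)

/-- The integrand of `hankelMoment`. -/
def hankelIntegrand (k : ℕ) (z s : ℝ) : ℂ :=
  ((s : ℂ) ^ 2 - I) ^ k * Complex.exp (-z * ((s : ℂ) ^ 2 - I)) * hankelWeight s

/-- The functions `∫ (s² - i)^k e^{-z(s² - i)} (s² - 2i)^{-1/2} ds` of `z > 0`. For `k = 0` this is
`(iπ/2) H₀⁽¹⁾(z)`, and differentiation in `z` raises `k` by one and changes the sign. -/
def hankelMoment (k : ℕ) (z : ℝ) : ℂ :=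
  ∫ s : ℝ, hankelIntegrand k z s

lemma sq_sub_two_I_mem_slitPlane (s : ℝ) : (s : ℂ) ^ 2 - 2 * I ∈ Complex.slitPlane := by
  right
  simp [← Complex.ofReal_pow]

lemma sq_sub_two_I_ne_zero (s : ℝ) : (s : ℂ) ^ 2 - 2 * I ≠ 0 :=
  Complex.slitPlane_ne_zero (sq_sub_two_I_mem_slitPlane s)

lemma hankelWeight_sq (s : ℝ) : hankelWeight s ^ 2 = ((s : ℂ) ^ 2 - 2 * I)⁻¹ := by
  rw [hankelWeight, ← Complex.cpow_nat_mul, ← Complex.cpow_neg_one]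
  norm_num

lemma re_hankelWeight_nonneg (s : ℝ) : 0 ≤ (hankelWeight s).re := by
  have h := Complex.neg_pi_lt_arg ((s : ℂ) ^ 2 - 2 * I)
  have h' := Complex.arg_le_pi ((s : ℂ) ^ 2 - 2 * I)
  have hre : hankelWeight s = ((s : ℂ) ^ 2 - 2 * I) ^ ((-(1 / 2) : ℝ) : ℂ) := by
    rw [hankelWeight]; push_cast; rfl
  rw [hre, Complex.cpow_ofReal_re]
  exact mul_nonneg (by positivity)
    (Real.cos_nonneg_of_neg_pi_div_two_le_of_le (by linarith) (by linarith))

lemma norm_hankelWeight_sq (s : ℝ) : ‖hankelWeight s‖ ^ 2 = ‖(s : ℂ) ^ 2 - 2 * I‖⁻¹ := by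
  rw [← norm_pow, hankelWeight_sq, norm_inv]

lemma two_le_norm_sq_sub_two_I (s : ℝ) : 2 ≤ ‖(s : ℂ) ^ 2 - 2 * I‖ := by
  have him : ((s : ℂ) ^ 2 - 2 * I).im = -2 := by simp [← Complex.ofReal_pow]
  have h := Complex.abs_im_le_norm ((s : ℂ) ^ 2 - 2 * I)
  rwa [him, abs_neg, abs_two] at h

lemma sq_le_norm_sq_sub_two_I (s : ℝ) : s ^ 2 ≤ ‖(s : ℂ) ^ 2 - 2 * I‖ := by
  have hre : ((s : ℂ) ^ 2 - 2 * I).re = s ^ 2 := by simp [← Complex.ofReal_pow]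
  exact hre ▸ Complex.re_le_norm _

lemma norm_hankelWeight_le_one (s : ℝ) : ‖hankelWeight s‖ ≤ 1 := by
  rw [← sq_le_one_iff₀ (norm_nonneg _), norm_hankelWeight_sq]
  exact inv_le_one_of_one_le₀ (by linarith [two_le_norm_sq_sub_two_I s])

lemma abs_mul_norm_hankelWeight_le_one (s : ℝ) : |s| * ‖hankelWeight s‖ ≤ 1 := by
  rw [← sq_le_one_iff₀ (by positivity), mul_pow, norm_hankelWeight_sq, sq_abs]
  exact mul_inv_le_one_of_le₀ (sq_le_norm_sq_sub_two_I s) (norm_nonneg _)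

lemma hasDerivAt_hankelWeight (s : ℝ) :
    HasDerivAt hankelWeight (-(s * (hankelWeight s / ((s : ℂ) ^ 2 - 2 * I)))) s := by
  have hbase : HasDerivAt (fun w : ℂ => w ^ 2 - 2 * I) (2 * (s : ℂ)) (s : ℂ) := by
    simpa using (hasDerivAt_pow 2 (s : ℂ)).sub_const (2 * I)
  refine (hbase.cpow_const (c := -(1 / 2))
    (sq_sub_two_I_mem_slitPlane s)).comp_ofReal.congr_deriv ?_
  rw [Complex.cpow_sub _ _ (sq_sub_two_I_ne_zero s), Complex.cpow_one, hankelWeight]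
  ring

lemma continuous_hankelWeight : Continuous hankelWeight :=
  continuous_iff_continuousAt.2 fun s => (hasDerivAt_hankelWeight s).continuousAt

lemma continuous_hankelIntegrand (k : ℕ) (z : ℝ) : Continuous (hankelIntegrand k z) := by
  have := continuous_hankelWeight
  unfold hankelIntegrand
  fun_prop

lemma norm_exp_neg_mul_sq_sub_I (z s : ℝ) :
    ‖Complex.exp (-z * ((s : ℂ) ^ 2 - I))‖ = Real.exp (-z * s ^ 2) := by
  rw [Complex.norm_exp]
  simp [← Complex.ofReal_pow]

lemma norm_sq_sub_I_le (s : ℝ) : ‖(s : ℂ) ^ 2 - I‖ ≤ s ^ 2 + 1 := by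
  refine (norm_sub_le _ _).trans ?_
  simp

lemma norm_hankelIntegrand_le (k : ℕ) (z s : ℝ) :
    ‖hankelIntegrand k z s‖ ≤ (s ^ 2 + 1) ^ k * Real.exp (-z * s ^ 2) := by
  rw [hankelIntegrand, norm_mul, norm_mul, norm_pow, norm_exp_neg_mul_sq_sub_I]
  refine mul_le_of_le_one_right (by positivity) (norm_hankelWeight_le_one s) |>.trans ?_
  gcongr
  exact norm_sq_sub_I_le s

lemma integrable_pow_mul_exp_neg_mul_sq (n : ℕ) {z : ℝ} (hz : 0 < z) :
    Integrable fun s : ℝ => s ^ n * Real.exp (-z * s ^ 2) := by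
  have hn : (-1 : ℝ) < n := neg_one_lt_zero.trans_le n.cast_nonneg
  simpa using integrable_rpow_mul_exp_neg_mul_sq hz hn

lemma integrable_sq_add_one_pow_mul_exp (k : ℕ) {z : ℝ} (hz : 0 < z) :
    Integrable fun s : ℝ => (s ^ 2 + 1) ^ k * Real.exp (-z * s ^ 2) := by
  simp only [add_pow, one_pow, mul_one, ← pow_mul, Finset.sum_mul]
  refine integrable_finsetSum _ fun m _ => ?_
  refine ((integrable_pow_mul_exp_neg_mul_sq (2 * m) hz).const_mul (k.choose m : ℝ)).congr ?_
  exact Eventually.of_forall fun s => by ring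

lemma integral_abs_pow_mul_exp_neg_mul_sq (n : ℕ) {z : ℝ} (hz : 0 < z) :
    ∫ s : ℝ, |s| ^ n * Real.exp (-z * s ^ 2) =
      z ^ (-((n : ℝ) + 1) / 2) * Real.Gamma ((n + 1) / 2) := by
  have hn : (-1 : ℝ) < n := neg_one_lt_zero.trans_le n.cast_nonneg
  have habs := integral_comp_abs (f := fun s => s ^ n * Real.exp (-z * s ^ 2))
  have hgamma := integral_rpow_mul_exp_neg_mul_rpow (q := n) two_pos hn hz
  simp only [Real.rpow_natCast, Real.rpow_two] at hgamma
  simp only [sq_abs, hgamma] at habs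
  rw [habs]
  ring

lemma integral_abs_mul_exp_neg_mul_sq {z : ℝ} (hz : 0 < z) :
    ∫ s : ℝ, |s| * Real.exp (-z * s ^ 2) = z⁻¹ := by
  have h := integral_abs_pow_mul_exp_neg_mul_sq 1 hz
  norm_num [Real.rpow_neg_one] at h
  simpa only [neg_mul] using h

lemma integral_sq_mul_exp_neg_mul_sq {z : ℝ} (hz : 0 < z) :
    ∫ s : ℝ, s ^ 2 * Real.exp (-z * s ^ 2) = √(Real.pi / z) / (2 * z) := by
  have h := integral_abs_pow_mul_exp_neg_mul_sq 2 hz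
  have hΓ : Real.Gamma ((((2 : ℕ) : ℝ) + 1) / 2) = √Real.pi / 2 := by
    rw [show (((2 : ℕ) : ℝ) + 1) / 2 = 1 / 2 + 1 by norm_num, Real.Gamma_add_one (by norm_num),
      Real.Gamma_one_half_eq]
    ring
  have hpow : z ^ (-(((2 : ℕ) : ℝ) + 1) / 2) = (z * √z)⁻¹ := by
    rw [show -(((2 : ℕ) : ℝ) + 1) / 2 = -(1 + 1 / 2) by norm_num, Real.rpow_neg hz.le,
      Real.rpow_add hz, Real.rpow_one, Real.sqrt_eq_rpow]
  simp only [sq_abs] at h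
  rw [h, hΓ, hpow, Real.sqrt_div Real.pi_pos.le]
  field_simp

lemma integrable_hankelIntegrand (k : ℕ) {z : ℝ} (hz : 0 < z) :
    Integrable (hankelIntegrand k z) :=
  (integrable_sq_add_one_pow_mul_exp k hz).mono'
    (continuous_hankelIntegrand k z).aestronglyMeasurable
    (Eventually.of_forall (norm_hankelIntegrand_le k z))

lemma hasDerivAt_hankelIntegrand (k : ℕ) (z s : ℝ) :
    HasDerivAt (fun z => hankelIntegrand k z s) (-hankelIntegrand (k + 1) z s) z := by
  have hexp : HasDerivAt (fun z : ℝ => -(z : ℂ) * ((s : ℂ) ^ 2 - I)) (-1 * ((s : ℂ) ^ 2 - I)) z :=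
    (Complex.ofRealCLM.hasDerivAt (x := z)).neg.mul_const _
  refine ((hexp.cexp.const_mul (((s : ℂ) ^ 2 - I) ^ k)).mul_const
    (hankelWeight s)).congr_deriv ?_
  rw [hankelIntegrand]
  ring

lemma hasDerivAt_hankelMoment (k : ℕ) {z : ℝ} (hz : 0 < z) :
    HasDerivAt (hankelMoment k) (-hankelMoment (k + 1) z) z := by
  have h := (hasDerivAt_integral_of_dominated_loc_of_deriv_le (𝕜 := ℝ) (F := hankelIntegrand k)
    (F' := fun z s => -hankelIntegrand (k + 1) z s) (s := Set.Ioi (z / 2))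
    (bound := fun s => (s ^ 2 + 1) ^ (k + 1) * Real.exp (-(z / 2) * s ^ 2))
    (Ioi_mem_nhds (by linarith))
    (Eventually.of_forall fun x => (continuous_hankelIntegrand k x).aestronglyMeasurable)
    (integrable_hankelIntegrand k hz)
    (continuous_hankelIntegrand (k + 1) z).neg.aestronglyMeasurable
    (Eventually.of_forall fun s x (hx : z / 2 < x) => ?_)
    (integrable_sq_add_one_pow_mul_exp (k + 1) (by linarith))
    (Eventually.of_forall fun s x _ => hasDerivAt_hankelIntegrand k x s)).2
  · rwa [integral_neg] at h
  · rw [norm_neg]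
    refine (norm_hankelIntegrand_le (k + 1) x s).trans ?_
    gcongr

lemma contDiffOn_hankelMoment (n k : ℕ) : ContDiffOn ℝ n (hankelMoment k) (Set.Ioi 0) := by
  induction n generalizing k with
  | zero =>
    exact contDiffOn_zero.2 fun z hz =>
      (hasDerivAt_hankelMoment k hz).continuousAt.continuousWithinAt
  | succ n ih =>
    rw [Nat.cast_succ, contDiffOn_succ_iff_deriv_of_isOpen isOpen_Ioi]
    exact ⟨fun z hz => (hasDerivAt_hankelMoment k hz).differentiableAt.differentiableWithinAt,
      by simp, (ih (k + 1)).neg.congr fun z hz => (hasDerivAt_hankelMoment k hz).deriv⟩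

lemma continuousOn_hankelMoment (k : ℕ) : ContinuousOn (hankelMoment k) (Set.Ioi 0) :=
  (contDiffOn_hankelMoment 0 k).continuousOn

lemma hasDerivAt_besselPrimitive (z s : ℝ) :
    HasDerivAt (fun s : ℝ => s * (((s : ℂ) ^ 2 - 2 * I) * hankelWeight s) *
        Complex.exp (-z * ((s : ℂ) ^ 2 - I)))
      (2 * (hankelIntegrand 1 z s - z * (hankelIntegrand 2 z s + hankelIntegrand 0 z s))) s := by
  have hid : HasDerivAt (fun s : ℝ => (s : ℂ)) 1 s := Complex.ofRealCLM.hasDerivAt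
  have hsq : HasDerivAt (fun s : ℝ => (s : ℂ) ^ 2) (2 * (s : ℂ)) s := by
    simpa using hid.fun_pow 2
  have hcancel : ((s : ℂ) ^ 2 - 2 * I) * (s * (hankelWeight s / ((s : ℂ) ^ 2 - 2 * I))) =
      s * hankelWeight s := by
    rw [mul_left_comm, mul_div_cancel₀ _ (sq_sub_two_I_ne_zero s)]
  refine ((hid.fun_mul ((hsq.sub_const (2 * I)).fun_mul (hasDerivAt_hankelWeight s))).fun_mul
    ((hsq.sub_const I).const_mul (-(z : ℂ))).cexp).congr_deriv ?_
  simp only [hankelIntegrand]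
  linear_combination (-s * Complex.exp (-z * ((s : ℂ) ^ 2 - I))) * hcancel +
    2 * Complex.exp (-z * ((s : ℂ) ^ 2 - I)) * hankelWeight s * z * Complex.I_sq

lemma hankelMoment_bessel {z : ℝ} (hz : 0 < z) :
    z * hankelMoment 2 z - hankelMoment 1 z + z * hankelMoment 0 z = 0 := by
  have hI := fun k => integrable_hankelIntegrand k hz
  have hprim : Integrable fun s : ℝ => s * (((s : ℂ) ^ 2 - 2 * I) * hankelWeight s) *
      Complex.exp (-z * ((s : ℂ) ^ 2 - I)) := by
    refine ((integrable_sq_add_one_pow_mul_exp 1 hz).const_mul 2).mono' ?_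
      (Eventually.of_forall fun s => ?_)
    · have := continuous_hankelWeight
      exact Continuous.aestronglyMeasurable (by fun_prop)
    · have hbase : ‖(s : ℂ) ^ 2 - 2 * I‖ ≤ 2 * (s ^ 2 + 1) := by
        refine (norm_sub_le _ _).trans ?_
        simp only [norm_pow, norm_mul, Complex.norm_real, Complex.norm_ofNat, Complex.norm_I,
          Real.norm_eq_abs, sq_abs]
        linarith [sq_nonneg s]
      have hfactor : |s| * (‖(s : ℂ) ^ 2 - 2 * I‖ * ‖hankelWeight s‖) ≤ 2 * (s ^ 2 + 1) := by
        rw [mul_left_comm]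
        exact (mul_le_of_le_one_right (norm_nonneg _) (abs_mul_norm_hankelWeight_le_one s)).trans
          hbase
      rw [norm_mul, norm_mul, norm_mul, norm_exp_neg_mul_sq_sub_I, Complex.norm_real,
        Real.norm_eq_abs, pow_one, ← mul_assoc (2 : ℝ)]
      exact mul_le_mul_of_nonneg_right hfactor (Real.exp_nonneg _)
  have hsum : Integrable fun s => z * (hankelIntegrand 2 z s + hankelIntegrand 0 z s) :=
    ((hI 2).add (hI 0)).const_mul _
  have h := integral_eq_zero_of_hasDerivAt_of_integrable (hasDerivAt_besselPrimitive z)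
    (((hI 1).sub hsum).const_mul 2) hprim
  rw [integral_const_mul, integral_sub (hI 1) hsum, integral_const_mul,
    integral_add (hI 2) (hI 0)] at h
  simp only [hankelMoment]
  linear_combination -(1 / 2) * h

lemma norm_hankelMoment_zero_le {z : ℝ} (hz : 0 < z) : ‖hankelMoment 0 z‖ ≤ √(Real.pi / z) := by
  rw [← integral_gaussian]
  refine norm_integral_le_of_norm_le (integrable_exp_neg_mul_sq hz)
    (Eventually.of_forall fun s => ?_)
  simpa using norm_hankelIntegrand_le 0 z s

lemma norm_hankelMoment_radiation_le {z : ℝ} (hz : 0 < z) :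
    ‖hankelMoment 1 z + I * hankelMoment 0 z‖ ≤ √(Real.pi / z) / (2 * z) := by
  rw [← integral_sq_mul_exp_neg_mul_sq hz, hankelMoment, hankelMoment, ← integral_const_mul,
    ← integral_add (integrable_hankelIntegrand 1 hz)
      ((integrable_hankelIntegrand 0 hz).const_mul _)]
  refine norm_integral_le_of_norm_le (integrable_pow_mul_exp_neg_mul_sq 2 hz)
    (Eventually.of_forall fun s => ?_)
  have hsum : hankelIntegrand 1 z s + I * hankelIntegrand 0 z s =
      (s : ℂ) ^ 2 * Complex.exp (-z * ((s : ℂ) ^ 2 - I)) * hankelWeight s := by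
    simp only [hankelIntegrand]
    ring
  rw [hsum, norm_mul, norm_mul, norm_exp_neg_mul_sq_sub_I, norm_pow, Complex.norm_real,
    Real.norm_eq_abs, sq_abs]
  exact mul_le_of_le_one_right (by positivity) (norm_hankelWeight_le_one s)

/- With `b = s² - 2i`, the left side is `√b + i / √b - |s|`, and `√b - |s| = -2i / (√b + |s|)`. -/
lemma norm_sq_sub_I_mul_hankelWeight_sub_abs_le (s : ℝ) :
    ‖((s : ℂ) ^ 2 - I) * hankelWeight s - |s|‖ ≤ 3 := by
  set w := hankelWeight s
  have hbw : ((s : ℂ) ^ 2 - 2 * I) * w ^ 2 = 1 := by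
    rw [hankelWeight_sq, mul_inv_cancel₀ (sq_sub_two_I_ne_zero s)]
  have hden : 1 ≤ ‖1 + (|s| : ℝ) * w‖ := by
    refine le_trans ?_ (Complex.re_le_norm _)
    rw [Complex.add_re, Complex.one_re, Complex.re_ofReal_mul]
    linarith [mul_nonneg (abs_nonneg s) (re_hankelWeight_nonneg s)]
  have hden0 : 1 + (|s| : ℝ) * w ≠ 0 := norm_pos_iff.1 (one_pos.trans_le hden)
  have habs : ((|s| : ℝ) : ℂ) ^ 2 = (s : ℂ) ^ 2 := by
    rw [← Complex.ofReal_pow, sq_abs, Complex.ofReal_pow]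
  have hquot : 2 * I * w / (1 + (|s| : ℝ) * w) = (|s| : ℝ) - ((s : ℂ) ^ 2 - 2 * I) * w := by
    rw [div_eq_iff hden0]
    linear_combination ((|s| : ℝ) : ℂ) * hbw - w * habs
  have hsplit : ((s : ℂ) ^ 2 - I) * w - (|s| : ℝ) =
      I * w - 2 * I * w / (1 + (|s| : ℝ) * w) := by
    rw [hquot]
    ring
  rw [hsplit]
  refine (norm_sub_le _ _).trans ?_
  rw [norm_div, norm_mul, norm_mul, norm_mul, Complex.norm_I, Complex.norm_ofNat]
  have hw1 : ‖w‖ ≤ 1 := norm_hankelWeight_le_one s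
  have hquot_le : 2 * 1 * ‖w‖ / ‖1 + |s| * w‖ ≤ 2 * 1 * 1 / 1 := by gcongr
  linarith

/- `|s|` has the exact Gaussian moment `1 / z`. -/
lemma norm_mul_hankelMoment_one_sub_exp_le {z : ℝ} (hz : 0 < z) :
    ‖z * hankelMoment 1 z - Complex.exp (I * z)‖ ≤ 3 * √(Real.pi * z) := by
  have habs : Integrable fun s : ℝ => |s| * Real.exp (-z * s ^ 2) := by
    refine (integrable_pow_mul_exp_neg_mul_sq 1 hz).norm.congr (Eventually.of_forall fun s => ?_)
    simp
  have hphase : ∀ s : ℝ, hankelIntegrand 1 z s -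
      Complex.exp (I * z) * ((|s| * Real.exp (-z * s ^ 2) : ℝ) : ℂ) =
      (((s : ℂ) ^ 2 - I) * hankelWeight s - |s|) * Complex.exp (-z * ((s : ℂ) ^ 2 - I)) := by
    intro s
    have hexp : Complex.exp (-z * ((s : ℂ) ^ 2 - I)) =
        Complex.exp (I * z) * Complex.exp (-z * (s : ℂ) ^ 2) := by
      rw [← Complex.exp_add]
      ring_nf
    rw [hankelIntegrand, hexp]
    push_cast
    ring
  have hphaseInt : Integrable fun s : ℝ =>
      Complex.exp (I * z) * ((|s| * Real.exp (-z * s ^ 2) : ℝ) : ℂ) := habs.ofReal.const_mul _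
  have hbound : ‖hankelMoment 1 z - Complex.exp (I * z) * ((z⁻¹ : ℝ) : ℂ)‖ ≤
      3 * √(Real.pi / z) := by
    rw [← integral_abs_mul_exp_neg_mul_sq hz, ← integral_complex_ofReal, ← integral_const_mul,
      hankelMoment, ← integral_sub (integrable_hankelIntegrand 1 hz) hphaseInt,
      ← integral_gaussian, ← integral_const_mul]
    refine norm_integral_le_of_norm_le ((integrable_exp_neg_mul_sq hz).const_mul 3)
      (Eventually.of_forall fun s => ?_)
    rw [hphase, norm_mul, norm_exp_neg_mul_sq_sub_I]
    gcongr
    exact norm_sq_sub_I_mul_hankelWeight_sub_abs_le s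
  have hz0 : (z : ℂ) ≠ 0 := by exact_mod_cast hz.ne'
  calc ‖z * hankelMoment 1 z - Complex.exp (I * z)‖
      = z * ‖hankelMoment 1 z - Complex.exp (I * z) * ((z⁻¹ : ℝ) : ℂ)‖ := by
        rw [← Complex.norm_of_nonneg hz.le, ← norm_mul, Complex.norm_of_nonneg hz.le]
        congr 1
        push_cast
        field_simp
    _ ≤ z * (3 * √(Real.pi / z)) := by gcongr
    _ = 3 * √(Real.pi * z) := by
        rw [show Real.pi * z = z ^ 2 * (Real.pi / z) by field_simp, Real.sqrt_mul (sq_nonneg z),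
          Real.sqrt_sq hz.le]
        ring

lemma norm_mul_hankelMoment_one_le {z : ℝ} (hz : 0 < z) :
    ‖z * hankelMoment 1 z‖ ≤ 1 + 3 * √(Real.pi * z) := by
  have h := norm_sub_norm_le (z * hankelMoment 1 z) (Complex.exp (I * z))
  rw [mul_comm I, Complex.norm_exp_ofReal_mul_I, mul_comm (z : ℂ) I] at h
  linarith [norm_mul_hankelMoment_one_sub_exp_le hz]

lemma tendsto_mul_hankelMoment_one :
    Tendsto (fun z : ℝ => z * hankelMoment 1 z) (𝓝[>] 0) (𝓝 1) := by
  have hsqrt : Tendsto (fun z : ℝ => 3 * √(Real.pi * z)) (𝓝[>] 0) (𝓝 0) := by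
    have hc : Continuous fun z : ℝ => 3 * √(Real.pi * z) := by fun_prop
    simpa using (hc.tendsto 0).mono_left nhdsWithin_le_nhds
  have hexp : Tendsto (fun z : ℝ => Complex.exp (I * z)) (𝓝[>] 0) (𝓝 1) := by
    have hc : Continuous fun z : ℝ => Complex.exp (I * z) := by fun_prop
    simpa using (hc.tendsto 0).mono_left nhdsWithin_le_nhds
  have hdiff : Tendsto (fun z : ℝ => z * hankelMoment 1 z - Complex.exp (I * z)) (𝓝[>] 0) (𝓝 0) :=
    squeeze_zero_norm' (by
      filter_upwards [self_mem_nhdsWithin] with z hz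
      exact norm_mul_hankelMoment_one_sub_exp_le hz) hsqrt
  simpa using hdiff.add hexp

lemma exists_re_hankelMoment_zero_ge_log :
    ∃ z₀ C : ℝ, 0 < z₀ ∧ 0 < C ∧
      ∀ z ∈ Set.Ioc 0 z₀, -(Real.log z / 2) - C ≤ (hankelMoment 0 z).re := by
  have hre : Tendsto (fun z : ℝ => (z * hankelMoment 1 z).re) (𝓝[>] 0) (𝓝 1) :=
    (Complex.continuous_re.tendsto 1).comp tendsto_mul_hankelMoment_one
  obtain ⟨z₀, hz₀ : 0 < z₀, hhalf⟩ := mem_nhdsGT_iff_exists_Ioc_subset.1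
    (hre.eventually (lt_mem_nhds (one_half_lt_one (α := ℝ))))
  have hderiv : ∀ x ∈ Set.Ioc 0 z₀, HasDerivAt (fun x => (hankelMoment 0 x).re + Real.log x / 2)
      (-(hankelMoment 1 x).re + x⁻¹ / 2) x := fun x hx =>
    (Complex.reCLM.hasFDerivAt.comp_hasDerivAt x (hasDerivAt_hankelMoment 0 hx.1)).add
      ((Real.hasDerivAt_log hx.1.ne').div_const 2)
  have hanti : AntitoneOn (fun x => (hankelMoment 0 x).re + Real.log x / 2) (Set.Ioc 0 z₀) := by
    refine antitoneOn_of_deriv_nonpos (convex_Ioc _ _)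
      (fun x hx => (hderiv x hx).continuousAt.continuousWithinAt) ?_ ?_ <;> rw [interior_Ioc]
    · exact fun x hx => (hderiv x ⟨hx.1, hx.2.le⟩).differentiableAt.differentiableWithinAt
    · intro x hx
      have hxre : 1 / 2 < (x * hankelMoment 1 x).re := hhalf ⟨hx.1, hx.2.le⟩
      rw [Complex.re_ofReal_mul] at hxre
      rw [(hderiv x ⟨hx.1, hx.2.le⟩).deriv]
      have : x⁻¹ * (1 / 2) ≤ x⁻¹ * (x * (hankelMoment 1 x).re) :=
        mul_le_mul_of_nonneg_left hxre.le (inv_nonneg.2 hx.1.le)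
      rw [inv_mul_cancel_left₀ hx.1.ne'] at this
      linarith
  refine ⟨z₀, |(hankelMoment 0 z₀).re + Real.log z₀ / 2| + 1, hz₀, by positivity, fun z hz => ?_⟩
  have h := hanti hz ⟨hz₀, le_rfl⟩ hz.2
  have h' := neg_abs_le ((hankelMoment 0 z₀).re + Real.log z₀ / 2)
  simp only at h
  linarith

lemma exists_norm_hankelMoment_zero_le_log :
    ∃ C K : ℝ, 0 < C ∧ 0 < K ∧ ∀ z ∈ Set.Ioc (0 : ℝ) 1,
      ‖hankelMoment 0 z‖ ≤ C - K * Real.log z := by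
  set K := 1 + 3 * √Real.pi
  refine ⟨‖hankelMoment 0 1‖ + 1, K, by positivity, by positivity, fun z hz => ?_⟩
  have hpos : ∀ x ∈ Set.uIcc z 1, 0 < x := fun x hx => by
    rw [Set.uIcc_of_le hz.2] at hx
    exact hz.1.trans_le hx.1
  have hcont : ContinuousOn (hankelMoment 1) (Set.uIcc z 1) :=
    (continuousOn_hankelMoment 1).mono hpos
  have hftc : hankelMoment 0 z = hankelMoment 0 1 + ∫ x in z..1, hankelMoment 1 x := by
    have h := intervalIntegral.integral_eq_sub_of_hasDerivAt
      (fun x hx => hasDerivAt_hankelMoment 0 (hpos x hx)) hcont.neg.intervalIntegrable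
    rw [intervalIntegral.integral_neg] at h
    linear_combination h
  have hint : ‖∫ x in z..1, hankelMoment 1 x‖ ≤ ∫ x in z..1, K * x⁻¹ := by
    refine intervalIntegral.norm_integral_le_of_norm_le hz.2
      (Eventually.of_forall fun x hx => ?_) (ContinuousOn.intervalIntegrable ?_)
    · have hx0 : 0 < x := hz.1.trans hx.1
      have h := norm_mul_hankelMoment_one_le hx0
      have hsqrt : √(Real.pi * x) ≤ √Real.pi :=
        Real.sqrt_le_sqrt (mul_le_of_le_one_right Real.pi_pos.le hx.2)
      rw [norm_mul, Complex.norm_of_nonneg hx0.le] at h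
      rw [← div_eq_mul_inv, le_div_iff₀ hx0]
      linarith
    · exact continuousOn_const.mul (continuousOn_id.inv₀ fun x hx => (hpos x hx).ne')
  rw [intervalIntegral.integral_const_mul, integral_inv_of_pos hz.1 one_pos, one_div,
    Real.log_inv] at hint
  rw [hftc]
  linarith [norm_add_le (hankelMoment 0 1) (∫ x in z..1, hankelMoment 1 x)]

/-! ### Green's identity in the half-plane -/

/-- The half-plane `ℝ²₊`, as a subset of `ℝ × ℝ`, where the divergence theorem on boxes is
available. -/
def upperProd : Set (ℝ × ℝ) := {p | 0 < p.2}

/-- The derivative of `f` at `p` in the direction `v`. -/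
def dirDeriv (v : ℝ × ℝ) (f : ℝ × ℝ → ℂ) (p : ℝ × ℝ) : ℂ := fderiv ℝ f p v

/-- The partial derivative `∂₁`. -/
abbrev dFst : (ℝ × ℝ → ℂ) → ℝ × ℝ → ℂ := dirDeriv (1, 0)

/-- The partial derivative `∂₂`. -/
abbrev dSnd : (ℝ × ℝ → ℂ) → ℝ × ℝ → ℂ := dirDeriv (0, 1)

/-- The classical solutions of the Helmholtz equation in `ℝ²₊`. -/
structure IsHelmholtz (κ : ℝ) (f : ℝ × ℝ → ℂ) : Prop where
  contDiffOn : ContDiffOn ℝ 2 f upperProd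
  laplacian_add : ∀ p ∈ upperProd, dFst (dFst f) p + dSnd (dSnd f) p + (κ : ℂ) ^ 2 * f p = 0

lemma isOpen_upperProd : IsOpen upperProd := isOpen_lt continuous_const continuous_snd

lemma differentiableAt_upperProd {f : ℝ × ℝ → ℂ} {n : WithTop ℕ∞}
    (hf : ContDiffOn ℝ n f upperProd) (hn : n ≠ 0) {p : ℝ × ℝ} (hp : p ∈ upperProd) :
    DifferentiableAt ℝ f p :=
  (hf.contDiffAt (isOpen_upperProd.mem_nhds hp)).differentiableAt hn

lemma contDiffOn_dirDeriv {f : ℝ × ℝ → ℂ} {m n : WithTop ℕ∞} (hf : ContDiffOn ℝ n f upperProd)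
    (hmn : m + 1 ≤ n) (v : ℝ × ℝ) : ContDiffOn ℝ m (dirDeriv v f) upperProd :=
  (hf.fderiv_of_isOpen isOpen_upperProd hmn).clm_apply contDiffOn_const

lemma dirDeriv_eq_add (v : ℝ × ℝ) (f : ℝ × ℝ → ℂ) (p : ℝ × ℝ) :
    dirDeriv v f p = v.1 * dFst f p + v.2 * dSnd f p := by
  have hv : v = v.1 • ((1 : ℝ), (0 : ℝ)) + v.2 • ((0 : ℝ), (1 : ℝ)) := by ext <;> simp
  simp only [dirDeriv]
  conv_lhs => rw [hv, map_add, map_smul, map_smul, Complex.real_smul, Complex.real_smul]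

lemma dirDeriv_mul_sub_mul {f g χ : ℝ × ℝ → ℂ} {p : ℝ × ℝ} (v : ℝ × ℝ)
    (hf : ContDiffOn ℝ 2 f upperProd) (hg : ContDiffOn ℝ 2 g upperProd)
    (hχ : ContDiffOn ℝ 1 χ upperProd) (hp : p ∈ upperProd) :
    dirDeriv v (fun q => χ q * (g q * dirDeriv v f q - f q * dirDeriv v g q)) p =
      dirDeriv v χ p * (g p * dirDeriv v f p - f p * dirDeriv v g p) +
        χ p * (g p * dirDeriv v (dirDeriv v f) p - f p * dirDeriv v (dirDeriv v g) p) := by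
  have hd {n : WithTop ℕ∞} {u : ℝ × ℝ → ℂ} (hu : ContDiffOn ℝ n u upperProd) (hn : n ≠ 0) :
      HasFDerivAt u (fderiv ℝ u p) p := (differentiableAt_upperProd hu hn hp).hasFDerivAt
  have hdf := hd (contDiffOn_dirDeriv hf one_add_one_eq_two.le v) one_ne_zero
  have hdg := hd (contDiffOn_dirDeriv hg one_add_one_eq_two.le v) one_ne_zero
  have h := (hd hχ one_ne_zero).fun_mul
    (((hd hg two_ne_zero).fun_mul hdf).fun_sub ((hd hf two_ne_zero).fun_mul hdg))
  rw [dirDeriv, h.fderiv]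
  simp only [dirDeriv, add_apply, sub_apply, smul_apply, smul_eq_mul]
  ring

/-- The integrand `∇χ · (g ∇f - f ∇g)` of the bulk term of Green's identity. -/
def greenDensity (f g χ : ℝ × ℝ → ℂ) (p : ℝ × ℝ) : ℂ :=
  dFst χ p * (g p * dFst f p - f p * dFst g p) + dSnd χ p * (g p * dSnd f p - f p * dSnd g p)

lemma green_identity {κ : ℝ} {f g χ : ℝ × ℝ → ℂ} (hf : IsHelmholtz κ f) (hg : IsHelmholtz κ g)
    (hχ : ContDiffOn ℝ 1 χ upperProd) {A h : ℝ} (hh : 0 < h) (hA : h ≤ A)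
    (hχA : ∀ p : ℝ × ℝ, p.1 = -A ∨ p.1 = A ∨ p.2 = A → χ p = 0) :
    ∫ s in (-A)..A, χ (s, h) * (g (s, h) * dSnd f (s, h) - f (s, h) * dSnd g (s, h)) =
      -∫ p in Set.Icc ((-A, h) : ℝ × ℝ) (A, A), greenDensity f g χ p := by
  have hsub : Set.Icc ((-A, h) : ℝ × ℝ) (A, A) ⊆ upperProd := fun p hp => hh.trans_le hp.1.2
  set F : ℝ × ℝ → ℝ × ℝ → ℂ := fun v p => χ p * (g p * dirDeriv v f p - f p * dirDeriv v g p)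
  have hF : ∀ v, ContDiffOn ℝ 1 (F v) upperProd := fun v =>
    hχ.mul (((hg.contDiffOn.of_le one_le_two).mul
      (contDiffOn_dirDeriv hf.contDiffOn one_add_one_eq_two.le v)).sub
        ((hf.contDiffOn.of_le one_le_two).mul
          (contDiffOn_dirDeriv hg.contDiffOn one_add_one_eq_two.le v)))
  have hFd : ∀ v, ∀ p ∈ upperProd, HasFDerivAt (F v) (fderiv ℝ (F v) p) p := fun v p hp =>
    (differentiableAt_upperProd (hF v) one_ne_zero hp).hasFDerivAt
  have hdiv : ∀ p ∈ upperProd,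
      dirDeriv (1, 0) (F (1, 0)) p + dirDeriv (0, 1) (F (0, 1)) p = greenDensity f g χ p := by
    intro p hp
    rw [dirDeriv_mul_sub_mul _ hf.contDiffOn hg.contDiffOn hχ hp,
      dirDeriv_mul_sub_mul _ hf.contDiffOn hg.contDiffOn hχ hp, greenDensity]
    linear_combination (χ p * g p) * hf.laplacian_add p hp - (χ p * f p) * hg.laplacian_add p hp
  have hcont : ∀ v, ContinuousOn (dirDeriv v (F v)) upperProd := fun v =>
    (contDiffOn_dirDeriv (m := 0) (hF v) (zero_add 1).le v).continuousOn
  have hint : IntegrableOn (fun p => dirDeriv (1, 0) (F (1, 0)) p + dirDeriv (0, 1) (F (0, 1)) p)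
      (Set.Icc ((-A, h) : ℝ × ℝ) (A, A)) :=
    (((hcont _).add (hcont _)).mono hsub).integrableOn_compact isCompact_Icc
  have hgauss := integral_divergence_prod_Icc_of_hasFDerivAt_of_le (F (1, 0)) (F (0, 1))
    (fderiv ℝ (F (1, 0))) (fderiv ℝ (F (0, 1))) (-A, h) (A, A) ⟨by simp; linarith, hA⟩
    ((hF _).continuousOn.mono hsub) ((hF _).continuousOn.mono hsub)
    (fun p hp => hFd _ p (hh.trans hp.2.1)) (fun p hp => hFd _ p (hh.trans hp.2.1)) hint
  have hzero : ∀ v p, p.1 = -A ∨ p.1 = A ∨ p.2 = A → F v p = 0 := fun v p hp => by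
    simp [F, hχA p hp]
  have htop : ∀ x, F (0, 1) (x, A) = 0 := fun x => hzero _ _ (by simp)
  have hright : ∀ x, F (1, 0) (A, x) = 0 := fun x => hzero _ _ (by simp)
  have hleft : ∀ x, F (1, 0) (-A, x) = 0 := fun x => hzero _ _ (by simp)
  simp only [htop, hright, hleft, intervalIntegral.integral_zero, add_zero, sub_zero,
    zero_sub] at hgauss
  rw [← setIntegral_congr_fun measurableSet_Icc fun p hp => hdiv p (hsub hp)]
  exact neg_eq_iff_eq_neg.1 hgauss.symm

/-! ### Radial functions -/

/-- The Euclidean distance from `p` to the boundary point `(y, 0)`; for `y = 0` it is the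
Euclidean norm, whereas `‖p‖` is the sup norm. -/
def radius (y : ℝ) (p : ℝ × ℝ) : ℝ := √((p.1 - y) ^ 2 + p.2 ^ 2)

/-- The component of `v` in the direction pointing from `(y, 0)` to `p`. -/
def radialPart (y : ℝ) (p v : ℝ × ℝ) : ℝ := ((p.1 - y) * v.1 + p.2 * v.2) / radius y p

lemma radius_nonneg (y : ℝ) (p : ℝ × ℝ) : 0 ≤ radius y p := Real.sqrt_nonneg _

lemma radius_sq (y : ℝ) (p : ℝ × ℝ) : radius y p ^ 2 = (p.1 - y) ^ 2 + p.2 ^ 2 :=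
  Real.sq_sqrt (by positivity)

lemma continuous_radius (y : ℝ) : Continuous (radius y) := by
  unfold radius
  fun_prop

lemma sq_add_sq_pos {y : ℝ} {p : ℝ × ℝ} (hp : p ∈ upperProd) : 0 < (p.1 - y) ^ 2 + p.2 ^ 2 :=
  add_pos_of_nonneg_of_pos (sq_nonneg _) (pow_pos hp 2)

lemma radius_pos {y : ℝ} {p : ℝ × ℝ} (hp : p ∈ upperProd) : 0 < radius y p :=
  Real.sqrt_pos.2 (sq_add_sq_pos hp)

lemma abs_fst_sub_le_radius (y : ℝ) (p : ℝ × ℝ) : |p.1 - y| ≤ radius y p :=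
  Real.abs_le_sqrt (le_add_of_nonneg_right (sq_nonneg _))

lemma abs_snd_le_radius (y : ℝ) (p : ℝ × ℝ) : |p.2| ≤ radius y p :=
  Real.abs_le_sqrt (le_add_of_nonneg_left (sq_nonneg _))

lemma radius_eq_norm (y : ℝ) (p : ℝ × ℝ) : radius y p = ‖((p.1 + p.2 * I : ℂ)) - y‖ := by
  rw [radius, ← Complex.norm_add_mul_I]
  push_cast
  ring_nf

lemma abs_radius_sub_radius_le (y z : ℝ) (p : ℝ × ℝ) : |radius y p - radius z p| ≤ |y - z| := by
  rw [radius_eq_norm, radius_eq_norm]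
  refine (abs_norm_sub_norm_le _ _).trans_eq ?_
  rw [sub_sub_sub_cancel_left, ← Complex.ofReal_sub, Complex.norm_real, Real.norm_eq_abs,
    abs_sub_comm]

lemma abs_radialPart_le (y : ℝ) (p v : ℝ × ℝ) : |radialPart y p v| ≤ radius 0 v := by
  rw [radialPart, abs_div, abs_of_nonneg (radius_nonneg y p)]
  refine div_le_of_le_mul₀ (radius_nonneg _ _) (radius_nonneg _ _) ?_
  refine abs_le_of_sq_le_sq ?_ (mul_nonneg (radius_nonneg _ _) (radius_nonneg _ _))
  rw [mul_pow, radius_sq, radius_sq]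
  nlinarith [sq_nonneg ((p.1 - y) * v.2 - p.2 * v.1)]

lemma abs_radius_sub_radialPart_le (y : ℝ) {p : ℝ × ℝ} (hp : p ∈ upperProd) :
    |radius 0 p - radialPart y p p| ≤ 2 * |y| := by
  have hρ := radius_pos (y := y) hp
  have hsplit : radius 0 p - radialPart y p p =
      (radius 0 p - radius y p) + -(y * radialPart y p (1, 0)) := by
    rw [radialPart, radialPart]
    field_simp
    linear_combination radius_sq y p
  have hdist := abs_radius_sub_radius_le 0 y p
  have hpart : |radialPart y p (1, 0)| ≤ 1 := by
    simpa [radius] using abs_radialPart_le y p (1, 0)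
  rw [zero_sub, abs_neg] at hdist
  calc |radius 0 p - radialPart y p p|
      ≤ |radius 0 p - radius y p| + |y| * |radialPart y p (1, 0)| := by
        rw [hsplit, ← abs_mul, ← abs_neg (y * _)]
        exact abs_add_le _ _
    _ ≤ |y| + |y| * 1 := by gcongr
    _ = 2 * |y| := by ring

lemma contDiffOn_radius (y : ℝ) {n : WithTop ℕ∞} : ContDiffOn ℝ n (radius y) upperProd := by
  unfold radius
  exact ContDiffOn.sqrt (by fun_prop) fun p hp => (sq_add_sq_pos hp).ne'

lemma fderiv_radius (y : ℝ) {p : ℝ × ℝ} (hp : p ∈ upperProd) (v : ℝ × ℝ) :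
    fderiv ℝ (radius y) p v = radialPart y p v := by
  have hfst : HasFDerivAt (fun q : ℝ × ℝ => q.1 - y) (ContinuousLinearMap.fst ℝ ℝ ℝ) p :=
    hasFDerivAt_fst.sub_const y
  have hsq := (hfst.pow 2).fun_add
    ((hasFDerivAt_snd (𝕜 := ℝ) (E := ℝ) (F := ℝ) (p := p)).pow 2)
  have h : fderiv ℝ (radius y) p = _ := (hsq.sqrt (sq_add_sq_pos hp).ne').fderiv
  rw [h, radialPart, radius]
  simp only [one_div, mul_inv_rev, Nat.add_one_sub_one, pow_one, nsmul_eq_mul, Nat.cast_ofNat,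
    smul_add, add_apply, smul_apply, ContinuousLinearMap.coe_fst', smul_eq_mul,
    ContinuousLinearMap.coe_snd']
  ring

lemma hasFDerivAt_radius (y : ℝ) {p : ℝ × ℝ} (hp : p ∈ upperProd) :
    HasFDerivAt (radius y) (fderiv ℝ (radius y) p) p :=
  (((contDiffOn_radius y).contDiffAt (isOpen_upperProd.mem_nhds hp)).differentiableAt
    one_ne_zero).hasFDerivAt

lemma dirDeriv_comp_radius {y : ℝ} {φ : ℝ → ℂ} {φ' : ℂ} {p : ℝ × ℝ} (hp : p ∈ upperProd)
    (hφ : HasDerivAt φ φ' (radius y p)) (v : ℝ × ℝ) :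
    dirDeriv v (fun q => φ (radius y q)) p = radialPart y p v * φ' := by
  have h : fderiv ℝ (fun q => φ (radius y q)) p = _ :=
    (hφ.hasFDerivAt.comp p (hasFDerivAt_radius y hp)).fderiv
  rw [dirDeriv, h, ContinuousLinearMap.comp_apply, fderiv_radius y hp]
  simp only [ContinuousLinearMap.toSpanSingleton_apply, Complex.real_smul]

lemma dirDeriv_dirDeriv_comp_radius {y : ℝ} {φ φ₁ : ℝ → ℂ} {φ₂ : ℂ} {p : ℝ × ℝ}
    (hp : p ∈ upperProd) (hφ : ∀ r, 0 < r → HasDerivAt φ (φ₁ r) r)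
    (hφ₁ : HasDerivAt φ₁ φ₂ (radius y p)) (v : ℝ × ℝ) :
    dirDeriv v (dirDeriv v fun q => φ (radius y q)) p =
      (radialPart y p v ^ 2 : ℝ) * φ₂ +
        ((v.1 ^ 2 + v.2 ^ 2 - radialPart y p v ^ 2) / radius y p : ℝ) * φ₁ (radius y p) := by
  have hr := radius_pos (y := y) hp
  have hψ : HasDerivAt (fun r : ℝ => φ₁ r / r)
      ((φ₂ * radius y p - φ₁ (radius y p) * 1) / (radius y p : ℂ) ^ 2) (radius y p) :=
    hφ₁.fun_div Complex.ofRealCLM.hasDerivAt (by exact_mod_cast hr.ne')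
  have hfactor : dirDeriv v (fun q => φ (radius y q)) =ᶠ[𝓝 p] fun q =>
      (((q.1 - y) * v.1 + q.2 * v.2 : ℝ) : ℂ) * (φ₁ (radius y q) / radius y q) := by
    filter_upwards [isOpen_upperProd.mem_nhds hp] with q hq
    rw [dirDeriv_comp_radius hq (hφ _ (radius_pos hq)), radialPart]
    push_cast
    ring
  have hlin : HasFDerivAt (fun q : ℝ × ℝ => (q.1 - y) * v.1 + q.2 * v.2)
      (v.1 • ContinuousLinearMap.fst ℝ ℝ ℝ + v.2 • ContinuousLinearMap.snd ℝ ℝ ℝ) p :=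
    ((hasFDerivAt_fst.sub_const y).mul_const v.1).add (hasFDerivAt_snd.mul_const v.2)
  have hcoeff : HasFDerivAt (fun q : ℝ × ℝ => (((q.1 - y) * v.1 + q.2 * v.2 : ℝ) : ℂ)) _ p :=
    Complex.ofRealCLM.hasFDerivAt.comp p hlin
  have hquot : HasFDerivAt (fun q => φ₁ (radius y q) / (radius y q : ℂ)) _ p :=
    hψ.hasFDerivAt.comp p (hasFDerivAt_radius y hp)
  have hprod := congrArg (fun L => L v) (hcoeff.fun_mul hquot).fderiv
  have hdot : (p.1 - y) * v.1 + p.2 * v.2 = radialPart y p v * radius y p := by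
    rw [radialPart, div_mul_cancel₀ _ hr.ne']
  rw [dirDeriv, hfactor.fderiv_eq]
  refine hprod.trans ?_
  have hr' : (radius y p : ℂ) ≠ 0 := by exact_mod_cast hr.ne'
  rw [hdot]
  simp only [add_apply, smul_apply, ContinuousLinearMap.comp_apply, fderiv_radius y hp,
    ContinuousLinearMap.coe_fst', ContinuousLinearMap.coe_snd', smul_eq_mul]
  simp only [Complex.ofReal_mul, mul_one, ContinuousLinearMap.toSpanSingleton_apply,
    Complex.real_smul, Complex.ofRealCLM_apply, Complex.ofReal_add, Complex.ofReal_pow,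
    Complex.ofReal_div, Complex.ofReal_sub]
  field_simp
  ring

/-! ### Cylindrical waves -/

/-- The cylindrical wave `r ↦ (π i / 2) H₀⁽¹⁾(κ r)` emitted from the boundary point `(y, 0)`. -/
def hankelWave (κ y : ℝ) (p : ℝ × ℝ) : ℂ := hankelMoment 0 (κ * radius y p)

lemma hasDerivAt_hankelMoment_mul {κ r : ℝ} (k : ℕ) (hκ : 0 < κ) (hr : 0 < r) :
    HasDerivAt (fun t => hankelMoment k (κ * t)) (-κ * hankelMoment (k + 1) (κ * r)) r := by
  have h := (hasDerivAt_hankelMoment k (mul_pos hκ hr)).scomp r ((hasDerivAt_id r).const_mul κ)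
  refine h.congr_deriv ?_
  simp

lemma dirDeriv_hankelWave {κ : ℝ} (hκ : 0 < κ) (y : ℝ) {p : ℝ × ℝ} (hp : p ∈ upperProd)
    (v : ℝ × ℝ) :
    dirDeriv v (hankelWave κ y) p =
      radialPart y p v * (-κ * hankelMoment 1 (κ * radius y p)) :=
  dirDeriv_comp_radius hp (hasDerivAt_hankelMoment_mul 0 hκ (radius_pos hp)) v

lemma isHelmholtz_hankelWave {κ : ℝ} (hκ : 0 < κ) (y : ℝ) :
    IsHelmholtz κ (hankelWave κ y) where
  contDiffOn := (contDiffOn_hankelMoment 2 0).comp (contDiffOn_const.mul (contDiffOn_radius y))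
    fun _ hp => mul_pos hκ (radius_pos hp)
  laplacian_add p hp := by
    have hr := radius_pos (y := y) hp
    have hφ₁ : HasDerivAt (fun r => -κ * hankelMoment 1 (κ * r))
        (-κ * (-κ * hankelMoment 2 (κ * radius y p))) (radius y p) :=
      (hasDerivAt_hankelMoment_mul 1 hκ hr).const_mul _
    have hsecond : ∀ v, dirDeriv v (dirDeriv v (hankelWave κ y)) p = _ :=
      dirDeriv_dirDeriv_comp_radius hp (fun r => hasDerivAt_hankelMoment_mul 0 hκ) hφ₁
    have hunit : radialPart y p (1, 0) ^ 2 + radialPart y p (0, 1) ^ 2 = 1 := by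
      rw [radialPart, radialPart, div_pow, div_pow, ← add_div, radius_sq,
        div_eq_one_iff_eq (sq_add_sq_pos hp).ne']
      ring
    have hunit' : (radialPart y p (0, 1) : ℂ) ^ 2 = 1 - (radialPart y p (1, 0) : ℂ) ^ 2 := by
      exact_mod_cast eq_sub_of_add_eq' hunit
    have hr' : (radius y p : ℂ) ≠ 0 := by exact_mod_cast hr.ne'
    have hbessel := hankelMoment_bessel (mul_pos hκ hr)
    push_cast at hbessel
    rw [dFst, dSnd, hsecond, hsecond, hankelWave]
    push_cast
    rw [hunit']
    field_simp
    linear_combination (κ : ℂ) * hbessel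

lemma radius_zero_le_two_mul_radius {y : ℝ} {p : ℝ × ℝ} (hy : 2 * |y| ≤ radius 0 p) :
    radius 0 p ≤ 2 * radius y p := by
  have h := (abs_le.1 (abs_radius_sub_radius_le 0 y p)).2
  rw [zero_sub, abs_neg] at h
  linarith

lemma sqrt_pi_div_mul_radius_le {κ y : ℝ} (hκ : 0 < κ) {p : ℝ × ℝ} (hp : p ∈ upperProd)
    (hy : 2 * |y| ≤ radius 0 p) :
    √(Real.pi / (κ * radius y p)) ≤ √(2 * Real.pi / κ) / √(radius 0 p) := by
  have hr₀ := radius_pos (y := 0) hp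
  have hhalf : radius 0 p / 2 ≤ radius y p :=
    (div_le_iff₀' two_pos).2 (radius_zero_le_two_mul_radius hy)
  have hbound : Real.pi / (κ * radius y p) ≤ Real.pi / (κ * (radius 0 p / 2)) := by gcongr
  rw [← Real.sqrt_div (by positivity)]
  refine Real.sqrt_le_sqrt (hbound.trans_eq ?_)
  field_simp

lemma norm_hankelWave_le {κ y : ℝ} (hκ : 0 < κ) {p : ℝ × ℝ} (hp : p ∈ upperProd)
    (hy : 2 * |y| ≤ radius 0 p) :
    ‖hankelWave κ y p‖ ≤ √(2 * Real.pi / κ) / √(radius 0 p) :=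
  (norm_hankelMoment_zero_le (mul_pos hκ (radius_pos hp))).trans
    (sqrt_pi_div_mul_radius_le hκ hp hy)

/-- The radiation condition is centred at the origin although the wave is emitted from `(y, 0)`:
the discrepancy `r - (p · (p - y)) / |p - y|` of the radial derivatives stays bounded. -/
lemma norm_hankelWave_radiation_le {κ y : ℝ} (hκ : 0 < κ) {p : ℝ × ℝ} (hp : p ∈ upperProd)
    (hy : 2 * |y| ≤ radius 0 p) :
    ‖dirDeriv p (hankelWave κ y) p - I * κ * radius 0 p * hankelWave κ y p‖ ≤
      √(2 * Real.pi / κ) * (1 + 2 * κ * |y|) / √(radius 0 p) := by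
  set X := radialPart y p p
  set H₀ := hankelMoment 0 (κ * radius y p)
  set H₁ := hankelMoment 1 (κ * radius y p)
  set B := √(Real.pi / (κ * radius y p))
  have hz : 0 < κ * radius y p := mul_pos hκ (radius_pos hp)
  have hB : B ≤ √(2 * Real.pi / κ) / √(radius 0 p) := sqrt_pi_div_mul_radius_le hκ hp hy
  have hsplit : dirDeriv p (hankelWave κ y) p - I * κ * radius 0 p * hankelWave κ y p =
      -κ * (X * (H₁ + I * H₀) + (radius 0 p - X : ℝ) * (I * H₀)) := by
    rw [dirDeriv_hankelWave hκ y hp, hankelWave]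
    push_cast
    ring
  have hmain : κ * (|X| * ‖H₁ + I * H₀‖) ≤ B :=
    calc κ * (|X| * ‖H₁ + I * H₀‖)
        ≤ κ * (2 * radius y p * (B / (2 * (κ * radius y p)))) := by
          have hX := (abs_radialPart_le y p p).trans (radius_zero_le_two_mul_radius hy)
          have hH := norm_hankelMoment_radiation_le hz
          have hr := radius_nonneg y p
          gcongr
      _ = B := by
          have hr := radius_pos (y := y) hp
          field_simp
  have hrest : κ * (|radius 0 p - X| * ‖I * H₀‖) ≤ κ * (2 * |y| * B) := by
    rw [norm_mul, Complex.norm_I, one_mul]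
    gcongr
    · exact abs_radius_sub_radialPart_le y hp
    · exact norm_hankelMoment_zero_le hz
  rw [hsplit, norm_mul, norm_neg, Complex.norm_real, Real.norm_of_nonneg hκ.le]
  calc κ * ‖X * (H₁ + I * H₀) + (radius 0 p - X : ℝ) * (I * H₀)‖
      ≤ κ * (|X| * ‖H₁ + I * H₀‖ + |radius 0 p - X| * ‖I * H₀‖) := by
        gcongr
        refine (norm_add_le _ _).trans_eq ?_
        rw [norm_mul (X : ℂ), norm_mul ((radius 0 p - X : ℝ) : ℂ), Complex.norm_real,
          Complex.norm_real, Real.norm_eq_abs, Real.norm_eq_abs]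
    _ ≤ B + κ * (2 * |y| * B) := by
        rw [mul_add]
        exact add_le_add hmain hrest
    _ = B * (1 + 2 * κ * |y|) := by ring
    _ ≤ √(2 * Real.pi / κ) / √(radius 0 p) * (1 + 2 * κ * |y|) := by gcongr
    _ = _ := by ring

lemma norm_dirDeriv_hankelWave_le {κ : ℝ} (hκ : 0 < κ) (y : ℝ) {p : ℝ × ℝ} (hp : p ∈ upperProd)
    (v : ℝ × ℝ) :
    ‖dirDeriv v (hankelWave κ y) p‖ ≤ radius 0 v * (κ * ‖hankelMoment 1 (κ * radius y p)‖) := by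
  rw [dirDeriv_hankelWave hκ y hp, norm_mul, norm_mul, norm_neg, Complex.norm_real,
    Complex.norm_real, Real.norm_eq_abs, Real.norm_of_nonneg hκ.le]
  gcongr
  exact abs_radialPart_le y p v

/-! ### Radial cutoffs -/

/-- A smooth function equal to `1` on `(-∞, 1]` and to `0` on `[2, ∞)`. -/
def cutoff (x : ℝ) : ℝ := Real.smoothTransition (2 - x)

lemma contDiff_cutoff {n : ℕ∞} : ContDiff ℝ n cutoff :=
  Real.smoothTransition.contDiff.comp (contDiff_const.sub contDiff_id)

lemma cutoff_of_le_one {x : ℝ} (hx : x ≤ 1) : cutoff x = 1 :=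
  Real.smoothTransition.one_of_one_le (by linarith)

lemma cutoff_of_two_le {x : ℝ} (hx : 2 ≤ x) : cutoff x = 0 :=
  Real.smoothTransition.zero_of_nonpos (by linarith)

lemma cutoff_nonneg (x : ℝ) : 0 ≤ cutoff x := Real.smoothTransition.nonneg _

lemma cutoff_le_one (x : ℝ) : cutoff x ≤ 1 := Real.smoothTransition.le_one _

lemma deriv_cutoff_eq_zero {x : ℝ} (hx : x ∉ Set.Icc 1 2) : deriv cutoff x = 0 := by
  rw [Set.mem_Icc, not_and_or, not_le, not_le] at hx
  rcases hx with hx | hx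
  · have h : cutoff =ᶠ[𝓝 x] fun _ => 1 := by
      filter_upwards [gt_mem_nhds hx] with t ht using cutoff_of_le_one ht.le
    rw [h.deriv_eq, deriv_const]
  · have h : cutoff =ᶠ[𝓝 x] fun _ => 0 := by
      filter_upwards [lt_mem_nhds hx] with t ht using cutoff_of_two_le ht.le
    rw [h.deriv_eq, deriv_const]

lemma exists_abs_deriv_cutoff_le : ∃ K, 0 < K ∧ ∀ x, |deriv cutoff x| ≤ K := by
  have hcont : Continuous (deriv cutoff) := (contDiff_cutoff (n := 1)).continuous_deriv le_rfl
  obtain ⟨C, hC⟩ := (isCompact_Icc (a := (1 : ℝ)) (b := 2)).exists_bound_of_continuousOn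
    hcont.continuousOn
  refine ⟨max C 1, by positivity, fun x => ?_⟩
  by_cases hx : x ∈ Set.Icc (1 : ℝ) 2
  · exact (hC x hx).trans (le_max_left _ _)
  · rw [deriv_cutoff_eq_zero hx, abs_zero]
    positivity

/-- A cutoff equal to `1` on the disc of radius `ρ` around `(b, 0)` and supported in the
concentric disc of radius `2 ρ`. -/
def discCutoff (b ρ : ℝ) (p : ℝ × ℝ) : ℂ := cutoff (radius b p / ρ)

lemma continuous_discCutoff (b ρ : ℝ) : Continuous (discCutoff b ρ) :=
  Complex.continuous_ofReal.comp
    ((contDiff_cutoff (n := 0)).continuous.comp ((continuous_radius b).div_const ρ))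

lemma contDiffOn_discCutoff (b ρ : ℝ) {n : ℕ∞} : ContDiffOn ℝ n (discCutoff b ρ) upperProd :=
  (Complex.ofRealCLM.contDiff.comp contDiff_cutoff).comp_contDiffOn
    ((contDiffOn_radius b).div_const ρ)

lemma norm_discCutoff_le_one (b ρ : ℝ) (p : ℝ × ℝ) : ‖discCutoff b ρ p‖ ≤ 1 := by
  rw [discCutoff, Complex.norm_real, Real.norm_of_nonneg (cutoff_nonneg _)]
  exact cutoff_le_one _

lemma discCutoff_eq_one {b ρ : ℝ} (hρ : 0 < ρ) {p : ℝ × ℝ} (hp : radius b p ≤ ρ) :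
    discCutoff b ρ p = 1 := by
  rw [discCutoff, cutoff_of_le_one ((div_le_one hρ).2 hp), Complex.ofReal_one]

lemma discCutoff_eq_zero {b ρ : ℝ} (hρ : 0 < ρ) {p : ℝ × ℝ} (hp : 2 * ρ ≤ radius b p) :
    discCutoff b ρ p = 0 := by
  rw [discCutoff, cutoff_of_two_le ((le_div_iff₀ hρ).2 hp), Complex.ofReal_zero]

lemma dirDeriv_discCutoff (b ρ : ℝ) {p : ℝ × ℝ} (hp : p ∈ upperProd) (v : ℝ × ℝ) :
    dirDeriv v (discCutoff b ρ) p =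
      radialPart b p v * ((deriv cutoff (radius b p / ρ) / ρ : ℝ) : ℂ) := by
  have hderiv : HasDerivAt cutoff (deriv cutoff (radius b p / ρ)) (radius b p / ρ) :=
    ((contDiff_cutoff (n := 1)).differentiable one_ne_zero).differentiableAt.hasDerivAt
  have h := (hderiv.comp (radius b p) ((hasDerivAt_id _).div_const ρ)).ofReal_comp
  rw [mul_one_div] at h
  exact dirDeriv_comp_radius hp h v

lemma greenDensity_discCutoff (f g : ℝ × ℝ → ℂ) (b ρ : ℝ) {p : ℝ × ℝ} (hp : p ∈ upperProd) :
    greenDensity f g (discCutoff b ρ) p = (deriv cutoff (radius b p / ρ) / (ρ * radius b p) : ℝ) *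
      (g p * dirDeriv (p - (b, 0)) f p - f p * dirDeriv (p - (b, 0)) g p) := by
  have hr : (radius b p : ℂ) ≠ 0 := by exact_mod_cast (radius_pos hp).ne'
  rw [greenDensity, dFst, dSnd, dirDeriv_discCutoff b ρ hp, dirDeriv_discCutoff b ρ hp,
    dirDeriv_eq_add (p - (b, 0)), dirDeriv_eq_add (p - (b, 0)), radialPart, radialPart]
  push_cast
  field_simp
  simp only [mul_zero, add_zero, zero_add, Prod.fst_sub, Complex.ofReal_sub, Prod.snd_sub,
    sub_zero]
  ring

/-! ### Radiating fields driven by the aperture -/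

/-- The half-box `(b - s, b + s) × (0, s)` around the boundary point `(b, 0)`. -/
def halfBox (b s : ℝ) : Set (ℝ × ℝ) := Set.Ioo (b - s) (b + s) ×ˢ Set.Ioo 0 s

/-- The closed half-plane without the two end points of the aperture. -/
def closedUpper (ε : ℝ) : Set (ℝ × ℝ) := {p | 0 ≤ p.2 ∧ p ≠ (0, 0) ∧ p ≠ (ε, 0)}

/-- The `H¹` energy density. -/
def energyDensity (W : ℝ × ℝ → ℂ) (p : ℝ × ℝ) : ℝ := ‖dFst W p‖ ^ 2 + ‖dSnd W p‖ ^ 2 + ‖W p‖ ^ 2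

/-- A radiating Helmholtz field in `ℝ²₊` with normal derivative `c` on the aperture
`(0, ε) × {0}` and `0` on the rest of the boundary line; the field `v - uⁱⁿᶜ - uʳᵉᶠ` of the cavity
problem is of this kind. -/
structure IsApertureField (κ ε : ℝ) (c : ℂ) (W : ℝ × ℝ → ℂ) : Prop extends IsHelmholtz κ W where
  continuousOn : ContinuousOn W (closedUpper ε)
  energy : ∀ R, IntegrableOn (energyDensity W) (halfBox 0 R)
  neumann : ∀ t ∉ Set.Icc 0 ε, Tendsto (dSnd W) (𝓝[upperProd] (t, 0)) (𝓝 0)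
  aperture : ∀ t ∈ Set.Ioo 0 ε, Tendsto (dSnd W) (𝓝[upperProd] (t, 0)) (𝓝 c)
  radiation : ∀ η > 0, ∃ R, ∀ p ∈ upperProd, R ≤ radius 0 p →
    ‖dirDeriv p W p - I * κ * radius 0 p * W p‖ ≤ η * √(radius 0 p)

lemma norm_le_of_norm_deriv_sub_le {g g' : ℝ → ℂ} {κ η a b : ℝ} (ha : 0 < a) (hab : a ≤ b)
    (hg : ∀ s, a ≤ s → HasDerivAt g (g' s) s)
    (hrad : ∀ s, a ≤ s → ‖g' s - I * κ * g s‖ ≤ η / √s) :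
    ‖g b‖ ≤ ‖g a‖ + 2 * η * (√b - √a) := by
  set phase : ℝ → ℂ := fun s => Complex.exp (-(I * κ * s))
  have hphase : ∀ s, ‖phase s‖ = 1 := fun s => by simp [phase, Complex.norm_exp]
  have hphase' : ∀ s, HasDerivAt phase (phase s * -(I * κ * 1)) s := fun s =>
    ((Complex.ofRealCLM.hasDerivAt (x := s)).const_mul (I * κ)).neg.cexp
  have hderiv : ∀ s, a ≤ s → HasDerivAt (fun t => phase t * g t)
      (phase s * (g' s - I * κ * g s)) s := fun s hs =>
    ((hphase' s).fun_mul (hg s hs)).congr_deriv (by ring)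
  have hbound : ∀ s, a ≤ s →
      HasDerivAt (fun t => ‖g a‖ + 2 * η * (√t - √a)) (η / √s) s := fun s hs => by
    have hs0 := Real.sqrt_pos.2 (ha.trans_le hs)
    refine ((((Real.hasDerivAt_sqrt (ha.trans_le hs).ne').sub_const _).const_mul _).const_add
      _).congr_deriv ?_
    field_simp
  have h := image_norm_le_of_norm_deriv_right_le_deriv_boundary'
    (fun s hs => (hderiv s hs.1).continuousAt.continuousWithinAt)
    (fun s hs => (hderiv s hs.1).hasDerivWithinAt)
    (by rw [norm_mul, hphase, sub_self, mul_zero, one_mul, add_zero])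
    (fun s hs => (hbound s hs.1).continuousAt.continuousWithinAt)
    (fun s hs => (hbound s hs.1).hasDerivWithinAt)
    (fun s hs => by rw [norm_mul, hphase, one_mul]; exact hrad s hs.1) (Set.right_mem_Icc.2 hab)
  rwa [norm_mul, hphase, one_mul] at h

lemma radius_zero_smul {s : ℝ} (hs : 0 ≤ s) (p : ℝ × ℝ) :
    radius 0 (s • p) = s * radius 0 p := by
  refine (sq_eq_sq₀ (radius_nonneg _ _) (mul_nonneg hs (radius_nonneg _ _))).1 ?_
  rw [mul_pow, radius_sq, radius_sq, Prod.smul_fst, Prod.smul_snd, smul_eq_mul, smul_eq_mul]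
  ring

lemma isCompact_halfCircle (R : ℝ) : IsCompact {p : ℝ × ℝ | 0 ≤ p.2 ∧ radius 0 p = R} := by
  refine (isCompact_Icc (a := ((-R, -R) : ℝ × ℝ)) (b := (R, R))).of_isClosed_subset
    ((isClosed_le continuous_const continuous_snd).inter
      (isClosed_eq (continuous_radius 0) continuous_const)) ?_
  rintro p ⟨-, rfl⟩
  have hfst := abs_fst_sub_le_radius 0 p
  rw [sub_zero] at hfst
  exact ⟨⟨(abs_le.1 hfst).1, (abs_le.1 (abs_snd_le_radius 0 p)).1⟩,
    ⟨(abs_le.1 hfst).2, (abs_le.1 (abs_snd_le_radius 0 p)).2⟩⟩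

section
variable {κ ε : ℝ} {c : ℂ} {W : ℝ × ℝ → ℂ}

lemma IsApertureField.norm_le_along_ray (hW : IsApertureField κ ε c W) {η a : ℝ} (ha : 0 < a)
    (hrad : ∀ p ∈ upperProd, a ≤ radius 0 p →
      ‖dirDeriv p W p - I * κ * radius 0 p * W p‖ ≤ η * √(radius 0 p))
    {p : ℝ × ℝ} (hp : p ∈ upperProd) (hap : a ≤ radius 0 p) :
    ‖W p‖ ≤ ‖W ((a / radius 0 p) • p)‖ + 2 * η * (√(radius 0 p) - √a) := by
  have hr := radius_pos (y := 0) hp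
  set u := (radius 0 p)⁻¹ • p with hu
  have hmem : ∀ s, a ≤ s → s • u ∈ upperProd := fun s hs =>
    mul_pos (ha.trans_le hs) (mul_pos (inv_pos.2 hr) hp)
  have hradius : ∀ s, a ≤ s → radius 0 (s • u) = s := fun s hs => by
    rw [hu, smul_smul, ← div_eq_mul_inv, radius_zero_smul (div_nonneg (ha.le.trans hs) hr.le),
      div_mul_cancel₀ _ hr.ne']
  have hderiv : ∀ s, a ≤ s → HasDerivAt (fun t : ℝ => W (t • u)) (dirDeriv u W (s • u)) s :=
    fun s hs => by
      have hray : HasDerivAt (fun t : ℝ => t • u) u s := by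
        simpa using (hasDerivAt_id s).smul_const u
      exact (differentiableAt_upperProd hW.contDiffOn two_ne_zero
        (hmem s hs)).hasFDerivAt.comp_hasDerivAt s hray
  have hslope : ∀ s, a ≤ s → ‖dirDeriv u W (s • u) - I * κ * W (s • u)‖ ≤ η / √s := fun s hs => by
    have hs0 := ha.trans_le hs
    have h := hrad _ (hmem s hs) ((hradius s hs).symm ▸ hs)
    have hfactor : dirDeriv (s • u) W (s • u) - I * κ * s * W (s • u) =
        s * (dirDeriv u W (s • u) - I * κ * W (s • u)) := by
      rw [dirDeriv, map_smul, Complex.real_smul, dirDeriv]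
      ring
    rw [hradius s hs, hfactor, norm_mul, Complex.norm_real, Real.norm_of_nonneg hs0.le] at h
    refine ((le_div_iff₀' hs0).2 h).trans_eq ?_
    rw [mul_div_assoc, Real.sqrt_div_self', mul_one_div]
  have h := norm_le_of_norm_deriv_sub_le ha hap hderiv hslope
  rwa [hu, smul_smul, smul_smul, mul_inv_cancel₀ hr.ne', one_smul, ← div_eq_mul_inv] at h

lemma IsApertureField.norm_le_sqrt_radius (hW : IsApertureField κ ε c W) (hε : 0 < ε) {η : ℝ}
    (hη : 0 < η) : ∃ R, ∀ p ∈ upperProd, R ≤ radius 0 p → ‖W p‖ ≤ η * √(radius 0 p) := by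
  obtain ⟨R₀, hR₀⟩ := hW.radiation (η / 4) (by positivity)
  set R₁ := max R₀ (ε + 1)
  have hεR₁ : ε < R₁ := (lt_add_one ε).trans_le (le_max_right _ _)
  have hR₁ : 0 < R₁ := hε.trans hεR₁
  obtain ⟨M, hM⟩ := (isCompact_halfCircle R₁).exists_bound_of_continuousOn <|
    hW.continuousOn.mono (by
      rintro p ⟨hp, hpR⟩
      refine ⟨hp, ?_, ?_⟩ <;> rintro rfl
      · exact hR₁.ne (by simpa [radius] using hpR)
      · exact hεR₁.ne (by simpa [radius, Real.sqrt_sq hε.le] using hpR))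
  refine ⟨max R₁ ((2 * M / η) ^ 2), fun p hp hpR => ?_⟩
  have hR₁p : R₁ ≤ radius 0 p := (le_max_left _ _).trans hpR
  have hr := hR₁.trans_le hR₁p
  have hMp : 2 * M / η ≤ √(radius 0 p) := Real.le_sqrt_of_sq_le ((le_max_right _ _).trans hpR)
  have hcircle : ‖W ((R₁ / radius 0 p) • p)‖ ≤ M :=
    hM _ ⟨(mul_pos (div_pos hR₁ hr) hp).le, by
      rw [radius_zero_smul (div_pos hR₁ hr).le, div_mul_cancel₀ _ hr.ne']⟩
  have hray := hW.norm_le_along_ray hR₁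
    (fun q hq hqR => hR₀ q hq ((le_max_left _ _).trans hqR)) hp hR₁p
  rw [div_le_iff₀ hη] at hMp
  have hpos := mul_nonneg hη.le (Real.sqrt_nonneg R₁)
  linarith

lemma volume_real_Icc_prod {a b c d : ℝ} (hab : a ≤ b) (hcd : c ≤ d) :
    volume.real (Set.Icc ((a, c) : ℝ × ℝ) (b, d)) = (b - a) * (d - c) := by
  rw [← Set.Icc_prod_Icc, Measure.volume_eq_prod, measureReal_prod_prod,
    Real.volume_real_Icc_of_le hab, Real.volume_real_Icc_of_le hcd]

/-- Green's density only sees `∂_r - iκ`, which both radiating fields nearly annihilate. -/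
lemma norm_greenDensity_far_le {E : ℝ × ℝ → ℂ} {K C η R : ℝ} {p : ℝ × ℝ} (hR : 0 < R)
    (hp : p ∈ upperProd) (hK : ∀ x, |deriv cutoff x| ≤ K)
    (hE : R ≤ radius 0 p → ‖E p‖ ≤ C / √(radius 0 p) ∧
      ‖dirDeriv p E p - I * κ * radius 0 p * E p‖ ≤ C / √(radius 0 p))
    (hW : R ≤ radius 0 p → ‖W p‖ ≤ η * √(radius 0 p) ∧
      ‖dirDeriv p W p - I * κ * radius 0 p * W p‖ ≤ η * √(radius 0 p)) (hCη : 0 ≤ C * η) :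
    ‖greenDensity W E (discCutoff 0 R) p‖ ≤ K / R ^ 2 * (2 * (C * η)) := by
  have hr := radius_pos (y := 0) hp
  have hK₀ : 0 ≤ K := (abs_nonneg _).trans (hK 0)
  rw [greenDensity_discCutoff _ _ _ _ hp, norm_mul, Complex.norm_real, Real.norm_eq_abs, abs_div,
    abs_of_pos (mul_pos hR hr), Prod.mk_zero_zero, sub_zero]
  by_cases hsmall : radius 0 p / R < 1
  · rw [deriv_cutoff_eq_zero fun h => hsmall.not_ge h.1, abs_zero, zero_div, zero_mul]
    positivity
  have hRr : R ≤ radius 0 p := (one_le_div hR).1 (not_lt.1 hsmall)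
  have hbracket : ‖E p * dirDeriv p W p - W p * dirDeriv p E p‖ ≤ 2 * (C * η) := by
    have hinsert : E p * dirDeriv p W p - W p * dirDeriv p E p =
        E p * (dirDeriv p W p - I * κ * radius 0 p * W p) -
          W p * (dirDeriv p E p - I * κ * radius 0 p * E p) := by ring
    have := Real.sqrt_pos.2 hr
    rw [hinsert]
    refine (norm_sub_le _ _).trans ?_
    rw [norm_mul, norm_mul]
    calc _ ≤ C / √(radius 0 p) * (η * √(radius 0 p)) +
          η * √(radius 0 p) * (C / √(radius 0 p)) := by
          gcongr
          exacts [(norm_nonneg _).trans (hE hRr).1, (hE hRr).1, (hW hRr).2,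
            (norm_nonneg _).trans (hW hRr).1, (hW hRr).1, (hE hRr).2]
      _ = 2 * (C * η) := by field_simp; ring
  have hcoeff : |deriv cutoff (radius 0 p / R)| / (R * radius 0 p) ≤ K / R ^ 2 := by
    rw [sq]
    gcongr
    exact hK _
  gcongr

lemma IsApertureField.exists_far_bulk_le (hW : IsApertureField κ ε c W) (hκ : 0 < κ) (hε : 0 < ε)
    (y : ℝ) {η : ℝ} (hη : 0 < η) :
    ∃ R₀, ∀ R, R₀ ≤ R → ∀ h, 0 < h → h ≤ 2 * R →
      ‖∫ p in Set.Icc ((-(2 * R), h) : ℝ × ℝ) (2 * R, 2 * R),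
        greenDensity W (hankelWave κ y) (discCutoff 0 R) p‖ ≤ η := by
  obtain ⟨K, hK, hKb⟩ := exists_abs_deriv_cutoff_le
  set C := √(2 * Real.pi / κ) * (1 + 2 * κ * |y|)
  have hC : 0 < C := by positivity
  have hC' : √(2 * Real.pi / κ) ≤ C := le_mul_of_one_le_right (Real.sqrt_nonneg _)
    (le_add_of_nonneg_right (by positivity))
  set η' := η / (16 * K * C) with hη'
  have hη'₀ : 0 < η' := by positivity
  obtain ⟨R₁, hR₁⟩ := hW.norm_le_sqrt_radius hε hη'₀
  obtain ⟨R₂, hR₂⟩ := hW.radiation η' hη'₀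
  refine ⟨max (2 * |y| + 1) (max R₁ R₂), fun R hR h hh hhR => ?_⟩
  obtain ⟨hRy, hRR₁, hRR₂⟩ : 2 * |y| + 1 ≤ R ∧ R₁ ≤ R ∧ R₂ ≤ R := by
    simpa only [max_le_iff] using hR
  have hR₀ : 0 < R := (by positivity : 0 < 2 * |y| + 1).trans_le hRy
  have hbound : ∀ p ∈ Set.Icc ((-(2 * R), h) : ℝ × ℝ) (2 * R, 2 * R),
      ‖greenDensity W (hankelWave κ y) (discCutoff 0 R) p‖ ≤ K / R ^ 2 * (2 * (C * η')) := by
    intro p hp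
    have hpu : p ∈ upperProd := hh.trans_le hp.1.2
    refine norm_greenDensity_far_le hR₀ hpu hKb (fun hRp => ?_)
      (fun hRp => ⟨hR₁ p hpu (hRR₁.trans hRp), hR₂ p hpu (hRR₂.trans hRp)⟩) (by positivity)
    have hy : 2 * |y| ≤ radius 0 p := by linarith
    exact ⟨(norm_hankelWave_le hκ hpu hy).trans (by gcongr), norm_hankelWave_radiation_le hκ hpu hy⟩
  refine (norm_setIntegral_le_of_norm_le_const isCompact_Icc.measure_lt_top hbound).trans ?_
  rw [volume_real_Icc_prod (by linarith) hhR]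
  calc K / R ^ 2 * (2 * (C * η')) * ((2 * R - -(2 * R)) * (2 * R - h))
      ≤ K / R ^ 2 * (2 * (C * η')) * ((2 * R - -(2 * R)) * (2 * R)) := by
        gcongr <;> linarith
    _ = η := by
        rw [hη']
        field_simp
        ring

lemma volume_halfBox {b s : ℝ} (hs : 0 ≤ s) :
    volume (halfBox b s) = ENNReal.ofReal (2 * s ^ 2) := by
  rw [halfBox, Measure.volume_eq_prod, Measure.prod_prod, Real.volume_Ioo, Real.volume_Ioo,
    ← ENNReal.ofReal_mul (by linarith)]
  ring_nf

lemma measurableSet_halfBox (b s : ℝ) : MeasurableSet (halfBox b s) :=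
  measurableSet_Ioo.prod measurableSet_Ioo

lemma halfBox_subset_halfBox_zero {b s t : ℝ} (hst : |b| + s ≤ t) : halfBox b s ⊆ halfBox 0 t := by
  rintro p ⟨hfst, hsnd⟩
  have hb := abs_le.1 (le_refl |b|)
  exact ⟨⟨by linarith [hfst.1], by linarith [hfst.2]⟩, hsnd.1, by linarith [hsnd.2, abs_nonneg b]⟩

lemma tendsto_setIntegral_halfBox {e : ℝ × ℝ → ℝ} (he : ∀ R, IntegrableOn e (halfBox 0 R)) (b : ℝ) :
    Tendsto (fun s => ∫ p in halfBox b s, e p) (𝓝[>] 0) (𝓝 0) := by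
  have hvol : Tendsto (fun s : ℝ => ENNReal.ofReal (2 * s ^ 2)) (𝓝[>] 0) (𝓝 0) := by
    have h : Continuous fun s : ℝ => ENNReal.ofReal (2 * s ^ 2) :=
      ENNReal.continuous_ofReal.comp (by fun_prop)
    simpa using (h.tendsto 0).mono_left nhdsWithin_le_nhds
  have hrestrict : Tendsto (fun s => volume.restrict (halfBox 0 (|b| + 1)) (halfBox b s))
      (𝓝[>] 0) (𝓝 0) :=
    tendsto_of_tendsto_of_tendsto_of_le_of_le' tendsto_const_nhds hvol
      (Eventually.of_forall fun _ => zero_le) (by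
        filter_upwards [self_mem_nhdsWithin] with s hs
        exact (Measure.restrict_apply_le _ _).trans_eq (volume_halfBox (le_of_lt hs)))
  refine (Integrable.tendsto_setIntegral_nhds_zero (he (|b| + 1)) hrestrict).congr' ?_
  filter_upwards [nhdsWithin_le_nhds (gt_mem_nhds one_pos)] with s hs
  rw [Measure.restrict_restrict (measurableSet_halfBox b s), Set.inter_eq_left.2
    (halfBox_subset_halfBox_zero (by linarith))]

lemma exists_norm_hankelWave_le (hκ : 0 < κ) {y b : ℝ} (hyb : y ≠ b) :
    ∃ B > 0, ∀ p ∈ upperProd, radius b p ≤ |y - b| / 2 → ‖hankelWave κ y p‖ ≤ B ∧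
      ∀ v, ‖dirDeriv v (hankelWave κ y) p‖ ≤ radius 0 v * B := by
  set δ := |y - b|
  have hδ : 0 < δ := abs_pos.2 (sub_ne_zero.2 hyb)
  have hbdd : ∀ k, ∃ B, ∀ r ∈ Set.Icc (δ / 2) (3 * δ / 2), ‖hankelMoment k (κ * r)‖ ≤ B := fun k =>
    isCompact_Icc.exists_bound_of_continuousOn ((continuousOn_hankelMoment k).comp (by fun_prop)
      fun r hr => mul_pos hκ ((half_pos hδ).trans_le hr.1))
  obtain ⟨B₀, hB₀⟩ := hbdd 0
  obtain ⟨B₁, hB₁⟩ := hbdd 1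
  refine ⟨max (max B₀ (κ * B₁)) 1, by positivity, fun p hp hpb => ?_⟩
  have hdist := abs_le.1 (abs_radius_sub_radius_le y b p)
  have hmem : radius y p ∈ Set.Icc (δ / 2) (3 * δ / 2) := by
    have htri : δ ≤ radius y p + radius b p := by
      have hy := abs_fst_sub_le_radius y p
      have hb := abs_fst_sub_le_radius b p
      have := abs_sub_le y p.1 b
      rw [abs_sub_comm y p.1] at this
      linarith
    exact ⟨by linarith, by linarith⟩
  refine ⟨(hB₀ _ hmem).trans ((le_max_left _ _).trans (le_max_left _ _)),
    fun v => (norm_dirDeriv_hankelWave_le hκ y hp v).trans ?_⟩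
  have hr := radius_nonneg 0 v
  gcongr
  exact (mul_le_mul_of_nonneg_left (hB₁ _ hmem) hκ.le).trans
    ((le_max_right _ _).trans (le_max_left _ _))

lemma norm_dirDeriv_le (v : ℝ × ℝ) (f : ℝ × ℝ → ℂ) (p : ℝ × ℝ) :
    ‖dirDeriv v f p‖ ≤ radius 0 v * (‖dFst f p‖ + ‖dSnd f p‖) := by
  have hfst := abs_fst_sub_le_radius 0 v
  rw [sub_zero] at hfst
  rw [dirDeriv_eq_add, mul_add]
  refine (norm_add_le _ _).trans ?_
  rw [norm_mul, norm_mul, Complex.norm_real, Complex.norm_real, Real.norm_eq_abs, Real.norm_eq_abs]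
  gcongr
  exact abs_snd_le_radius 0 v

/-- The majorant of Green's density near an end point of the aperture. -/
def nearMajorant (W : ℝ × ℝ → ℂ) (M ρ μ : ℝ) (p : ℝ × ℝ) : ℝ :=
  M * (3 * (μ / ρ ^ 2) + energyDensity W p / μ)

lemma nearMajorant_nonneg (W : ℝ × ℝ → ℂ) {M μ : ℝ} (ρ : ℝ) {p : ℝ × ℝ} (hM : 0 ≤ M)
    (hμ : 0 < μ) : 0 ≤ nearMajorant W M ρ μ p := by
  unfold nearMajorant energyDensity
  positivity

lemma integrableOn_const_halfBox (a b : ℝ) {s : ℝ} (hs : 0 ≤ s) :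
    IntegrableOn (fun _ : ℝ × ℝ => a) (halfBox b s) :=
  integrableOn_const (hs := volume_halfBox (b := b) hs ▸ ENNReal.ofReal_ne_top)

lemma integrableOn_nearMajorant {b s : ℝ} (hs : 0 ≤ s)
    (he : IntegrableOn (energyDensity W) (halfBox b s)) (M ρ μ : ℝ) :
    IntegrableOn (nearMajorant W M ρ μ) (halfBox b s) :=
  ((integrableOn_const_halfBox _ b hs).add (he.div_const μ)).const_mul M

lemma integral_nearMajorant {b s : ℝ} (hs : 0 ≤ s)
    (he : IntegrableOn (energyDensity W) (halfBox b s)) (M ρ μ : ℝ) :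
    ∫ p in halfBox b s, nearMajorant W M ρ μ p =
      M * (6 * s ^ 2 * μ / ρ ^ 2 + (∫ p in halfBox b s, energyDensity W p) / μ) := by
  simp only [nearMajorant]
  rw [integral_const_mul, integral_add (integrableOn_const_halfBox _ b hs) (he.div_const μ),
    setIntegral_const, integral_div, smul_eq_mul, Measure.real, volume_halfBox hs,
    ENNReal.toReal_ofReal (by positivity)]
  ring

/-- The gradient of the cutoff has size `1 / ρ` on a half-disc of area `∼ ρ²`, so Young's inequality
trades it for a constant and the energy density. -/
lemma norm_greenDensity_near_le {E : ℝ × ℝ → ℂ} {K B b ρ μ : ℝ} {p : ℝ × ℝ} (hρ : 0 < ρ)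
    (hμ : 0 < μ) (hp : p ∈ upperProd) (hK : ∀ x, |deriv cutoff x| ≤ K)
    (hE : ‖E p‖ ≤ B ∧ ∀ v, ‖dirDeriv v E p‖ ≤ radius 0 v * B) :
    ‖greenDensity W E (discCutoff b ρ) p‖ ≤ nearMajorant W (K * B) ρ μ p := by
  have hr := radius_pos (y := b) hp
  have hB : 0 ≤ B := (norm_nonneg _).trans hE.1
  have hK₀ : 0 ≤ K := (abs_nonneg _).trans (hK 0)
  have hradius : radius 0 (p - (b, 0)) = radius b p := by simp [radius]
  have hbracket : ‖E p * dirDeriv (p - (b, 0)) W p - W p * dirDeriv (p - (b, 0)) E p‖ ≤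
      B * (radius b p * (‖dFst W p‖ + ‖dSnd W p‖)) + ‖W p‖ * (radius b p * B) := by
    refine (norm_sub_le _ _).trans ?_
    rw [norm_mul, norm_mul, ← hradius]
    gcongr
    exacts [hE.1, norm_dirDeriv_le _ _ _, hE.2 _]
  have hyoung : ∀ x : ℝ, x / ρ ≤ μ / ρ ^ 2 + x ^ 2 / μ := fun x => by
    have hsq : μ / ρ ^ 2 + x ^ 2 / μ - x / ρ = μ * ((1 / ρ - x / (2 * μ)) ^ 2 +
        3 * (x / (2 * μ)) ^ 2) := by
      field_simp
      ring
    exact sub_nonneg.1 (hsq ▸ by positivity)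
  rw [greenDensity_discCutoff _ _ _ _ hp, norm_mul, Complex.norm_real, Real.norm_eq_abs, abs_div,
    abs_of_pos (mul_pos hρ hr)]
  calc _ ≤ K / (ρ * radius b p) *
        (B * (radius b p * (‖dFst W p‖ + ‖dSnd W p‖)) + ‖W p‖ * (radius b p * B)) := by
        gcongr
        exact hK _
    _ = K * B * (‖dFst W p‖ / ρ + ‖dSnd W p‖ / ρ + ‖W p‖ / ρ) := by field_simp
    _ ≤ K * B * ((μ / ρ ^ 2 + ‖dFst W p‖ ^ 2 / μ) + (μ / ρ ^ 2 + ‖dSnd W p‖ ^ 2 / μ) +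
          (μ / ρ ^ 2 + ‖W p‖ ^ 2 / μ)) := by gcongr <;> exact hyoung _
    _ = _ := by
        rw [nearMajorant, energyDensity]
        ring

lemma norm_greenDensity_near_le_indicator {E : ℝ × ℝ → ℂ} {K B b ρ μ : ℝ} {p : ℝ × ℝ} (hρ : 0 < ρ)
    (hμ : 0 < μ) (hp : p ∈ upperProd) (hK : ∀ x, |deriv cutoff x| ≤ K) (hB : 0 ≤ B)
    (hE : radius b p ≤ 2 * ρ → ‖E p‖ ≤ B ∧ ∀ v, ‖dirDeriv v E p‖ ≤ radius 0 v * B) :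
    ‖greenDensity W E (discCutoff b ρ) p‖ ≤
      (halfBox b (3 * ρ)).indicator (nearMajorant W (K * B) ρ μ) p := by
  have hKB : 0 ≤ K * B := mul_nonneg ((abs_nonneg _).trans (hK 0)) hB
  by_cases hfar : 2 < radius b p / ρ
  · rw [greenDensity_discCutoff _ _ _ _ hp, deriv_cutoff_eq_zero fun h => hfar.not_ge h.2,
      zero_div, Complex.ofReal_zero, zero_mul, norm_zero]
    exact Set.indicator_nonneg (fun p _ => nearMajorant_nonneg W ρ hKB hμ) p
  have hpb : radius b p ≤ 2 * ρ := (div_le_iff₀ hρ).1 (not_lt.1 hfar)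
  have hfst := abs_le.1 ((abs_fst_sub_le_radius b p).trans hpb)
  have hsnd := abs_le.1 ((abs_snd_le_radius b p).trans hpb)
  have hmem : p ∈ halfBox b (3 * ρ) := ⟨⟨by linarith, by linarith⟩, hp, by linarith⟩
  rw [Set.indicator_of_mem hmem]
  exact norm_greenDensity_near_le hρ hμ hp hK (hE hpb)

lemma norm_setIntegral_le_setIntegral_of_norm_le_indicator {s t : Set (ℝ × ℝ)} {f : ℝ × ℝ → ℂ}
    {g : ℝ × ℝ → ℝ} (hs : MeasurableSet s) (ht : MeasurableSet t) (hg : IntegrableOn g t)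
    (hg₀ : ∀ p, 0 ≤ g p) (hfg : ∀ p ∈ s, ‖f p‖ ≤ t.indicator g p) :
    ‖∫ p in s, f p‖ ≤ ∫ p in t, g p := by
  have hind : Integrable (t.indicator g) := hg.integrable_indicator ht
  calc ‖∫ p in s, f p‖ ≤ ∫ p in s, t.indicator g p :=
        norm_integral_le_of_norm_le hind.restrict
          ((ae_restrict_mem hs).mono fun p hp => hfg p hp)
    _ ≤ ∫ p, t.indicator g p := setIntegral_le_integral hind
        (Eventually.of_forall fun _ => Set.indicator_nonneg (fun p _ => hg₀ p) _)
    _ = ∫ p in t, g p := integral_indicator ht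

lemma IsApertureField.eventually_near_bulk_le (hW : IsApertureField κ ε c W) (hκ : 0 < κ)
    {y b : ℝ} (hyb : y ≠ b) {η : ℝ} (hη : 0 < η) :
    ∀ᶠ ρ in 𝓝[>] (0 : ℝ), ∀ A h : ℝ, 0 < h →
      ‖∫ p in Set.Icc ((-A, h) : ℝ × ℝ) (A, A),
        greenDensity W (hankelWave κ y) (discCutoff b ρ) p‖ ≤ η := by
  obtain ⟨K, hK, hKb⟩ := exists_abs_deriv_cutoff_le
  obtain ⟨B, hB, hE⟩ := exists_norm_hankelWave_le hκ hyb
  set μ := η / (108 * K * B) with hμ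
  have hμ₀ : 0 < μ := by positivity
  have hscale : Tendsto (fun ρ : ℝ => 3 * ρ) (𝓝[>] 0) (𝓝[>] 0) :=
    tendsto_nhdsWithin_of_tendsto_nhds_of_eventually_within _
      (by simpa using ((continuous_const_mul (3 : ℝ)).tendsto 0).mono_left nhdsWithin_le_nhds)
      (by filter_upwards [self_mem_nhdsWithin] with ρ hρ using mul_pos three_pos (Set.mem_Ioi.1 hρ))
  have henergy : ∀ᶠ ρ in 𝓝[>] (0 : ℝ),
      ∫ p in halfBox b (3 * ρ), energyDensity W p < η * μ / (2 * K * B) :=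
    ((tendsto_setIntegral_halfBox hW.energy b).comp hscale).eventually
      (gt_mem_nhds (by positivity))
  have : 0 < |y - b| := abs_pos.2 (sub_ne_zero.2 hyb)
  filter_upwards [henergy, self_mem_nhdsWithin,
    nhdsWithin_le_nhds (gt_mem_nhds (by positivity : 0 < |y - b| / 4))] with ρ hρe hρ hρy A h hh
  have hρ₀ : 0 < ρ := hρ
  have he : IntegrableOn (energyDensity W) (halfBox b (3 * ρ)) :=
    (hW.energy (|b| + 3 * ρ)).mono_set (halfBox_subset_halfBox_zero le_rfl)
  refine (norm_setIntegral_le_setIntegral_of_norm_le_indicator measurableSet_Icc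
    (measurableSet_halfBox b (3 * ρ)) (integrableOn_nearMajorant (by positivity) he (K * B) ρ μ)
    (fun p => nearMajorant_nonneg W ρ (by positivity) hμ₀) fun p hp =>
      norm_greenDensity_near_le_indicator hρ₀ hμ₀ (hh.trans_le hp.1.2) hKb hB.le fun hpρ =>
        hE p (hh.trans_le hp.1.2) (by linarith)).trans ?_
  rw [integral_nearMajorant (by positivity) he]
  calc _ ≤ K * B * (6 * (3 * ρ) ^ 2 * μ / ρ ^ 2 + η * μ / (2 * K * B) / μ) := by gcongr
    _ = η := by
        rw [hμ]
        field_simp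
        norm_num

end

/-! ### Boundary limits of the layer potentials -/

lemma closure_upperProd : closure upperProd = {p : ℝ × ℝ | 0 ≤ p.2} := by
  have hprod : upperProd = Set.univ ×ˢ Set.Ioi (0 : ℝ) := by
    ext p
    simp [upperProd]
  ext p
  simp [hprod, closure_prod_eq]

lemma radius_boundary (b t : ℝ) : radius b (t, 0) = |t - b| := by
  simp [radius, Real.sqrt_sq_eq_abs]

lemma continuous_comp_line {G : ℝ × ℝ → ℂ} (hG : ContinuousOn G upperProd) {h : ℝ} (hh : 0 < h) :
    Continuous fun s : ℝ => G (s, h) :=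
  hG.comp_continuous (by fun_prop) fun _ => hh

lemma exists_norm_le_on_strip {G : ℝ × ℝ → ℂ} (hG : ContinuousOn G (closure upperProd)) (A : ℝ) :
    ∃ B, ∀ s ∈ Set.Icc (-A) A, ∀ h ∈ Set.Icc (0 : ℝ) 1, ‖G (s, h)‖ ≤ B := by
  have hsub : Set.Icc (-A) A ×ˢ Set.Icc (0 : ℝ) 1 ⊆ closure upperProd := fun p hp => by
    rw [closure_upperProd]
    exact hp.2.1
  obtain ⟨B, hB⟩ := (isCompact_Icc.prod isCompact_Icc).exists_bound_of_continuousOn (hG.mono hsub)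
  exact ⟨B, fun s hs h hh => hB (s, h) ⟨hs, hh⟩⟩

lemma tendsto_comp_boundary {G : ℝ × ℝ → ℂ} (hG : ContinuousOn G (closure upperProd)) (y u : ℝ) :
    Tendsto (fun h : ℝ => G (y + h * u, h)) (𝓝[>] 0) (𝓝 (G (y, 0))) := by
  have hcurve : ContinuousAt (fun h : ℝ => (y + h * u, h)) 0 := by fun_prop
  have hcurve' : Tendsto (fun h : ℝ => (y + h * u, h)) (𝓝[>] 0) (𝓝[closure upperProd] (y, 0)) := by
    refine tendsto_nhdsWithin_iff.2 ⟨?_, ?_⟩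
    · simpa using hcurve.tendsto.mono_left nhdsWithin_le_nhds
    · filter_upwards [self_mem_nhdsWithin] with h hh using subset_closure hh
  exact (hG (y, 0) (by simp [closure_upperProd])).tendsto.comp hcurve'

lemma intervalIntegrable_inv_sqrt_abs (a b : ℝ) :
    IntervalIntegrable (fun x : ℝ => 1 / √|x|) volume a b := by
  have hpos : ∀ M : ℝ, 0 ≤ M → IntervalIntegrable (fun x : ℝ => 1 / √|x|) volume 0 M := by
    intro M hM
    refine (intervalIntegral.intervalIntegrable_rpow' (r := -(1 / 2)) (by norm_num)).congr_ae ?_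
    rw [Set.uIoc_of_le hM]
    filter_upwards [ae_restrict_mem measurableSet_Ioc] with x hx
    rw [abs_of_pos hx.1, Real.rpow_neg hx.1.le, ← Real.sqrt_eq_rpow, one_div]
  have hzero : ∀ M : ℝ, IntervalIntegrable (fun x : ℝ => 1 / √|x|) volume 0 M := by
    intro M
    rcases le_total 0 M with hM | hM
    · exact hpos M hM
    · rw [IntervalIntegrable.iff_comp_neg]
      simpa using hpos (-M) (by linarith)
  exact (hzero a).symm.trans (hzero b)

/-- An integrable majorant of the Hankel wave centred at `y` on all horizontal lines. -/
def layerMajorant (κ y s : ℝ) : ℝ := √(Real.pi / κ) * (1 / √|s - y|)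

lemma intervalIntegrable_layerMajorant (κ y a b : ℝ) :
    IntervalIntegrable (layerMajorant κ y) volume a b := by
  have h := (intervalIntegrable_inv_sqrt_abs (a - y) (b - y)).comp_sub_right y
  simp only [sub_add_cancel] at h
  exact h.const_mul _

lemma norm_hankelWave_le_layerMajorant {κ y s : ℝ} (hκ : 0 < κ) (hs : s ≠ y) (h : ℝ) :
    ‖hankelWave κ y (s, h)‖ ≤ layerMajorant κ y s := by
  have hd : 0 < |s - y| := abs_pos.2 (sub_ne_zero.2 hs)
  have hr : |s - y| ≤ radius y (s, h) := abs_fst_sub_le_radius y (s, h)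
  calc ‖hankelWave κ y (s, h)‖ ≤ √(Real.pi / (κ * radius y (s, h))) :=
        norm_hankelMoment_zero_le (mul_pos hκ (hd.trans_le hr))
    _ ≤ √(Real.pi / (κ * |s - y|)) := by gcongr
    _ = layerMajorant κ y s := by
        rw [layerMajorant, ← div_div, Real.sqrt_div (by positivity), mul_one_div]

lemma continuousAt_hankelWave {κ y : ℝ} (hκ : 0 < κ) {p : ℝ × ℝ} (hp : 0 < radius y p) :
    ContinuousAt (hankelWave κ y) p :=
  ContinuousAt.comp (f := fun p => κ * radius y p)
    (hasDerivAt_hankelMoment 0 (mul_pos hκ hp)).continuousAt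
    ((continuous_radius y).const_mul κ).continuousAt

lemma ae_ne (y : ℝ) : ∀ᵐ s : ℝ, s ≠ y := by
  simp [ae_iff]

lemma tendsto_integral_mul_hankelWave {κ A : ℝ} (hκ : 0 < κ) (hA : 0 ≤ A) (y : ℝ)
    {G : ℝ × ℝ → ℂ} (hG : ContinuousOn G (closure upperProd)) :
    Tendsto (fun h => ∫ s in (-A)..A, G (s, h) * hankelWave κ y (s, h)) (𝓝[>] 0)
      (𝓝 (∫ s in (-A)..A, G (s, 0) * hankelWave κ y (s, 0))) := by
  obtain ⟨B, hB⟩ := exists_norm_le_on_strip hG A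
  refine intervalIntegral.tendsto_integral_filter_of_dominated_convergence
    (fun s => B * layerMajorant κ y s) ?_ ?_
    ((intervalIntegrable_layerMajorant κ y _ _).const_mul B) ?_
  · filter_upwards [self_mem_nhdsWithin] with h hh
    exact ((continuous_comp_line (hG.mono subset_closure) hh).mul (continuous_comp_line
      (isHelmholtz_hankelWave hκ y).contDiffOn.continuousOn hh)).aestronglyMeasurable
  · filter_upwards [Ioo_mem_nhdsGT (zero_lt_one' ℝ)] with h hh
    filter_upwards [ae_ne y] with s hs hsA
    rw [Set.uIoc_of_le (by linarith)] at hsA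
    have hGs := hB s ⟨hsA.1.le, hsA.2⟩ h ⟨hh.1.le, hh.2.le⟩
    rw [norm_mul]
    exact mul_le_mul hGs (norm_hankelWave_le_layerMajorant hκ hs h) (norm_nonneg _)
      ((norm_nonneg _).trans hGs)
  · filter_upwards [ae_ne y] with s hs _
    have hwave : ContinuousAt (fun h : ℝ => hankelWave κ y (s, h)) 0 := by
      refine ContinuousAt.comp (f := fun h : ℝ => (s, h)) (continuousAt_hankelWave hκ ?_)
        (by fun_prop)
      rw [radius_boundary]
      exact abs_pos.2 (sub_ne_zero.2 hs)
    have hGs := tendsto_comp_boundary hG s 0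
    simp only [mul_zero, add_zero] at hGs
    exact hGs.mul (hwave.tendsto.mono_left nhdsWithin_le_nhds)

/-- The function `h * dSnd (hankelWave κ y) (y + h * u, h)` of the rescaled tangential variable
`u`; as `h → 0` it tends to the negative of the Poisson kernel. -/
def doubleKernel (κ h u : ℝ) : ℂ :=
  -((κ * (h * √(1 + u ^ 2)) : ℝ) * hankelMoment 1 (κ * (h * √(1 + u ^ 2)))) *
    ((1 + u ^ 2)⁻¹ : ℝ)

lemma sqrt_one_add_sq_pos (u : ℝ) : 0 < √(1 + u ^ 2) := Real.sqrt_pos.2 (by positivity)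

lemma mul_dSnd_hankelWave {κ h : ℝ} (hκ : 0 < κ) (y : ℝ) (hh : 0 < h) (u : ℝ) :
    h * dSnd (hankelWave κ y) (y + h * u, h) = doubleKernel κ h u := by
  have hr : radius y (y + h * u, h) = h * √(1 + u ^ 2) := by
    rw [radius, show (y + h * u - y) ^ 2 + h ^ 2 = h ^ 2 * (1 + u ^ 2) by ring,
      Real.sqrt_mul (by positivity), Real.sqrt_sq hh.le]
  have hsqrt : (√(1 + u ^ 2) : ℂ) ≠ 0 := by exact_mod_cast (sqrt_one_add_sq_pos u).ne'
  have hsq : ((1 + u ^ 2 : ℝ) : ℂ) = (√(1 + u ^ 2) : ℂ) ^ 2 := by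
    rw [← Complex.ofReal_pow, Real.sq_sqrt (by positivity)]
  have hh' : (h : ℂ) ≠ 0 := by exact_mod_cast hh.ne'
  rw [dSnd, dirDeriv_hankelWave hκ y (p := (y + h * u, h)) hh, radialPart, hr, doubleKernel,
    Complex.ofReal_inv, hsq]
  push_cast
  field_simp
  ring

lemma measurable_doubleKernel {κ h : ℝ} (hκ : 0 < κ) (hh : 0 < h) :
    Measurable (doubleKernel κ h) := by
  have hmoment : Measurable fun u : ℝ => hankelMoment 1 (κ * (h * √(1 + u ^ 2))) :=
    ((continuousOn_hankelMoment 1).comp_continuous (by fun_prop) fun u =>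
      mul_pos hκ (mul_pos hh (sqrt_one_add_sq_pos u))).measurable
  unfold doubleKernel
  fun_prop

lemma norm_doubleKernel_le {κ h u L : ℝ} (hκ : 0 < κ) (hh : 0 < h)
    (hL : h * √(1 + u ^ 2) ≤ L) :
    ‖doubleKernel κ h u‖ ≤ (1 + 3 * √(Real.pi * (κ * L))) * (1 + u ^ 2)⁻¹ := by
  have hz : 0 < κ * (h * √(1 + u ^ 2)) := mul_pos hκ (mul_pos hh (sqrt_one_add_sq_pos u))
  rw [doubleKernel, norm_mul, norm_neg, Complex.norm_real, Real.norm_of_nonneg (by positivity)]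
  gcongr
  exact (norm_mul_hankelMoment_one_le hz).trans (by gcongr)

lemma tendsto_doubleKernel {κ : ℝ} (hκ : 0 < κ) (u : ℝ) :
    Tendsto (fun h => doubleKernel κ h u) (𝓝[>] 0) (𝓝 (-1 * ((1 + u ^ 2)⁻¹ : ℝ))) := by
  have hz : Tendsto (fun h : ℝ => κ * (h * √(1 + u ^ 2))) (𝓝[>] 0) (𝓝[>] 0) := by
    refine tendsto_nhdsWithin_iff.2 ⟨?_, ?_⟩
    · have hcont : ContinuousAt (fun h : ℝ => κ * (h * √(1 + u ^ 2))) 0 := by fun_prop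
      simpa using hcont.tendsto.mono_left nhdsWithin_le_nhds
    · filter_upwards [self_mem_nhdsWithin] with h hh
      exact mul_pos hκ (mul_pos hh (sqrt_one_add_sq_pos u))
  exact (tendsto_mul_hankelMoment_one.comp hz).neg.mul_const _

lemma integral_mul_dSnd_hankelWave {κ A h : ℝ} (hκ : 0 < κ) (hA : 0 ≤ A) (hh : 0 < h) (y : ℝ)
    (g : ℝ → ℂ) :
    ∫ s in (-A)..A, g s * dSnd (hankelWave κ y) (s, h) =
      ∫ u, (Set.Ioc (-A) A).indicator g (y + h * u) * doubleKernel κ h u := by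
  set φ : ℝ → ℂ := fun s => (Set.Ioc (-A) A).indicator g s * dSnd (hankelWave κ y) (s, h) with hφ
  have hinterval : ∫ s in (-A)..A, g s * dSnd (hankelWave κ y) (s, h) = ∫ s, φ s := by
    rw [intervalIntegral.integral_of_le (by linarith), ← integral_indicator measurableSet_Ioc]
    simp only [hφ, Set.indicator_mul_left]
  have hsubst : ∫ u, φ (y + h * u) = |h⁻¹| • ∫ s, φ s := by
    rw [Measure.integral_comp_mul_left (fun s => φ (y + s)) h, integral_add_left_eq_self]
  have hscale : ∀ u, (Set.Ioc (-A) A).indicator g (y + h * u) * doubleKernel κ h u =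
      h * φ (y + h * u) := fun u => by
    rw [← mul_dSnd_hankelWave hκ y hh u]
    ring
  have hh' : (h : ℂ) ≠ 0 := by exact_mod_cast hh.ne'
  simp only [hscale]
  rw [hinterval, integral_const_mul, hsubst, abs_of_pos (by positivity), Complex.real_smul,
    Complex.ofReal_inv, mul_inv_cancel_left₀ hh']

lemma mul_sqrt_one_add_sq_le {A y h u : ℝ} (hy : |y| ≤ A) (hh : h ∈ Set.Ioo (0 : ℝ) 1)
    (hu : y + h * u ∈ Set.Ioc (-A) A) : h * √(1 + u ^ 2) ≤ 2 * A + 1 := by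
  have hhu : h * |u| ≤ 2 * A := by
    rw [← abs_of_pos hh.1, ← abs_mul, abs_le]
    constructor <;> linarith [hu.1, hu.2, (abs_le.1 hy).1, (abs_le.1 hy).2]
  have hsqrt : √(1 + u ^ 2) ≤ 1 + |u| := by
    rw [Real.sqrt_le_left (by positivity)]
    nlinarith [sq_abs u, abs_nonneg u]
  calc h * √(1 + u ^ 2) ≤ h * (1 + |u|) := mul_le_mul_of_nonneg_left hsqrt hh.1.le
    _ = h + h * |u| := by ring
    _ ≤ 2 * A + 1 := by linarith [hh.2]

lemma tendsto_integral_mul_dSnd_hankelWave {κ A y : ℝ} (hκ : 0 < κ) (hy : |y| < A)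
    {G : ℝ × ℝ → ℂ} (hG : ContinuousOn G (closure upperProd)) :
    Tendsto (fun h => ∫ s in (-A)..A, G (s, h) * dSnd (hankelWave κ y) (s, h)) (𝓝[>] 0)
      (𝓝 (-(Real.pi * G (y, 0)))) := by
  obtain ⟨B, hB⟩ := exists_norm_le_on_strip hG A
  have hA : 0 < A := (abs_nonneg y).trans_lt hy
  have hB0 : 0 ≤ B := (norm_nonneg _).trans (hB 0 ⟨by linarith, hA.le⟩ 0 ⟨le_rfl, zero_le_one⟩)
  set K := 1 + 3 * √(Real.pi * (κ * (2 * A + 1)))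
  have hvalue : ∫ u : ℝ, G (y, 0) * (-1 * (((1 + u ^ 2)⁻¹ : ℝ) : ℂ)) =
      -(Real.pi * G (y, 0)) := by
    rw [integral_const_mul, integral_const_mul, integral_complex_ofReal,
      integral_univ_inv_one_add_sq]
    ring
  rw [← hvalue]
  refine (tendsto_integral_filter_of_dominated_convergence (fun u => B * (K * (1 + u ^ 2)⁻¹))
    (F := fun h u => (Set.Ioc (-A) A).indicator (fun s => G (s, h)) (y + h * u) *
      doubleKernel κ h u) ?_ ?_ ((integrable_inv_one_add_sq.const_mul K).const_mul B) ?_).congr' ?_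
  · filter_upwards [self_mem_nhdsWithin] with h hh
    have hind : Measurable ((Set.Ioc (-A) A).indicator fun s => G (s, h)) :=
      (continuous_comp_line (hG.mono subset_closure) hh).measurable.indicator measurableSet_Ioc
    exact ((hind.comp (by fun_prop)).mul (measurable_doubleKernel hκ hh)).aestronglyMeasurable
  · filter_upwards [Ioo_mem_nhdsGT (zero_lt_one' ℝ)] with h hh
    refine Eventually.of_forall fun u => ?_
    by_cases hu : y + h * u ∈ Set.Ioc (-A) A
    · rw [Set.indicator_of_mem hu, norm_mul]
      exact mul_le_mul (hB _ ⟨hu.1.le, hu.2⟩ h ⟨hh.1.le, hh.2.le⟩)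
        (norm_doubleKernel_le hκ hh.1 (mul_sqrt_one_add_sq_le hy.le hh hu)) (norm_nonneg _) hB0
    · rw [Set.indicator_of_notMem hu, zero_mul, norm_zero]
      positivity
  · refine Eventually.of_forall fun u => ?_
    have hcurve : ContinuousAt (fun h : ℝ => y + h * u) 0 := by fun_prop
    have hmem : ∀ᶠ h in 𝓝[>] (0 : ℝ), y + h * u ∈ Set.Ioc (-A) A := by
      refine (hcurve.eventually (Ioc_mem_nhds ?_ ?_)).filter_mono nhdsWithin_le_nhds <;>
        simp [neg_lt_of_abs_lt hy, lt_of_abs_lt hy]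
    refine ((tendsto_comp_boundary hG y u).mul (tendsto_doubleKernel hκ u)).congr' ?_
    filter_upwards [hmem] with h hu
    rw [Set.indicator_of_mem hu]
  · filter_upwards [self_mem_nhdsWithin] with h hh
    exact (integral_mul_dSnd_hankelWave hκ hA.le hh y fun s => G (s, h)).symm

/-! ### Green's representation of the trace -/

/-- A continuous cutoff that vanishes near both end points of the aperture, where the field may be
singular. -/
structure IsEndpointCutoff (ε : ℝ) (χ : ℝ × ℝ → ℂ) : Prop where
  continuous : Continuous χ
  eventuallyEq_zero_left : χ =ᶠ[𝓝 (0, 0)] 0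
  eventuallyEq_zero_right : χ =ᶠ[𝓝 (ε, 0)] 0

lemma IsEndpointCutoff.continuousOn_mul {ε : ℝ} {χ Z : ℝ × ℝ → ℂ} (hχ : IsEndpointCutoff ε χ)
    (hZ : ContinuousOn Z (closedUpper ε)) :
    ContinuousOn (fun p => χ p * Z p) (closure upperProd) := by
  have hzero : ∀ p, χ =ᶠ[𝓝 p] 0 → ContinuousAt (fun p => χ p * Z p) p := fun p hp => by
    refine (continuousAt_const (y := (0 : ℂ))).congr ?_
    filter_upwards [hp] with q hq
    rw [hq, Pi.zero_apply, zero_mul]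
  intro p hp
  rw [closure_upperProd] at hp ⊢
  by_cases hleft : p = (0, 0)
  · exact (hzero p (hleft ▸ hχ.eventuallyEq_zero_left)).continuousWithinAt
  by_cases hright : p = (ε, 0)
  · exact (hzero p (hright ▸ hχ.eventuallyEq_zero_right)).continuousWithinAt
  have hnhds : closedUpper ε ∈ 𝓝[{p | 0 ≤ p.2}] p := by
    filter_upwards [self_mem_nhdsWithin, nhdsWithin_le_nhds (isOpen_ne.mem_nhds hleft),
      nhdsWithin_le_nhds (isOpen_ne.mem_nhds hright)] with q hq hql hqr using ⟨hq, hql, hqr⟩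
  exact (hχ.continuous.continuousWithinAt.mul (hZ p ⟨hp, hleft, hright⟩)).mono_of_mem_nhdsWithin
    hnhds

section
variable {κ ε y : ℝ} {c : ℂ} {W : ℝ × ℝ → ℂ}

lemma IsApertureField.continuousOn_dSnd (hW : IsApertureField κ ε c W) :
    ContinuousOn (dSnd W) upperProd :=
  (contDiffOn_dirDeriv (m := 1) hW.contDiffOn le_rfl (0, 1)).continuousOn

/-- The normal derivative of a field on the closed half-plane. -/
def normalDeriv (W : ℝ × ℝ → ℂ) : ℝ × ℝ → ℂ := extendFrom upperProd (dSnd W)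

lemma IsApertureField.normalDeriv_eq (hW : IsApertureField κ ε c W) {p : ℝ × ℝ}
    (hp : p ∈ upperProd) : normalDeriv W p = dSnd W p :=
  extendFrom_eq (subset_closure hp) (hW.continuousOn_dSnd p hp)

lemma IsApertureField.tendsto_dSnd_boundary (hW : IsApertureField κ ε c W) {t : ℝ} (h0 : t ≠ 0)
    (hε : t ≠ ε) :
    Tendsto (dSnd W) (𝓝[upperProd] (t, 0)) (𝓝 ((Set.Ioo 0 ε).indicator (fun _ => c) t)) := by
  by_cases ht : t ∈ Set.Ioo 0 ε
  · rw [Set.indicator_of_mem ht]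
    exact hW.aperture t ht
  · rw [Set.indicator_of_notMem ht]
    exact hW.neumann t fun h => ht ⟨h.1.lt_of_ne' h0, h.2.lt_of_ne hε⟩

lemma IsApertureField.normalDeriv_boundary (hW : IsApertureField κ ε c W) {t : ℝ} (h0 : t ≠ 0)
    (hε : t ≠ ε) : normalDeriv W (t, 0) = (Set.Ioo 0 ε).indicator (fun _ => c) t :=
  extendFrom_eq (by simp [closure_upperProd]) (hW.tendsto_dSnd_boundary h0 hε)

lemma IsApertureField.continuousOn_normalDeriv (hW : IsApertureField κ ε c W) :
    ContinuousOn (normalDeriv W) (closedUpper ε) := by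
  refine continuousOn_extendFrom (fun p hp => ?_) fun p ⟨hp, hp0, hpε⟩ => ?_
  · rw [closure_upperProd]
    exact hp.1
  · rcases hp.lt_or_eq with h | h
    · exact ⟨_, hW.continuousOn_dSnd p h⟩
    · obtain ⟨t, x⟩ := p
      obtain rfl : 0 = x := h
      exact ⟨_, hW.tendsto_dSnd_boundary (by simpa using hp0) (by simpa using hpε)⟩

lemma IsApertureField.tendsto_singleLayer (hW : IsApertureField κ ε c W) (hκ : 0 < κ) (hε : 0 < ε)
    {χ : ℝ × ℝ → ℂ} (hχ : IsEndpointCutoff ε χ) {A : ℝ} (hA : ε < A) (y : ℝ) :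
    Tendsto (fun h => ∫ s in (-A)..A, χ (s, h) * (hankelWave κ y (s, h) * dSnd W (s, h)))
      (𝓝[>] 0) (𝓝 (c * ∫ t in (0 : ℝ)..ε, χ (t, 0) * hankelWave κ y (t, 0))) := by
  have hlimit : ∫ s in (-A)..A, χ (s, 0) * normalDeriv W (s, 0) * hankelWave κ y (s, 0) =
      c * ∫ t in (0 : ℝ)..ε, χ (t, 0) * hankelWave κ y (t, 0) := by
    have hae : ∀ᵐ s : ℝ, s ∈ Set.uIoc (-A) A →
        χ (s, 0) * normalDeriv W (s, 0) * hankelWave κ y (s, 0) =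
          (Set.Ioo 0 ε).indicator (fun t => c * (χ (t, 0) * hankelWave κ y (t, 0))) s := by
      filter_upwards [ae_ne 0, ae_ne ε] with s h0 hs _
      rw [hW.normalDeriv_boundary h0 hs]
      by_cases h : s ∈ Set.Ioo 0 ε
      · simp only [Set.indicator_of_mem h]
        ring
      · simp only [Set.indicator_of_notMem h, mul_zero, zero_mul]
    have hsub : Set.Ioo 0 ε ⊆ Set.Ioc (-A) A := fun t ht => ⟨by linarith [ht.1], by linarith [ht.2]⟩
    rw [intervalIntegral.integral_congr_ae hae, intervalIntegral.integral_of_le (by linarith),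
      setIntegral_indicator measurableSet_Ioo, Set.inter_eq_right.2 hsub,
      ← integral_Ioc_eq_integral_Ioo, ← intervalIntegral.integral_of_le hε.le,
      intervalIntegral.integral_const_mul]
  rw [← hlimit]
  refine (tendsto_integral_mul_hankelWave hκ (hε.trans hA).le y
    (hχ.continuousOn_mul hW.continuousOn_normalDeriv)).congr' ?_
  filter_upwards [self_mem_nhdsWithin] with h hh
  refine intervalIntegral.integral_congr fun s _ => ?_
  simp only [hW.normalDeriv_eq (p := (s, h)) hh]
  ring

lemma IsApertureField.tendsto_doubleLayer (hW : IsApertureField κ ε c W) (hκ : 0 < κ)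
    {χ : ℝ × ℝ → ℂ} (hχ : IsEndpointCutoff ε χ) {A : ℝ} (hy : |y| < A) :
    Tendsto (fun h => ∫ s in (-A)..A, χ (s, h) * (W (s, h) * dSnd (hankelWave κ y) (s, h)))
      (𝓝[>] 0) (𝓝 (-(Real.pi * (χ (y, 0) * W (y, 0))))) := by
  simpa only [mul_assoc] using
    tendsto_integral_mul_dSnd_hankelWave hκ hy (hχ.continuousOn_mul hW.continuousOn)

end

/-- The cutoff to a large disc from which the discs around the end points are removed. -/
def apertureCutoff (ε R ρ : ℝ) (p : ℝ × ℝ) : ℂ :=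
  discCutoff 0 R p - discCutoff 0 ρ p - discCutoff ε ρ p

lemma isEndpointCutoff_apertureCutoff {ε R ρ : ℝ} (hρ : 0 < ρ) (hρε : 4 * ρ < ε)
    (hR : ε + ρ ≤ R) : IsEndpointCutoff ε (apertureCutoff ε R ρ) := by
  have hball : ∀ b : ℝ, ∀ᶠ p in 𝓝 ((b, 0) : ℝ × ℝ), radius b p < ρ := fun b =>
    (continuous_radius b).continuousAt.eventually_lt_const (by simpa [radius_boundary] using hρ)
  have hdist : ∀ p, |radius ε p - radius 0 p| ≤ ε := fun p =>
    (abs_radius_sub_radius_le ε 0 p).trans (by rw [sub_zero, abs_of_pos (by linarith)])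
  have hsum : ∀ p, ε ≤ radius ε p + radius 0 p := fun p => by
    have h0 := abs_fst_sub_le_radius 0 p
    rw [sub_zero] at h0
    linarith [neg_le_of_abs_le (abs_fst_sub_le_radius ε p), le_of_abs_le h0]
  refine ⟨((continuous_discCutoff 0 R).sub (continuous_discCutoff 0 ρ)).sub
    (continuous_discCutoff ε ρ), ?_, ?_⟩
  · filter_upwards [hball 0] with p hp
    rw [apertureCutoff, discCutoff_eq_one (by linarith) (by linarith),
      discCutoff_eq_one hρ hp.le, discCutoff_eq_zero hρ (by linarith [hsum p])]
    simp
  · filter_upwards [hball ε] with p hp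
    rw [apertureCutoff, discCutoff_eq_one (by linarith) (by linarith [(abs_le.1 (hdist p)).1]),
      discCutoff_eq_zero (b := 0) hρ (by linarith [hsum p]), discCutoff_eq_one hρ hp.le]
    simp

lemma apertureCutoff_eq_one {ε R ρ t : ℝ} (hρ : 0 < ρ) (ht : 2 * ρ ≤ t) (htε : 2 * ρ ≤ ε - t)
    (hR : ε ≤ R) : apertureCutoff ε R ρ (t, 0) = 1 := by
  have h0 : radius 0 (t, 0) = t := by
    rw [radius_boundary, sub_zero, abs_of_pos (by linarith)]
  have hε : radius ε (t, 0) = ε - t := by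
    rw [radius_boundary, abs_sub_comm, abs_of_pos (by linarith)]
  rw [apertureCutoff, discCutoff_eq_one (by linarith) (by linarith),
    discCutoff_eq_zero hρ (by linarith), discCutoff_eq_zero hρ (by linarith)]
  simp

lemma eventually_apertureCutoff_eq_one {ε R t : ℝ} (ht : t ∈ Set.Ioo 0 ε) (hR : ε ≤ R) :
    ∀ᶠ ρ in 𝓝[>] 0, apertureCutoff ε R ρ (t, 0) = 1 := by
  have hpos : 0 < min (t / 2) ((ε - t) / 2) := lt_min (by linarith [ht.1]) (by linarith [ht.2])
  filter_upwards [Ioo_mem_nhdsGT hpos] with ρ hρ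
  obtain ⟨hleft, hright⟩ := lt_min_iff.1 hρ.2
  exact apertureCutoff_eq_one hρ.1 (by linarith) (by linarith) hR

lemma continuousOn_hankelWave_boundary {κ : ℝ} (hκ : 0 < κ) (y : ℝ) :
    ContinuousOn (fun t : ℝ => hankelWave κ y (t, 0)) {y}ᶜ := fun t ht => by
  refine (ContinuousAt.comp (f := fun t : ℝ => (t, (0 : ℝ))) (continuousAt_hankelWave hκ ?_)
    (by fun_prop)).continuousWithinAt
  rw [radius_boundary]
  exact abs_pos.2 (sub_ne_zero.2 ht)

lemma aestronglyMeasurable_hankelWave_boundary {κ : ℝ} (hκ : 0 < κ) (y : ℝ) :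
    AEStronglyMeasurable (fun t : ℝ => hankelWave κ y (t, 0)) volume := by
  have h := (continuousOn_hankelWave_boundary hκ y).aestronglyMeasurable (μ := volume)
    (measurableSet_singleton y).compl
  rwa [Measure.restrict_eq_self_of_ae_mem (show ∀ᵐ t : ℝ, t ∈ ({y}ᶜ : Set ℝ) from ae_ne y)] at h

lemma intervalIntegrable_hankelWave_boundary {κ : ℝ} (hκ : 0 < κ) (y a b : ℝ) :
    IntervalIntegrable (fun t => hankelWave κ y (t, 0)) volume a b := by
  refine (intervalIntegrable_layerMajorant κ y a b).mono_fun
    (aestronglyMeasurable_hankelWave_boundary hκ y).restrict ?_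
  filter_upwards [ae_restrict_of_ae (ae_ne y)] with t ht
  exact (norm_hankelWave_le_layerMajorant hκ ht 0).trans (le_abs_self _)

lemma tendsto_integral_apertureCutoff {κ ε R : ℝ} (hκ : 0 < κ) (hε : 0 < ε) (hR : ε ≤ R) (y : ℝ) :
    Tendsto (fun ρ => ∫ t in (0 : ℝ)..ε, apertureCutoff ε R ρ (t, 0) * hankelWave κ y (t, 0))
      (𝓝[>] 0) (𝓝 (∫ t in (0 : ℝ)..ε, hankelWave κ y (t, 0))) := by
  have hInt := intervalIntegrable_hankelWave_boundary hκ y 0 ε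
  refine intervalIntegral.tendsto_integral_filter_of_dominated_convergence
    (fun t => 3 * ‖hankelWave κ y (t, 0)‖) ?_ ?_ (hInt.norm.const_mul 3) ?_
  · refine Eventually.of_forall fun ρ => AEStronglyMeasurable.mul ?_
      (aestronglyMeasurable_hankelWave_boundary hκ y).restrict
    have hcont : Continuous (apertureCutoff ε R ρ) :=
      ((continuous_discCutoff 0 R).sub (continuous_discCutoff 0 ρ)).sub (continuous_discCutoff ε ρ)
    exact (hcont.comp (by fun_prop)).aestronglyMeasurable
  · refine Eventually.of_forall fun ρ => Eventually.of_forall fun t _ => ?_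
    rw [norm_mul]
    gcongr
    refine (norm_sub_le _ _).trans ?_
    linarith [norm_sub_le (discCutoff 0 R (t, 0)) (discCutoff 0 ρ (t, 0)),
      norm_discCutoff_le_one 0 R (t, 0), norm_discCutoff_le_one 0 ρ (t, 0),
      norm_discCutoff_le_one ε ρ (t, 0)]
  · filter_upwards [ae_ne ε] with t htε ht
    rw [Set.uIoc_of_le hε.le] at ht
    refine tendsto_const_nhds.congr' ?_
    filter_upwards [eventually_apertureCutoff_eq_one ⟨ht.1, ht.2.lt_of_ne htε⟩ hR] with ρ hρ
    rw [hρ, one_mul]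

section
variable {κ ε y : ℝ} {c : ℂ} {W : ℝ × ℝ → ℂ}

lemma IsApertureField.green_discCutoff (hW : IsApertureField κ ε c W) (hκ : 0 < κ) (y : ℝ)
    {b σ A h : ℝ} (hσ : 0 < σ) (hh : 0 < h) (hhA : h ≤ A) (hb : |b| + 2 * σ ≤ A) :
    ∫ s in (-A)..A, discCutoff b σ (s, h) *
        (hankelWave κ y (s, h) * dSnd W (s, h) - W (s, h) * dSnd (hankelWave κ y) (s, h)) =
      -∫ p in Set.Icc ((-A, h) : ℝ × ℝ) (A, A),
        greenDensity W (hankelWave κ y) (discCutoff b σ) p := by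
  refine green_identity hW.toIsHelmholtz (isHelmholtz_hankelWave hκ y) (contDiffOn_discCutoff b σ)
    hh hhA fun p hp => discCutoff_eq_zero hσ ?_
  have hfst := abs_le.1 (abs_fst_sub_le_radius b p)
  have hsnd := (le_abs_self _).trans (abs_snd_le_radius b p)
  rcases hp with hp | hp | hp <;> linarith [neg_abs_le b, le_abs_self b]

lemma IsApertureField.layers_eq_bulk (hW : IsApertureField κ ε c W) (hκ : 0 < κ) (hε : 0 ≤ ε)
    (y : ℝ) {R ρ h : ℝ} (hρ : 0 < ρ) (hR : ε + ρ ≤ R) (hh : 0 < h) (hhR : h ≤ 2 * R) :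
    (∫ s in (-(2 * R))..(2 * R), apertureCutoff ε R ρ (s, h) *
        (hankelWave κ y (s, h) * dSnd W (s, h))) -
      ∫ s in (-(2 * R))..(2 * R), apertureCutoff ε R ρ (s, h) *
        (W (s, h) * dSnd (hankelWave κ y) (s, h)) =
    -(∫ p in Set.Icc ((-(2 * R), h) : ℝ × ℝ) (2 * R, 2 * R),
        greenDensity W (hankelWave κ y) (discCutoff 0 R) p) +
      (∫ p in Set.Icc ((-(2 * R), h) : ℝ × ℝ) (2 * R, 2 * R),
        greenDensity W (hankelWave κ y) (discCutoff 0 ρ) p) +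
      ∫ p in Set.Icc ((-(2 * R), h) : ℝ × ℝ) (2 * R, 2 * R),
        greenDensity W (hankelWave κ y) (discCutoff ε ρ) p := by
  have hE := isHelmholtz_hankelWave hκ y
  have hline : Continuous fun s : ℝ => (s, h) := by fun_prop
  have hsingle : Continuous fun s => hankelWave κ y (s, h) * dSnd W (s, h) :=
    (continuous_comp_line hE.contDiffOn.continuousOn hh).mul
      (continuous_comp_line hW.continuousOn_dSnd hh)
  have hdouble : Continuous fun s => W (s, h) * dSnd (hankelWave κ y) (s, h) :=
    (continuous_comp_line hW.contDiffOn.continuousOn hh).mul (continuous_comp_line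
      (contDiffOn_dirDeriv (m := 1) hE.contDiffOn le_rfl (0, 1)).continuousOn hh)
  have hcut : ∀ b σ : ℝ, Continuous fun s => discCutoff b σ (s, h) := fun b σ =>
    (continuous_discCutoff b σ).comp hline
  have hap : ∀ {g : ℝ → ℂ}, Continuous g → IntervalIntegrable
      (fun s => apertureCutoff ε R ρ (s, h) * g s) volume (-(2 * R)) (2 * R) := fun hg =>
    ((((hcut 0 R).sub (hcut 0 ρ)).sub (hcut ε ρ)).mul hg).intervalIntegrable _ _
  have hdisc : ∀ b σ : ℝ, IntervalIntegrable (fun s => discCutoff b σ (s, h) *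
      (hankelWave κ y (s, h) * dSnd W (s, h) - W (s, h) * dSnd (hankelWave κ y) (s, h))) volume
      (-(2 * R)) (2 * R) := fun b σ =>
    ((hcut b σ).mul (hsingle.sub hdouble)).intervalIntegrable _ _
  rw [← neg_neg (∫ p in _, greenDensity _ _ (discCutoff 0 ρ) p),
    ← neg_neg (∫ p in _, greenDensity _ _ (discCutoff ε ρ) p),
    ← hW.green_discCutoff hκ y (by linarith) hh hhR (by simp),
    ← hW.green_discCutoff hκ y hρ hh hhR (by rw [abs_zero]; linarith),
    ← hW.green_discCutoff hκ y hρ hh hhR (by rw [abs_of_nonneg hε]; linarith),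
    ← sub_eq_add_neg, ← sub_eq_add_neg, ← intervalIntegral.integral_sub (hap hsingle) (hap hdouble),
    ← intervalIntegral.integral_sub (hdisc 0 R) (hdisc 0 ρ),
    ← intervalIntegral.integral_sub ((hdisc 0 R).sub (hdisc 0 ρ)) (hdisc ε ρ)]
  refine intervalIntegral.integral_congr fun s _ => ?_
  simp only [apertureCutoff]
  ring

lemma IsApertureField.exists_cutoff_trace_le (hW : IsApertureField κ ε c W) (hκ : 0 < κ)
    (hε : 0 < ε) (hy : y ∈ Set.Ioo 0 ε) {η : ℝ} (hη : 0 < η) :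
    ∃ R ≥ ε, ∀ᶠ ρ in 𝓝[>] 0, ‖c * (∫ t in (0 : ℝ)..ε, apertureCutoff ε R ρ (t, 0) *
      hankelWave κ y (t, 0)) + Real.pi * W (y, 0)‖ ≤ 3 * η := by
  obtain ⟨R₀, hfar⟩ := hW.exists_far_bulk_le hκ hε y hη
  set R := max R₀ (ε + 1)
  have hRε : ε + 1 ≤ R := le_max_right _ _
  refine ⟨R, by linarith, ?_⟩
  filter_upwards [hW.eventually_near_bulk_le hκ hy.1.ne' hη,
    hW.eventually_near_bulk_le hκ hy.2.ne hη, eventually_apertureCutoff_eq_one hy (R := R)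
      (by linarith), Ioo_mem_nhdsGT (show 0 < min (ε / 4) 1 by positivity)]
    with ρ hleft hright hone hρ
  obtain ⟨hρε, hρ1⟩ := lt_min_iff.1 hρ.2
  have hχ : IsEndpointCutoff ε (apertureCutoff ε R ρ) :=
    isEndpointCutoff_apertureCutoff hρ.1 (by linarith) (by linarith)
  have hlimit := (hW.tendsto_singleLayer hκ hε hχ (A := 2 * R) (by linarith) y).sub
    (hW.tendsto_doubleLayer hκ hχ (y := y) (A := 2 * R)
      (abs_lt.2 ⟨by linarith [hy.1], by linarith [hy.2]⟩))
  rw [hone, one_mul, sub_neg_eq_add] at hlimit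
  refine le_of_tendsto hlimit.norm ?_
  filter_upwards [Ioo_mem_nhdsGT (show 0 < 2 * R by linarith)] with h hh
  rw [hW.layers_eq_bulk hκ hε.le y hρ.1 (by linarith) hh.1 hh.2.le]
  refine norm_add₃_le.trans ?_
  rw [norm_neg]
  linarith [hfar R (le_max_left _ _) h hh.1 hh.2.le, hleft (2 * R) h hh.1, hright (2 * R) h hh.1]

theorem IsApertureField.trace_eq (hW : IsApertureField κ ε c W) (hκ : 0 < κ) (hε : 0 < ε)
    (hy : y ∈ Set.Ioo 0 ε) :
    c * (∫ t in (0 : ℝ)..ε, hankelWave κ y (t, 0)) + Real.pi * W (y, 0) = 0 := by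
  rw [← norm_le_zero_iff]
  refine le_of_forall_pos_le_add fun η hη => ?_
  obtain ⟨R, hR, hρ⟩ := hW.exists_cutoff_trace_le hκ hε hy (show 0 < η / 3 by positivity)
  have hlimit := ((tendsto_integral_apertureCutoff hκ hε hR y).const_mul c).add_const
    (Real.pi * W (y, 0))
  have := le_of_tendsto hlimit.norm hρ
  linarith

end

/-! ### The scattered field in product coordinates -/

/-- The identification of `ℝ × ℝ` with the Euclidean plane. -/
def toPlane : (ℝ × ℝ) ≃L[ℝ] Plane :=
  (ContinuousLinearEquiv.finTwoArrow ℝ ℝ).symm.trans (EuclideanSpace.equiv (Fin 2) ℝ).symm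

lemma toPlane_apply (p : ℝ × ℝ) : toPlane p = !₂[p.1, p.2] := rfl

lemma toPlane_fst : toPlane (1, 0) = EuclideanSpace.single 0 1 := by
  ext i
  fin_cases i <;> simp [toPlane_apply]

lemma toPlane_snd : toPlane (0, 1) = EuclideanSpace.single 1 1 := by
  ext i
  fin_cases i <;> simp [toPlane_apply]

lemma norm_toPlane (p : ℝ × ℝ) : ‖toPlane p‖ = radius 0 p := by
  simp [EuclideanSpace.norm_eq, radius, toPlane_apply]

lemma measurePreserving_toPlane : MeasurePreserving toPlane volume volume :=
  (EuclideanSpace.volume_preserving_symm_measurableEquiv_toLp (Fin 2)).symm.comp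
    (volume_preserving_finTwoArrow ℝ).symm

lemma isOpen_upperHalf : IsOpen upperHalf :=
  isOpen_lt continuous_const (EuclideanSpace.proj (𝕜 := ℝ) (1 : Fin 2)).continuous

lemma tendsto_toPlane_boundary (t : ℝ) :
    Tendsto toPlane (𝓝[upperProd] (t, 0)) (𝓝[upperHalf] !₂[t, 0]) :=
  tendsto_nhdsWithin_iff.2 ⟨(toPlane.continuous.tendsto (t, 0)).mono_left nhdsWithin_le_nhds,
    eventually_mem_nhdsWithin⟩

lemma dirDeriv_comp_toPlane (v : ℝ × ℝ) (f : Plane → ℂ) (p : ℝ × ℝ) :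
    dirDeriv v (fun q => f (toPlane q)) p = fderiv ℝ f (toPlane p) (toPlane v) := by
  have hcomp : fderiv ℝ (fun q => f (toPlane q)) p =
      (fderiv ℝ f (toPlane p)).comp (toPlane : _ →L[ℝ] Plane) := toPlane.comp_right_fderiv
  rw [dirDeriv, hcomp]
  rfl

lemma dFst_comp_toPlane (f : Plane → ℂ) :
    (dFst fun q => f (toPlane q)) = fun q => partialDeriv 0 f (toPlane q) :=
  funext fun q => (dirDeriv_comp_toPlane _ f q).trans (by rw [toPlane_fst, partialDeriv])

lemma dSnd_comp_toPlane (f : Plane → ℂ) :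
    (dSnd fun q => f (toPlane q)) = fun q => partialDeriv 1 f (toPlane q) :=
  funext fun q => (dirDeriv_comp_toPlane _ f q).trans (by rw [toPlane_snd, partialDeriv])

lemma laplacian_eq_partialDeriv {f : Plane → ℂ} {x : Plane} (hf : ContDiffAt ℝ 2 f x) :
    Laplacian.laplacian f x =
      partialDeriv 0 (partialDeriv 0 f) x + partialDeriv 1 (partialDeriv 1 f) x := by
  have hdiff : DifferentiableAt ℝ (fderiv ℝ f) x :=
    (hf.fderiv_right (m := 1) one_add_one_eq_two.le).differentiableAt one_ne_zero
  have hpartial (i : Fin 2) : partialDeriv i (partialDeriv i f) x =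
      fderiv ℝ (fderiv ℝ f) x (EuclideanSpace.single i 1) (EuclideanSpace.single i 1) := by
    have h : HasFDerivAt (partialDeriv i f) _ x :=
      hdiff.hasFDerivAt.clm_apply (hasFDerivAt_const (EuclideanSpace.single i (1 : ℝ)) x)
    rw [partialDeriv, h.fderiv]
    simp
  rw [hpartial, hpartial, InnerProductSpace.laplacian_eq_iteratedFDeriv_orthonormalBasis f
    (EuclideanSpace.basisFun (Fin 2) ℝ)]
  simp only [Fin.sum_univ_two, iteratedFDeriv_two_apply, EuclideanSpace.basisFun_apply]
  rfl

lemma isHelmholtz_comp_toPlane {κ : ℝ} {f : Plane → ℂ} (hf : ContDiffOn ℝ 2 f upperHalf)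
    (hκ : ∀ x ∈ upperHalf, Laplacian.laplacian f x + (κ : ℂ) ^ 2 * f x = 0) :
    IsHelmholtz κ (fun p => f (toPlane p)) where
  contDiffOn := hf.comp toPlane.contDiff.contDiffOn fun _ hp => hp
  laplacian_add p hp := by
    rw [dFst_comp_toPlane, dSnd_comp_toPlane, dFst_comp_toPlane, dSnd_comp_toPlane,
      ← laplacian_eq_partialDeriv (hf.contDiffAt (isOpen_upperHalf.mem_nhds hp)), hκ _ hp]

lemma dirDeriv_sub {f g : ℝ × ℝ → ℂ} {p : ℝ × ℝ} (v : ℝ × ℝ) (hf : DifferentiableAt ℝ f p)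
    (hg : DifferentiableAt ℝ g p) :
    dirDeriv v (fun q => f q - g q) p = dirDeriv v f p - dirDeriv v g p := by
  rw [dirDeriv, fderiv_fun_sub hf hg]
  rfl

lemma IsHelmholtz.sub {κ : ℝ} {f g : ℝ × ℝ → ℂ} (hf : IsHelmholtz κ f) (hg : IsHelmholtz κ g) :
    IsHelmholtz κ (fun p => f p - g p) where
  contDiffOn := hf.contDiffOn.sub hg.contDiffOn
  laplacian_add p hp := by
    have hsecond (v : ℝ × ℝ) : dirDeriv v (dirDeriv v fun q => f q - g q) p =
        dirDeriv v (dirDeriv v f) p - dirDeriv v (dirDeriv v g) p := by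
      have hfirst : dirDeriv v (fun q => f q - g q) =ᶠ[𝓝 p]
          fun q => dirDeriv v f q - dirDeriv v g q := by
        filter_upwards [isOpen_upperProd.mem_nhds hp] with q hq
        exact dirDeriv_sub v (differentiableAt_upperProd hf.contDiffOn two_ne_zero hq)
          (differentiableAt_upperProd hg.contDiffOn two_ne_zero hq)
      have hdiff {u : ℝ × ℝ → ℂ} (hu : ContDiffOn ℝ 2 u upperProd) :
          DifferentiableAt ℝ (dirDeriv v u) p :=
        differentiableAt_upperProd (contDiffOn_dirDeriv hu one_add_one_eq_two.le v) one_ne_zero hp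
      rw [← dirDeriv_sub v (hdiff hf.contDiffOn) (hdiff hg.contDiffOn), dirDeriv, dirDeriv,
        hfirst.fderiv_eq]
    linear_combination hsecond (1, 0) + hsecond (0, 1) + hf.laplacian_add p hp -
      hg.laplacian_add p hp

/-- The plane wave `exp (i (a x₁ + b x₂))`. -/
def planeWave (a b : ℝ) (p : ℝ × ℝ) : ℂ := Complex.exp (I * (a * p.1 + b * p.2))

lemma contDiff_planeWave (a b : ℝ) {n : ℕ∞} : ContDiff ℝ n (planeWave a b) := by
  have hfst : ContDiff ℝ n fun p : ℝ × ℝ => (p.1 : ℂ) :=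
    Complex.ofRealCLM.contDiff.comp contDiff_fst
  have hsnd : ContDiff ℝ n fun p : ℝ × ℝ => (p.2 : ℂ) :=
    Complex.ofRealCLM.contDiff.comp contDiff_snd
  unfold planeWave
  fun_prop

lemma dirDeriv_planeWave (a b : ℝ) (v : ℝ × ℝ) :
    dirDeriv v (planeWave a b) = fun p => I * (a * v.1 + b * v.2) * planeWave a b p := by
  ext p
  have hfst : HasFDerivAt (fun p : ℝ × ℝ => (p.1 : ℂ)) _ p :=
    (Complex.ofRealCLM.comp (ContinuousLinearMap.fst ℝ ℝ ℝ)).hasFDerivAt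
  have hsnd : HasFDerivAt (fun p : ℝ × ℝ => (p.2 : ℂ)) _ p :=
    (Complex.ofRealCLM.comp (ContinuousLinearMap.snd ℝ ℝ ℝ)).hasFDerivAt
  have h : HasFDerivAt (planeWave a b) _ p :=
    (((hfst.const_mul (a : ℂ)).add (hsnd.const_mul (b : ℂ))).const_mul I).cexp
  rw [dirDeriv, h.fderiv]
  simp only [Pi.add_apply, smul_add, add_apply, smul_apply, ContinuousLinearMap.comp_apply,
    ContinuousLinearMap.coe_fst', Complex.ofRealCLM_apply, smul_eq_mul,
    ContinuousLinearMap.coe_snd', planeWave]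
  ring

lemma isHelmholtz_planeWave {κ a b : ℝ} (hab : a ^ 2 + b ^ 2 = κ ^ 2) :
    IsHelmholtz κ (planeWave a b) where
  contDiffOn := (contDiff_planeWave a b (n := 2)).contDiffOn
  laplacian_add p _ := by
    have hsecond (v : ℝ × ℝ) : dirDeriv v (dirDeriv v (planeWave a b)) p =
        (I * (a * v.1 + b * v.2)) ^ 2 * planeWave a b p := by
      have hd : DifferentiableAt ℝ (planeWave a b) p :=
        (contDiff_planeWave a b (n := 1)).differentiable one_ne_zero p
      conv_lhs => rw [dirDeriv_planeWave, dirDeriv, fderiv_const_mul hd]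
      rw [smul_apply, ← dirDeriv, dirDeriv_planeWave, smul_eq_mul]
      ring
    have hab' : (a : ℂ) ^ 2 + (b : ℂ) ^ 2 = (κ : ℂ) ^ 2 := by exact_mod_cast hab
    have hfst := hsecond (1, 0)
    have hsnd := hsecond (0, 1)
    simp only [Complex.ofReal_one, Complex.ofReal_zero, mul_one, mul_zero, add_zero, zero_add]
      at hfst hsnd
    linear_combination hfst + hsnd + ((a : ℂ) ^ 2 + b ^ 2) * planeWave a b p * Complex.I_sq -
      planeWave a b p * hab'

lemma scattered_toPlane (κ θ : ℝ) (v : Plane → ℂ) :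
    (fun p => scattered κ θ v (toPlane p)) = fun p => v (toPlane p) -
      planeWave (κ * Real.sin θ) (-(κ * Real.cos θ)) p -
      planeWave (κ * Real.sin θ) (κ * Real.cos θ) p := by
  ext p
  have h₀ : toPlane p 0 = p.1 := rfl
  have h₁ : toPlane p 1 = p.2 := rfl
  rw [sub_sub, scattered, uInc, uRef, planeWave, planeWave, h₀, h₁]
  push_cast
  ring_nf

lemma continuousOn_energyDensity {f : ℝ × ℝ → ℂ} (hf : ContDiffOn ℝ 1 f upperProd) :
    ContinuousOn (energyDensity f) upperProd := by
  have hd (v : ℝ × ℝ) : ContinuousOn (dirDeriv v f) upperProd :=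
    (contDiffOn_dirDeriv (m := 0) hf (zero_add 1).le v).continuousOn
  exact (((hd _).norm.pow 2).add ((hd _).norm.pow 2)).add (hf.continuousOn.norm.pow 2)

lemma energyDensity_sub_le {f g : ℝ × ℝ → ℂ} {p : ℝ × ℝ} (hf : DifferentiableAt ℝ f p)
    (hg : DifferentiableAt ℝ g p) :
    energyDensity (fun q => f q - g q) p ≤ 2 * energyDensity f p + 2 * energyDensity g p := by
  have hsq (a b : ℂ) : ‖a - b‖ ^ 2 ≤ 2 * ‖a‖ ^ 2 + 2 * ‖b‖ ^ 2 := by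
    nlinarith [parallelogram_law_with_norm ℝ a b, norm_nonneg (a + b)]
  simp only [energyDensity, dirDeriv_sub _ hf hg]
  linarith [hsq (dFst f p) (dFst g p), hsq (dSnd f p) (dSnd g p), hsq (f p) (g p)]

lemma integrableOn_energyDensity_of_contDiff {g : ℝ × ℝ → ℂ} (hg : ContDiff ℝ 1 g) (b s : ℝ) :
    IntegrableOn (energyDensity g) (halfBox b s) := by
  have hd (v : ℝ × ℝ) : Continuous (dirDeriv v g) :=
    (hg.continuous_fderiv one_ne_zero).clm_apply continuous_const
  have hcont : Continuous (energyDensity g) :=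
    (((hd _).norm.pow 2).add ((hd _).norm.pow 2)).add (hg.continuous.norm.pow 2)
  exact (hcont.continuousOn.integrableOn_compact (isCompact_Icc.prod isCompact_Icc)).mono_set
    (Set.prod_mono Set.Ioo_subset_Icc_self Set.Ioo_subset_Icc_self)

lemma integrableOn_energyDensity_sub {f g : ℝ × ℝ → ℂ} {b s : ℝ}
    (hf : ContDiffOn ℝ 1 f upperProd) (hg : ContDiff ℝ 1 g)
    (hint : IntegrableOn (energyDensity f) (halfBox b s)) :
    IntegrableOn (energyDensity fun p => f p - g p) (halfBox b s) := by
  have hsub : halfBox b s ⊆ upperProd := fun p hp => hp.2.1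
  have hg' := integrableOn_energyDensity_of_contDiff hg b s
  refine ((hint.const_mul 2).add (hg'.const_mul 2)).mono'
    (((continuousOn_energyDensity (hf.sub hg.contDiffOn)).mono hsub).aestronglyMeasurable
      (measurableSet_halfBox b s)) ?_
  filter_upwards [ae_restrict_mem (measurableSet_halfBox b s)] with p hp
  rw [Real.norm_of_nonneg (by rw [energyDensity]; positivity)]
  exact energyDensity_sub_le (differentiableAt_upperProd hf one_ne_zero (hsub hp))
    (hg.differentiable one_ne_zero p)

lemma integrableOn_halfBox_comp_toPlane {F : Plane → ℝ}
    (hF : ∀ R : ℝ, IntegrableOn F (Metric.ball 0 R ∩ upperHalf)) (R : ℝ) :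
    IntegrableOn (fun p => F (toPlane p)) (halfBox 0 R) := by
  refine ((measurePreserving_toPlane.integrableOn_comp_preimage
    toPlane.toHomeomorph.measurableEmbedding).2 (hF (2 * R))).mono_set ?_
  rintro p ⟨⟨hleft, hright⟩, hpos, htop⟩
  refine ⟨?_, hpos⟩
  rw [mem_ball_zero_iff, norm_toPlane, radius, Real.sqrt_lt' (by linarith)]
  nlinarith

section
variable {κ θ ε d : ℝ} {v : Plane → ℂ}

lemma IsApproxSolution.isHelmholtz (hv : IsApproxSolution κ θ ε d v) :
    IsHelmholtz κ (fun p => scattered κ θ v (toPlane p)) := by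
  have hwave : (κ * Real.sin θ) ^ 2 + (κ * Real.cos θ) ^ 2 = κ ^ 2 := by
    linear_combination κ ^ 2 * Real.sin_sq_add_cos_sq θ
  rw [scattered_toPlane]
  exact ((isHelmholtz_comp_toPlane hv.contDiffOn hv.helmholtz).sub
    (isHelmholtz_planeWave (by rw [neg_sq, hwave]))).sub (isHelmholtz_planeWave hwave)

lemma IsApproxSolution.integrableOn_energyDensity (hv : IsApproxSolution κ θ ε d v) (R : ℝ) :
    IntegrableOn (energyDensity fun p => scattered κ θ v (toPlane p)) (halfBox 0 R) := by
  have hV : ContDiffOn ℝ 1 (fun p => v (toPlane p)) upperProd :=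
    (isHelmholtz_comp_toPlane hv.contDiffOn hv.helmholtz).contDiffOn.of_le one_le_two
  have henergy : IntegrableOn (energyDensity fun p => v (toPlane p)) (halfBox 0 R) := by
    have h := (integrableOn_halfBox_comp_toPlane hv.gradSq_integrable R).add
      (integrableOn_halfBox_comp_toPlane hv.sq_integrable R)
    refine h.congr_fun (fun p _ => ?_) (measurableSet_halfBox 0 R)
    simp only [energyDensity, dFst_comp_toPlane, dSnd_comp_toPlane, Pi.add_apply, gradSq]
  rw [scattered_toPlane]
  exact integrableOn_energyDensity_sub (hV.sub (contDiff_planeWave _ _).contDiffOn)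
    (contDiff_planeWave _ _) (integrableOn_energyDensity_sub hV (contDiff_planeWave _ _) henergy)

lemma IsApproxSolution.tendsto_dSnd (hv : IsApproxSolution κ θ ε d v) {t : ℝ} {a : ℂ}
    (ha : Tendsto (partialDeriv 1 v) (𝓝[upperHalf] !₂[t, 0]) (𝓝 a)) :
    Tendsto (dSnd fun p => scattered κ θ v (toPlane p)) (𝓝[upperProd] (t, 0)) (𝓝 a) := by
  have hV : ContDiffOn ℝ 2 (fun p => v (toPlane p)) upperProd :=
    (isHelmholtz_comp_toPlane hv.contDiffOn hv.helmholtz).contDiffOn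
  have htrace : Tendsto (dSnd fun p => v (toPlane p)) (𝓝[upperProd] (t, 0)) (𝓝 a) := by
    rw [dSnd_comp_toPlane]
    exact ha.comp (tendsto_toPlane_boundary t)
  have hwave (b : ℝ) : Tendsto (dSnd (planeWave (κ * Real.sin θ) b)) (𝓝[upperProd] (t, 0))
      (𝓝 (dSnd (planeWave (κ * Real.sin θ) b) (t, 0))) :=
    (((contDiff_planeWave _ b (n := 1)).continuous_fderiv one_ne_zero).clm_apply
      continuous_const).continuousAt.continuousWithinAt
  have hlim := (htrace.sub (hwave (-(κ * Real.cos θ)))).sub (hwave (κ * Real.cos θ))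
  have hcancel : a - dSnd (planeWave (κ * Real.sin θ) (-(κ * Real.cos θ))) (t, 0) -
      dSnd (planeWave (κ * Real.sin θ) (κ * Real.cos θ)) (t, 0) = a := by
    simp [dirDeriv_planeWave, planeWave]
  rw [hcancel] at hlim
  refine hlim.congr' ?_
  filter_upwards [self_mem_nhdsWithin] with p hp
  have hd (b : ℝ) : DifferentiableAt ℝ (planeWave (κ * Real.sin θ) b) p :=
    (contDiff_planeWave _ b (n := 1)).differentiable one_ne_zero p
  have hVd := differentiableAt_upperProd hV two_ne_zero hp
  rw [scattered_toPlane]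
  exact ((dirDeriv_sub _ (hVd.fun_sub (hd _)) (hd _)).trans
    (congrArg (· - _) (dirDeriv_sub _ hVd (hd _)))).symm

lemma IsApproxSolution.norm_radiation_le (hv : IsApproxSolution κ θ ε d v) {η : ℝ} (hη : 0 < η) :
    ∃ R, ∀ p ∈ upperProd, R ≤ radius 0 p →
      ‖dirDeriv p (fun q => scattered κ θ v (toPlane q)) p -
        I * κ * radius 0 p * scattered κ θ v (toPlane p)‖ ≤ η * √(radius 0 p) := by
  have hbasis := (Metric.hasBasis_cobounded_compl_closedBall (0 : Plane)).inf_principal upperHalf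
  obtain ⟨R, -, hR⟩ := hbasis.eventually_iff.1 (Metric.tendsto_nhds.1 hv.radiation η hη)
  refine ⟨R + 1, fun p hp hpR => ?_⟩
  have hfar : toPlane p ∈ (Metric.closedBall 0 R)ᶜ ∩ upperHalf := by
    refine ⟨?_, hp⟩
    rw [Set.mem_compl_iff, mem_closedBall_zero_iff, norm_toPlane, not_le]
    linarith
  have hsmall := hR hfar
  have hr : 0 < radius 0 p := radius_pos hp
  have hrc : (radius 0 p : ℂ) ≠ 0 := by exact_mod_cast hr.ne'
  set S := scattered κ θ v
  set X := fderiv ℝ S (toPlane p) ((radius 0 p)⁻¹ • toPlane p) - I * κ * S (toPlane p) with hX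
  have hdecomp : dirDeriv p (fun q => S (toPlane q)) p - I * κ * radius 0 p * S (toPlane p) =
      radius 0 p * X := by
    rw [hX, dirDeriv_comp_toPlane, map_smul, Complex.real_smul]
    push_cast
    field_simp
  rw [dist_zero_right, norm_toPlane, norm_mul, Complex.norm_real,
    Real.norm_of_nonneg (Real.sqrt_nonneg _)] at hsmall
  rw [hdecomp, norm_mul, Complex.norm_real, Real.norm_of_nonneg hr.le]
  calc radius 0 p * ‖X‖ = √(radius 0 p) * ‖X‖ * √(radius 0 p) := by
        nth_rewrite 1 [← Real.mul_self_sqrt hr.le]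
        ring
    _ ≤ η * √(radius 0 p) := by gcongr

theorem IsApproxSolution.isApertureField (hv : IsApproxSolution κ θ ε d v) :
    IsApertureField κ ε (dtn0 κ ε d v) (fun p => scattered κ θ v (toPlane p)) where
  toIsHelmholtz := hv.isHelmholtz
  continuousOn := by
    rw [scattered_toPlane]
    refine ((hv.continuousOn.comp toPlane.continuous.continuousOn ?_).sub
      (contDiff_planeWave _ _ (n := 1)).continuous.continuousOn).sub
      (contDiff_planeWave _ _ (n := 1)).continuous.continuousOn
    rintro p ⟨hp, hleft, hright⟩
    exact ⟨hp, fun h => hleft (toPlane.injective h), fun h => hright (toPlane.injective h)⟩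
  energy := hv.integrableOn_energyDensity
  neumann t ht := hv.tendsto_dSnd (hv.neumann t ht)
  aperture t ht := hv.tendsto_dSnd (hv.aperture t ht)
  radiation _ hη := hv.norm_radiation_le hη

end

/-! ### The single layer over the aperture -/

/-- The single-layer potential of the aperture at the boundary point `(y, 0)`. -/
def layer (κ ε y : ℝ) : ℂ := ∫ t in (0 : ℝ)..ε, hankelWave κ y (t, 0)

/-- The integral of the single-layer potential over the aperture that generates it. -/
def selfLayer (κ ε : ℝ) : ℂ := ∫ y in (0 : ℝ)..ε, layer κ ε y

section
variable {κ ε : ℝ}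

lemma continuous_layer (hκ : 0 < κ) (ε : ℝ) : Continuous (layer κ ε) := by
  have hint := intervalIntegrable_hankelWave_boundary hκ 0
  have hshift (y : ℝ) : layer κ ε y = (∫ s in (0 : ℝ)..(ε - y), hankelWave κ 0 (s, 0)) -
      ∫ s in (0 : ℝ)..(0 - y), hankelWave κ 0 (s, 0) := by
    rw [intervalIntegral.integral_interval_sub_left (hint _ _) (hint _ _),
      ← intervalIntegral.integral_comp_sub_right (fun s => hankelWave κ 0 (s, 0)) y, layer]
    simp only [hankelWave, radius_boundary, sub_zero]
  have hprim := intervalIntegral.continuous_primitive hint 0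
  rw [funext hshift]
  exact (hprim.comp (by fun_prop)).sub (hprim.comp (by fun_prop))

lemma ae_mul_abs_sub_mem (hκ : 0 < κ) {y : ℝ} (hy : y ∈ Set.Icc 0 ε) :
    ∀ᵐ t : ℝ, t ∈ Set.Icc 0 ε → 0 < |t - y| ∧ κ * |t - y| ∈ Set.Ioc 0 (κ * ε) := by
  filter_upwards [ae_ne y] with t hty ht
  have hpos : 0 < |t - y| := abs_pos.2 (sub_ne_zero.2 hty)
  have hle : |t - y| ≤ ε := by
    rw [abs_le]
    constructor <;> linarith [ht.1, ht.2, hy.1, hy.2]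
  exact ⟨hpos, by positivity, by gcongr⟩

lemma re_layer_ge {C y z₀ : ℝ} (hκ : 0 < κ) (hε : 0 < ε) (hz₀ : κ * ε ≤ z₀)
    (hC : ∀ z ∈ Set.Ioc 0 z₀, -(Real.log z / 2) - C ≤ (hankelMoment 0 z).re)
    (hy : y ∈ Set.Icc 0 ε) :
    ε * (-(Real.log (κ * ε) / 2) - C) ≤ (layer κ ε y).re := by
  have hint := intervalIntegrable_hankelWave_boundary hκ y 0 ε
  calc ε * (-(Real.log (κ * ε) / 2) - C)
      = ∫ _ in (0 : ℝ)..ε, (-(Real.log (κ * ε) / 2) - C) := by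
        rw [intervalIntegral.integral_const, sub_zero, smul_eq_mul]
    _ ≤ ∫ t in (0 : ℝ)..ε, (hankelWave κ y (t, 0)).re := by
        refine intervalIntegral.integral_mono_ae_restrict hε.le intervalIntegrable_const
          ⟨Complex.reCLM.integrable_comp hint.1, Complex.reCLM.integrable_comp hint.2⟩ ?_
        filter_upwards [ae_restrict_mem measurableSet_Icc,
          ae_restrict_of_ae (ae_mul_abs_sub_mem hκ hy)] with t ht hmem
        obtain ⟨-, hpos, hle⟩ := hmem ht
        have hlog := Real.log_le_log hpos hle
        have hre := hC _ ⟨hpos, hle.trans hz₀⟩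
        rw [hankelWave, radius_boundary]
        linarith
    _ = (layer κ ε y).re := Complex.reCLM.intervalIntegral_comp_comm hint

lemma mul_log_add_sub_le {x : ℝ} (hx : 0 ≤ x) (hε : 0 < ε) :
    x * Real.log ε + x - ε ≤ x * Real.log x := by
  rcases hx.eq_or_lt with rfl | hx
  · simpa using hε.le
  · have h := mul_le_mul_of_nonneg_left (Real.one_sub_inv_le_log_of_pos (div_pos hx hε)) hx.le
    rw [Real.log_div hx.ne' hε.ne', inv_div, mul_sub, mul_one, mul_div_cancel₀ _ hx.ne'] at h
    linarith

lemma integral_log_sub_ge {y : ℝ} (hε : 0 < ε) (hy : y ∈ Set.Icc 0 ε) :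
    ε * Real.log ε - 2 * ε ≤ ∫ t in (0 : ℝ)..ε, Real.log (t - y) := by
  rw [intervalIntegral.integral_comp_sub_right (fun s => Real.log s) y, integral_log, zero_sub,
    Real.log_neg_eq_log]
  linarith [mul_log_add_sub_le hy.1 hε, mul_log_add_sub_le (sub_nonneg.2 hy.2) hε]

lemma norm_layer_le {C K y : ℝ} (hκ : 0 < κ) (hε : 0 < ε) (hκε : κ * ε ≤ 1) (hK : 0 ≤ K)
    (hC : ∀ z ∈ Set.Ioc (0 : ℝ) 1, ‖hankelMoment 0 z‖ ≤ C - K * Real.log z)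
    (hy : y ∈ Set.Icc 0 ε) :
    ‖layer κ ε y‖ ≤ ε * (C + 2 * K - K * Real.log (κ * ε)) := by
  have hlog : IntervalIntegrable (fun t => Real.log (t - y)) volume 0 ε := by
    simpa using
      (intervalIntegral.intervalIntegrable_log' (a := 0 - y) (b := ε - y)).comp_sub_right y
  have hbound : ∀ᵐ t : ℝ, t ∈ Set.Ioc 0 ε →
      ‖hankelWave κ y (t, 0)‖ ≤ C - K * Real.log κ - K * Real.log (t - y) := by
    filter_upwards [ae_mul_abs_sub_mem hκ hy] with t hmem ht
    obtain ⟨hty, hpos, hle⟩ := hmem ⟨ht.1.le, ht.2⟩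
    have h := hC _ ⟨hpos, hle.trans hκε⟩
    rw [Real.log_mul hκ.ne' hty.ne', Real.log_abs] at h
    rw [hankelWave, radius_boundary]
    linarith
  calc ‖layer κ ε y‖
      ≤ ∫ t in (0 : ℝ)..ε, (C - K * Real.log κ - K * Real.log (t - y)) :=
        intervalIntegral.norm_integral_le_of_norm_le hε.le hbound
          (intervalIntegrable_const.sub (hlog.const_mul K))
    _ = ε * (C - K * Real.log κ) - K * ∫ t in (0 : ℝ)..ε, Real.log (t - y) := by
        rw [intervalIntegral.integral_sub intervalIntegrable_const (hlog.const_mul K),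
          intervalIntegral.integral_const, intervalIntegral.integral_const_mul, sub_zero,
          smul_eq_mul]
    _ ≤ ε * (C - K * Real.log κ) - K * (ε * Real.log ε - 2 * ε) := by
        gcongr
        exact integral_log_sub_ge hε hy
    _ = ε * (C + 2 * K - K * Real.log (κ * ε)) := by
        rw [Real.log_mul hκ.ne' hε.ne']
        ring

lemma re_selfLayer_ge {B : ℝ} (hκ : 0 < κ) (hε : 0 < ε)
    (hB : ∀ y ∈ Set.Icc 0 ε, B ≤ (layer κ ε y).re) : ε * B ≤ (selfLayer κ ε).re := by
  have hc := continuous_layer hκ ε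
  calc ε * B = ∫ _ in (0 : ℝ)..ε, B := by
        rw [intervalIntegral.integral_const, sub_zero, smul_eq_mul]
    _ ≤ ∫ y in (0 : ℝ)..ε, (layer κ ε y).re :=
        intervalIntegral.integral_mono_on hε.le intervalIntegrable_const
          ((Complex.continuous_re.comp hc).intervalIntegrable _ _) hB
    _ = (selfLayer κ ε).re :=
        Complex.reCLM.intervalIntegral_comp_comm (hc.intervalIntegrable _ _)

lemma norm_selfLayer_le {B : ℝ} (hε : 0 < ε)
    (hB : ∀ y ∈ Set.Icc 0 ε, ‖layer κ ε y‖ ≤ B) : ‖selfLayer κ ε‖ ≤ ε * B := by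
  have h := intervalIntegral.norm_integral_le_of_norm_le_const (a := 0) (b := ε)
    (f := layer κ ε) (C := B) fun y hy =>
      hB y (Set.Ioc_subset_Icc_self (Set.uIoc_of_le hε.le ▸ hy))
  rwa [sub_zero, abs_of_pos hε, mul_comm] at h

lemma log_wavelength_div (hκ : 0 < κ) (hε : 0 < ε) :
    Real.log (wavelength κ / ε) = Real.log (2 * Real.pi) - Real.log (κ * ε) := by
  rw [wavelength, div_div, Real.log_div Real.two_pi_pos.ne' (by positivity)]

lemma log_two_pi_mem_Icc : Real.log (2 * Real.pi) ∈ Set.Icc 0 7 := by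
  have hlog := Real.log_le_sub_one_of_pos Real.two_pi_pos
  exact ⟨Real.log_nonneg (by linarith [Real.pi_gt_three]), by linarith [Real.pi_le_four]⟩

theorem exists_selfLayer_bounds : ∃ s A B : ℝ, 0 < s ∧ 0 < A ∧ 0 < B ∧
    ∀ κ ε : ℝ, 0 < κ → 0 < ε → κ * ε ≤ s →
      ε ^ 2 * (Real.log (wavelength κ / ε) / 2 - A) ≤ (selfLayer κ ε).re ∧
      ‖selfLayer κ ε‖ ≤ ε ^ 2 * (B * (1 + Real.log (wavelength κ / ε))) := by
  obtain ⟨z₀, C₀, hz₀, hC₀, hre⟩ := exists_re_hankelMoment_zero_ge_log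
  obtain ⟨C, K, hC, hK, hnorm⟩ := exists_norm_hankelMoment_zero_le_log
  refine ⟨min z₀ 1, C₀ + 4, C + 2 * K, by positivity, by positivity, by positivity,
    fun κ ε hκ hε hs => ?_⟩
  obtain ⟨hpi₀, hpi₁⟩ := log_two_pi_mem_Icc
  have hκε : κ * ε ≤ 1 := hs.trans (min_le_right _ _)
  have hlog : Real.log (κ * ε) ≤ 0 := Real.log_nonpos (by positivity) hκε
  rw [log_wavelength_div hκ hε, pow_two, mul_assoc, mul_assoc]
  constructor
  · refine le_trans ?_ (re_selfLayer_ge hκ hε fun y hy =>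
      re_layer_ge hκ hε (hs.trans (min_le_left _ _)) hre hy)
    refine mul_le_mul_of_nonneg_left (mul_le_mul_of_nonneg_left ?_ hε.le) hε.le
    linarith
  · refine (norm_selfLayer_le hε fun y hy => norm_layer_le hκ hε hκε hK.le hnorm hy).trans ?_
    refine mul_le_mul_of_nonneg_left (mul_le_mul_of_nonneg_left ?_ hε.le) hε.le
    nlinarith

end

/-- The integral over the aperture of the boundary trace `exp (i κ t sin θ)` of the incident
wave. -/
def apertureWave (κ θ ε : ℝ) : ℂ := ∫ t in (0 : ℝ)..ε, planeWave (κ * Real.sin θ) 0 (t, 0)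

lemma planeWave_boundary (a b t : ℝ) :
    planeWave a b (t, 0) = Complex.exp ((a * t : ℝ) * I) := by
  rw [planeWave]
  push_cast
  ring_nf

lemma norm_apertureWave_le (κ θ : ℝ) {ε : ℝ} (hε : 0 < ε) : ‖apertureWave κ θ ε‖ ≤ ε := by
  have h := intervalIntegral.norm_integral_le_of_norm_le_const (a := 0) (b := ε)
    (f := fun t => planeWave (κ * Real.sin θ) 0 (t, 0)) (C := 1) fun t _ => by
      rw [planeWave_boundary, Complex.norm_exp_ofReal_mul_I]
  rwa [sub_zero, abs_of_pos hε, one_mul] at h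

lemma half_le_cos {x : ℝ} (hx : |x| ≤ 1) : 1 / 2 ≤ Real.cos x := by
  linarith [Real.one_sub_sq_div_two_le_cos (x := x), (sq_le_one_iff_abs_le_one _).2 hx]

lemma half_le_norm_apertureWave {κ θ ε : ℝ} (hκ : 0 < κ) (hε : 0 < ε) (hκε : κ * ε ≤ 1) :
    ε / 2 ≤ ‖apertureWave κ θ ε‖ := by
  have hc : Continuous fun t : ℝ => planeWave (κ * Real.sin θ) 0 (t, 0) :=
    (contDiff_planeWave _ _ (n := 0)).continuous.comp (by fun_prop)
  have hre (t : ℝ) (ht : t ∈ Set.Icc 0 ε) : 1 / 2 ≤ (planeWave (κ * Real.sin θ) 0 (t, 0)).re := by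
    rw [planeWave_boundary, Complex.exp_ofReal_mul_I_re]
    apply half_le_cos
    rw [abs_mul, abs_mul, abs_of_pos hκ, abs_of_nonneg ht.1]
    calc κ * |Real.sin θ| * t ≤ κ * 1 * ε := by
          gcongr
          · exact ht.1
          · exact Real.abs_sin_le_one θ
          · exact ht.2
      _ ≤ 1 := by rwa [mul_one]
  calc ε / 2 = ∫ _ in (0 : ℝ)..ε, (1 / 2 : ℝ) := by
        rw [intervalIntegral.integral_const, sub_zero, smul_eq_mul, mul_one_div]
    _ ≤ ∫ t in (0 : ℝ)..ε, (planeWave (κ * Real.sin θ) 0 (t, 0)).re :=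
        intervalIntegral.integral_mono_on hε.le intervalIntegrable_const
          ((Complex.continuous_re.comp hc).intervalIntegrable _ _) hre
    _ = (apertureWave κ θ ε).re :=
        Complex.reCLM.intervalIntegral_comp_comm (hc.intervalIntegrable _ _)
    _ ≤ ‖apertureWave κ θ ε‖ := Complex.re_le_norm _

/-! ### The equation for the aperture coefficient -/

/-- The real number `q` in the equation `v₀⁺ (1 + q J) = 2 φ₀ w` for the aperture coefficient `v₀⁺`
of a solution, where `J = selfLayer κ ε` and `w = apertureWave κ θ ε`. -/
def coupling (κ ε d : ℝ) : ℝ := κ * Real.cot (κ * d) / (Real.pi * ε)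

lemma dtn0_eq_cot (κ ε d : ℝ) (v : Plane → ℂ) :
    dtn0 κ ε d v = κ * Real.cot (κ * d) * coeff0 ε 0 v * phi0 ε := by
  have harg : I * 2 * κ * d = 2 * I * ((κ * d : ℝ) : ℂ) := by
    push_cast
    ring
  rw [dtn0, harg, Complex.ofReal_cot, Complex.cot_eq_exp_ratio, ← neg_sub _ (1 : ℂ), mul_neg,
    div_neg, ← div_div, div_eq_mul_inv _ I, Complex.inv_I]
  ring

lemma phi0_sq {ε : ℝ} (hε : 0 < ε) : phi0 ε ^ 2 = (ε : ℂ)⁻¹ := by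
  rw [phi0, ← Complex.ofReal_pow, div_pow, Real.sq_sqrt hε.le, one_pow, one_div,
    Complex.ofReal_inv]

lemma conj_phi0 (ε : ℝ) : starRingEnd ℂ (phi0 ε) = phi0 ε := Complex.conj_ofReal _

lemma coupling_eq {ε : ℝ} (hε : 0 < ε) (κ d : ℝ) :
    (coupling κ ε d : ℂ) = κ * Real.cot (κ * d) / Real.pi * phi0 ε ^ 2 := by
  rw [coupling, phi0_sq hε, ← div_eq_mul_inv, div_div]
  push_cast
  rfl

section
variable {κ θ ε d : ℝ} {v : Plane → ℂ}

lemma IsApproxSolution.trace_eq (hv : IsApproxSolution κ θ ε d v) (hκ : 0 < κ) (hε : 0 < ε)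
    {y : ℝ} (hy : y ∈ Set.Ioo 0 ε) :
    v !₂[y, 0] = -(dtn0 κ ε d v / Real.pi) * layer κ ε y +
      2 * planeWave (κ * Real.sin θ) 0 (y, 0) := by
  have hpi : (Real.pi : ℂ) ≠ 0 := Complex.ofReal_ne_zero.2 Real.pi_ne_zero
  have hgreen := hv.isApertureField.trace_eq hκ hε hy
  rw [congrFun (scattered_toPlane κ θ v) (y, 0), toPlane_apply, planeWave_boundary,
    planeWave_boundary, ← layer] at hgreen
  rw [planeWave_boundary]
  field_simp
  linear_combination hgreen

lemma IsApproxSolution.coeff0_zero_eq (hv : IsApproxSolution κ θ ε d v) (hκ : 0 < κ)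
    (hε : 0 < ε) : coeff0 ε 0 v =
      (-(dtn0 κ ε d v / Real.pi) * selfLayer κ ε + 2 * apertureWave κ θ ε) * phi0 ε := by
  have hwave : Continuous fun t : ℝ => planeWave (κ * Real.sin θ) 0 (t, 0) :=
    (contDiff_planeWave _ _ (n := 0)).continuous.comp (by fun_prop)
  rw [coeff0, conj_phi0, intervalIntegral.integral_mul_const, selfLayer, apertureWave,
    ← intervalIntegral.integral_const_mul, ← intervalIntegral.integral_const_mul,
    ← intervalIntegral.integral_add
      (((continuous_layer hκ ε).intervalIntegrable _ _).const_mul _)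
      ((hwave.intervalIntegrable _ _).const_mul _),
    intervalIntegral.integral_of_le hε.le, intervalIntegral.integral_of_le hε.le,
    integral_Ioc_eq_integral_Ioo, integral_Ioc_eq_integral_Ioo]
  exact congrArg (· * _)
    (setIntegral_congr_fun measurableSet_Ioo fun y hy => hv.trace_eq hκ hε hy)

theorem IsApproxSolution.coeff0_mul_one_add (hv : IsApproxSolution κ θ ε d v) (hκ : 0 < κ)
    (hε : 0 < ε) : coeff0 ε 0 v * (1 + coupling κ ε d * selfLayer κ ε) =
      2 * phi0 ε * apertureWave κ θ ε := by
  have hmean := hv.coeff0_zero_eq hκ hε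
  rw [dtn0_eq_cot] at hmean
  rw [coupling_eq hε]
  linear_combination hmean

lemma norm_phi0_mul (hε : 0 < ε) : ‖phi0 ε‖ * ε = √ε := by
  rw [phi0, Complex.norm_real, Real.norm_of_nonneg (by positivity), one_div, inv_mul_eq_div,
    Real.div_sqrt]

lemma IsApproxSolution.norm_coeff0_mul_mem (hv : IsApproxSolution κ θ ε d v) (hκ : 0 < κ)
    (hε : 0 < ε) (hκε : κ * ε ≤ 1) :
    ‖coeff0 ε 0 v‖ * ‖1 + coupling κ ε d * selfLayer κ ε‖ ∈ Set.Icc √ε (2 * √ε) := by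
  rw [← norm_mul, hv.coeff0_mul_one_add hκ hε, norm_mul, norm_mul, Complex.norm_two,
    ← norm_phi0_mul hε]
  have hlow := mul_le_mul_of_nonneg_left (half_le_norm_apertureWave (θ := θ) hκ hε hκε)
    (norm_nonneg (phi0 ε))
  have hup := mul_le_mul_of_nonneg_left (norm_apertureWave_le κ θ hε) (norm_nonneg (phi0 ε))
  constructor <;> linarith

/-! ### The energy of the cavity mode -/

lemma exp_add_sub_exp_sub (x y : ℂ) :
    Complex.exp (I * (x + y)) - Complex.exp (I * (x - y)) =
      2 * I * Complex.exp (I * x) * Complex.sin y := by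
  rw [mul_add, mul_sub, Complex.exp_add, Complex.exp_sub, div_eq_mul_inv, ← Complex.exp_neg,
    Complex.sin, mul_comm I y, neg_mul]
  linear_combination (-(Complex.exp (I * x) * (Complex.exp (-(y * I)) - Complex.exp (y * I)))) *
    Complex.I_sq

lemma IsApproxSolution.coeff0_bottom (hv : IsApproxSolution κ θ ε d v) (hε : 0 < ε) :
    coeff0 ε (-d) v = 0 := by
  rw [coeff0, intervalIntegral.integral_of_le hε.le, integral_Ioc_eq_integral_Ioo]
  exact setIntegral_eq_zero_of_forall_eq_zero fun t ht => by rw [hv.bottom t ht, zero_mul]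

lemma IsApproxSolution.eq_sin_mode (hv : IsApproxSolution κ θ ε d v) (hε : 0 < ε)
    {x : Plane} (hx : x ∈ cavity ε d) :
    v x = coeff0 ε 0 v * phi0 ε *
      ((Real.sin (κ * (x 1 + d)) / Real.sin (κ * d) : ℝ) : ℂ) := by
  have hden : Complex.exp (I * 2 * κ * d) - 1 =
      2 * I * Complex.exp (I * (κ * d)) * Complex.sin (κ * d) := by
    rw [← exp_add_sub_exp_sub, sub_self, mul_zero, Complex.exp_zero]
    ring_nf
  have hnum : Complex.exp (I * κ * d) * Complex.exp (I * κ * (x 1 + d)) -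
      Complex.exp (-I * κ * x 1) =
        2 * I * Complex.exp (I * (κ * d)) * Complex.sin (κ * (x 1 + d)) := by
    rw [← exp_add_sub_exp_sub, ← Complex.exp_add]
    ring_nf
  have hexp : Complex.exp (I * (κ * d)) ≠ 0 := Complex.exp_ne_zero _
  calc v x = coeff0 ε 0 v * phi0 ε * ((Complex.exp (I * κ * d) * Complex.exp (I * κ * (x 1 + d)) -
        Complex.exp (-I * κ * x 1)) / (Complex.exp (I * 2 * κ * d) - 1)) := by
        rw [hv.mode x hx, alphaPlus, alphaMinus, hv.coeff0_bottom hε]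
        ring
    _ = _ := by
        rw [hnum, hden, mul_div_mul_left _ _ (by simp [hexp])]
        push_cast
        rfl

lemma gradSq_eq_of_eventuallyEq_snd {f : Plane → ℂ} {F : ℝ → ℂ} {F' : ℂ} {x : Plane}
    (hF : HasDerivAt F F' (x 1)) (hf : f =ᶠ[𝓝 x] fun z => F (z 1)) : gradSq f x = ‖F'‖ ^ 2 := by
  have hderiv := (hF.hasFDerivAt.comp x
    (EuclideanSpace.proj (𝕜 := ℝ) (1 : Fin 2)).hasFDerivAt).congr_of_eventuallyEq hf
  simp [gradSq, partialDeriv, hderiv.fderiv]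

lemma isOpen_cavity (ε d : ℝ) : IsOpen (cavity ε d) := by
  have hcoord (i : Fin 2) : Continuous fun x : Plane => x i := by fun_prop
  exact (isOpen_lt continuous_const (hcoord 0)).inter
    ((isOpen_lt (hcoord 0) continuous_const).inter
      ((isOpen_lt continuous_const (hcoord 1)).inter (isOpen_lt (hcoord 1) continuous_const)))

lemma IsApproxSolution.gradSq_cavity (hv : IsApproxSolution κ θ ε d v) (hε : 0 < ε)
    {x : Plane} (hx : x ∈ cavity ε d) :
    gradSq v x = ‖coeff0 ε 0 v‖ ^ 2 / ε *
      (κ * Real.cos (κ * (x 1 + d)) / Real.sin (κ * d)) ^ 2 := by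
  have hlin : HasDerivAt (fun t : ℝ => κ * (t + d)) κ (x 1) := by
    simpa using ((hasDerivAt_id (x 1)).add_const d).const_mul κ
  have hderiv := ((hlin.sin.div_const (Real.sin (κ * d))).ofReal_comp).const_mul
    (coeff0 ε 0 v * phi0 ε)
  have hnhds := (isOpen_cavity ε d).mem_nhds hx
  rw [gradSq_eq_of_eventuallyEq_snd hderiv (eventually_of_mem hnhds fun z hz =>
      hv.eq_sin_mode hε hz), norm_mul, norm_mul, mul_pow, mul_pow, ← norm_pow (phi0 ε),
    phi0_sq hε, norm_inv, Complex.norm_real, Complex.norm_real, Real.norm_of_nonneg hε.le,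
    Real.norm_eq_abs, sq_abs, mul_comm (Real.cos _), div_eq_mul_inv (‖coeff0 ε 0 v‖ ^ 2)]

lemma mul_cos_le_sin {x : ℝ} (hx : 0 < x) (hx₁ : x ≤ 1) : x * Real.cos x ≤ Real.sin x := by
  have hcos : 0 < Real.cos x := by linarith [half_le_cos (x := x) (by rwa [abs_of_pos hx])]
  have htan := Real.lt_tan hx (by linarith [Real.pi_gt_three])
  rw [Real.tan_eq_sin_div_cos, lt_div_iff₀ hcos] at htan
  exact htan.le

lemma half_mul_le_sin {x : ℝ} (hx : 0 < x) (hx₁ : x ≤ 1) : x / 2 ≤ Real.sin x := by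
  nlinarith [half_le_cos (x := x) (by rwa [abs_of_pos hx]), mul_cos_le_sin hx hx₁]

lemma mul_cos_div_sin_mem {u : ℝ} (hκ : 0 < κ) (hd : 0 < d) (hκd : κ * d ≤ 1) (hu : 0 ≤ u)
    (hud : u ≤ d) : κ * Real.cos (κ * u) / Real.sin (κ * d) ∈ Set.Icc (1 / (2 * d)) (2 / d) := by
  have hx : 0 < κ * d := by positivity
  have hsin := half_mul_le_sin hx hκd
  have hsin_le := Real.sin_le hx.le
  have hsin_pos : 0 < Real.sin (κ * d) := by linarith
  have hκu : |κ * u| ≤ 1 := by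
    rw [abs_of_nonneg (by positivity)]
    exact (mul_le_mul_of_nonneg_left hud hκ.le).trans hκd
  have hcos := half_le_cos hκu
  have hcos_le := Real.cos_le_one (κ * u)
  rw [Set.mem_Icc, div_le_div_iff₀ (by positivity) hsin_pos, div_le_div_iff₀ hsin_pos hd]
  constructor <;> nlinarith

lemma measure_real_cavity (hε : 0 < ε) (hd : 0 < d) : volume.real (cavity ε d) = ε * d := by
  have hpre : toPlane ⁻¹' cavity ε d = Set.Ioo 0 ε ×ˢ Set.Ioo (-d) 0 :=
    Set.ext fun _ => and_assoc.symm
  rw [measureReal_def, ← measurePreserving_toPlane.measure_preimage_emb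
    toPlane.toHomeomorph.measurableEmbedding, hpre, Measure.volume_eq_prod, Measure.prod_prod,
    ENNReal.toReal_mul]
  simp [hε.le, hd.le]

lemma setIntegral_cavity_mem {f : Plane → ℝ} {m M : ℝ} (hε : 0 < ε) (hd : 0 < d)
    (hf : ContinuousOn f (cavity ε d)) (hm : 0 ≤ m)
    (hfm : ∀ x ∈ cavity ε d, f x ∈ Set.Icc m M) :
    ∫ x in cavity ε d, f x ∈ Set.Icc (ε * d * m) (ε * d * M) := by
  have hmeas := (isOpen_cavity ε d).measurableSet
  have hvol := measure_real_cavity hε hd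
  have hfin : volume (cavity ε d) ≠ ⊤ := fun htop => by
    rw [measureReal_def, htop, ENNReal.toReal_top] at hvol
    exact (mul_pos hε hd).ne hvol
  have hconst (c : ℝ) : IntegrableOn (fun _ => c) (cavity ε d) := integrableOn_const (hs := hfin)
  have hint : IntegrableOn f (cavity ε d) := by
    refine (hconst M).mono' (hf.aestronglyMeasurable hmeas) ?_
    filter_upwards [ae_restrict_mem hmeas] with x hx
    exact (Real.norm_of_nonneg (hm.trans (hfm x hx).1)).trans_le (hfm x hx).2
  have hconst_eq (c : ℝ) : ∫ _ in cavity ε d, c = ε * d * c := by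
    rw [setIntegral_const, hvol, smul_eq_mul]
  rw [← hconst_eq, ← hconst_eq]
  exact ⟨setIntegral_mono_on (hconst m) hint hmeas fun x hx => (hfm x hx).1,
    setIntegral_mono_on hint (hconst M) hmeas fun x hx => (hfm x hx).2⟩

theorem IsApproxSolution.gradL2Norm_mem (hv : IsApproxSolution κ θ ε d v) (hκ : 0 < κ)
    (hε : 0 < ε) (hd : 0 < d) (hκd : κ * d ≤ 1) :
    gradL2Norm v (cavity ε d) ∈
      Set.Icc (‖coeff0 ε 0 v‖ / (2 * √d)) (2 * ‖coeff0 ε 0 v‖ / √d) := by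
  set a := coeff0 ε 0 v
  have hgrad (x : Plane) (hx : x ∈ cavity ε d) := hv.gradSq_cavity hε hx
  have hcont : ContinuousOn (gradSq v) (cavity ε d) :=
    ContinuousOn.congr (by fun_prop) hgrad
  have hmem (x : Plane) (hx : x ∈ cavity ε d) : gradSq v x ∈
      Set.Icc (‖a‖ ^ 2 / ε * (1 / (2 * d)) ^ 2) (‖a‖ ^ 2 / ε * (2 / d) ^ 2) := by
    have hmode := mul_cos_div_sin_mem (u := x 1 + d) hκ hd hκd (by linarith [hx.2.2.1])
      (by linarith [hx.2.2.2])
    have hpos := (show 0 < 1 / (2 * d) by positivity).trans_le hmode.1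
    rw [hgrad x hx]
    exact ⟨mul_le_mul_of_nonneg_left (pow_le_pow_left₀ (by positivity) hmode.1 2) (by positivity),
      mul_le_mul_of_nonneg_left (pow_le_pow_left₀ hpos.le hmode.2 2) (by positivity)⟩
  obtain ⟨hlow, hup⟩ := setIntegral_cavity_mem hε hd hcont (by positivity) hmem
  have hsd := Real.sq_sqrt hd.le
  constructor
  · refine Real.le_sqrt_of_sq_le (le_trans (le_of_eq ?_) hlow)
    rw [div_pow _ (2 * √d), mul_pow 2 √d, hsd]
    field_simp
  · refine (Real.sqrt_le_left (by positivity)).2 (hup.trans (le_of_eq ?_))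
    rw [div_pow _ √d, hsd]
    field_simp

end

/-! ### The two-sided estimate -/

/-- The factor by which the radiation into the half-plane damps the cavity mode; it is of order `1`
exactly as long as `ε * log (λ / ε)` is at most of order `d`. -/
def damping (κ ε d : ℝ) : ℝ := 1 + ε / d * Real.log (wavelength κ / ε)

section
variable {κ ε d : ℝ}

lemma one_le_damping (hε : 0 < ε) (hd : 0 < d) (hle : ε ≤ wavelength κ) :
    1 ≤ damping κ ε d :=
  le_add_of_nonneg_right (mul_nonneg (by positivity) (Real.log_nonneg ((one_le_div hε).2 hle)))

lemma damping_le_two (hd : 0 < d) (hlog : ε * Real.log (wavelength κ / ε) ≤ d) :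
    damping κ ε d ≤ 2 := by
  rw [damping, div_mul_eq_mul_div]
  linarith [(div_le_one hd).2 hlog]

lemma mul_cot_mem {x : ℝ} (hx : 0 < x) (hx₁ : x ≤ 1) : x * Real.cot x ∈ Set.Icc (1 / 2) 1 := by
  have hsin : 0 < Real.sin x := by linarith [half_mul_le_sin hx hx₁]
  rw [Real.cot_eq_cos_div_sin, ← mul_div_assoc]
  refine ⟨?_, (div_le_one hsin).2 (mul_cos_le_sin hx hx₁)⟩
  rw [le_div_iff₀ hsin]
  nlinarith [Real.sin_le hx.le, half_le_cos (x := x) (by rwa [abs_of_pos hx])]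

lemma coupling_mul_sq_mem (hκ : 0 < κ) (hε : 0 < ε) (hd : 0 < d) (hκd : κ * d ≤ 1) :
    coupling κ ε d * ε ^ 2 ∈ Set.Icc (ε / d / 8) (ε / d / 3) := by
  have hpi := Real.pi_gt_three
  have hpi' := Real.pi_le_four
  obtain ⟨hlow, hup⟩ := mul_cot_mem (mul_pos hκ hd) hκd
  have heq : coupling κ ε d * ε ^ 2 = ε / d * (κ * d * Real.cot (κ * d) / Real.pi) := by
    rw [coupling]
    field_simp
  rw [heq, div_eq_mul_inv _ 8, div_eq_mul_inv _ 3]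
  refine ⟨mul_le_mul_of_nonneg_left ?_ (by positivity),
    mul_le_mul_of_nonneg_left ?_ (by positivity)⟩
  · rw [le_div_iff₀ Real.pi_pos]
    linarith
  · rw [div_le_iff₀ Real.pi_pos]
    linarith

lemma damping_le_norm_one_add {A : ℝ} (hκ : 0 < κ) (hε : 0 < ε) (hd : 0 < d) (hκd : κ * d ≤ 1)
    (hA : 0 < A) (hεA : ε * A ≤ d) (hle : ε ≤ wavelength κ)
    (hre : ε ^ 2 * (Real.log (wavelength κ / ε) / 2 - A) ≤ (selfLayer κ ε).re) :
    damping κ ε d / 16 ≤ ‖1 + coupling κ ε d * selfLayer κ ε‖ := by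
  obtain ⟨hlow, hup⟩ := coupling_mul_sq_mem hκ hε hd hκd
  have hq : 0 ≤ coupling κ ε d :=
    nonneg_of_mul_nonneg_left ((by positivity : (0 : ℝ) ≤ ε / d / 8).trans hlow) (by positivity)
  have hlog : 0 ≤ Real.log (wavelength κ / ε) := Real.log_nonneg ((one_le_div hε).2 hle)
  have hεA' : ε / d * A ≤ 1 := by rwa [div_mul_eq_mul_div, div_le_one hd]
  have hmain := mul_le_mul_of_nonneg_right hlow hlog
  have herr := mul_le_mul_of_nonneg_right hup hA.le
  have hq_re := mul_le_mul_of_nonneg_left hre hq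
  calc damping κ ε d / 16 ≤ 1 + coupling κ ε d * (selfLayer κ ε).re := by
        rw [damping]
        linarith
    _ = (1 + coupling κ ε d * selfLayer κ ε).re := by
        rw [Complex.add_re, Complex.one_re, Complex.re_ofReal_mul]
    _ ≤ ‖1 + coupling κ ε d * selfLayer κ ε‖ := Complex.re_le_norm _

lemma norm_one_add_le_damping {B : ℝ} (hκ : 0 < κ) (hε : 0 < ε) (hd : 0 < d) (hκd : κ * d ≤ 1)
    (hB : 0 < B) (hεd : ε ≤ d) (hle : ε ≤ wavelength κ)
    (hnorm : ‖selfLayer κ ε‖ ≤ ε ^ 2 * (B * (1 + Real.log (wavelength κ / ε)))) :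
    ‖1 + coupling κ ε d * selfLayer κ ε‖ ≤ (1 + B) * damping κ ε d := by
  obtain ⟨hlow, hup⟩ := coupling_mul_sq_mem hκ hε hd hκd
  have hq : 0 ≤ coupling κ ε d :=
    nonneg_of_mul_nonneg_left ((by positivity : (0 : ℝ) ≤ ε / d / 8).trans hlow) (by positivity)
  have hlog : 0 ≤ Real.log (wavelength κ / ε) := Real.log_nonneg ((one_le_div hε).2 hle)
  have hσ : 0 ≤ ε / d := by positivity
  have hσ₁ : ε / d ≤ 1 := (div_le_one hd).2 hεd
  calc ‖1 + coupling κ ε d * selfLayer κ ε‖ ≤ 1 + coupling κ ε d * ‖selfLayer κ ε‖ := by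
        refine (norm_add_le _ _).trans_eq ?_
        rw [norm_one, norm_mul, Complex.norm_real, Real.norm_of_nonneg hq]
    _ ≤ 1 + coupling κ ε d * (ε ^ 2 * (B * (1 + Real.log (wavelength κ / ε)))) := by gcongr
    _ = 1 + coupling κ ε d * ε ^ 2 * (B * (1 + Real.log (wavelength κ / ε))) := by ring
    _ ≤ 1 + ε / d * (B * (1 + Real.log (wavelength κ / ε))) := by
        gcongr
        linarith
    _ ≤ (1 + B) * damping κ ε d := by
        rw [damping]
        nlinarith [mul_nonneg hσ hlog, mul_nonneg hB.le (sub_nonneg.2 hσ₁)]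

lemma wavelength_pos (hκ : 0 < κ) : 0 < wavelength κ := div_pos Real.two_pi_pos hκ

lemma mul_le_one_of_le_wavelength (hκ : 0 < κ) (hd : d ≤ 1 / 8 * wavelength κ) : κ * d ≤ 1 :=
  calc κ * d ≤ κ * (1 / 8 * wavelength κ) := mul_le_mul_of_nonneg_left hd hκ.le
    _ = Real.pi / 4 := by
        rw [wavelength]
        field_simp
        norm_num
    _ ≤ 1 := by linarith [Real.pi_le_four]

theorem exists_norm_one_add_selfLayer_bounds : ∃ δ C : ℝ, 0 < δ ∧ δ ≤ 1 / 8 ∧ 0 < C ∧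
    ∀ κ ε d : ℝ, 0 < κ → 0 < ε → 0 < d → ε ≤ δ * d → d ≤ 1 / 8 * wavelength κ →
      ‖1 + coupling κ ε d * selfLayer κ ε‖ ∈ Set.Icc (damping κ ε d / 16) (C * damping κ ε d) := by
  obtain ⟨s, A, B, hs, hA, hB, hbounds⟩ := exists_selfLayer_bounds
  refine ⟨min (1 / 8) (min s A⁻¹), 1 + B, by positivity, min_le_left _ _, by positivity,
    fun κ ε d hκ hε hd hεδ hdδ => ?_⟩
  have hκd := mul_le_one_of_le_wavelength hκ hdδ
  have hδ (t : ℝ) (ht : min (1 / 8) (min s A⁻¹) ≤ t) : ε ≤ t * d :=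
    hεδ.trans (mul_le_mul_of_nonneg_right ht hd.le)
  have hεd : ε ≤ d := by linarith [hδ (1 / 8) (min_le_left _ _)]
  have hle : ε ≤ wavelength κ := by linarith [wavelength_pos hκ]
  have hεA : ε * A ≤ d := by
    have h := hδ A⁻¹ ((min_le_right _ _).trans (min_le_right _ _))
    rwa [inv_mul_eq_div, le_div_iff₀ hA] at h
  have hκε : κ * ε ≤ s := by
    nlinarith [hδ s ((min_le_right _ _).trans (min_le_left _ _))]
  obtain ⟨hre, hnorm⟩ := hbounds κ ε hκ hε hκε
  exact ⟨damping_le_norm_one_add hκ hε hd hκd hA hεA hle hre,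
    norm_one_add_le_damping hκ hε hd hκd hB hεd hle hnorm⟩

end

end

end PECPMC

open PECPMC in
theorem theorem2p1_general : ∃ δ C₁ C₂ : ℝ, 0 < δ ∧ δ ≤ 1 / 8 ∧ 0 < C₁ ∧ 0 < C₂ ∧
    ∀ κ θ ε d : ℝ, 0 < κ → 0 < ε → 0 < d → ε ≤ δ * d → d ≤ 1 / 8 * wavelength κ →
      ∀ v : Plane → ℂ, IsApproxSolution κ θ ε d v →
        gradL2Norm v (cavity ε d) ∈
          Set.Icc (C₁ * √(ε / d) / damping κ ε d) (C₂ * √(ε / d) / damping κ ε d) := by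
  obtain ⟨δ, C, hδ, hδ₁, hC, hbounds⟩ := exists_norm_one_add_selfLayer_bounds
  refine ⟨δ, 1 / (2 * C), 64, hδ, hδ₁, by positivity, by positivity,
    fun κ θ ε d hκ hε hd hεd hdδ v hv => ?_⟩
  have hκd := mul_le_one_of_le_wavelength hκ hdδ
  have hεd' : ε ≤ d := by nlinarith
  have hκε : κ * ε ≤ 1 := (mul_le_mul_of_nonneg_left hεd' hκ.le).trans hκd
  have hD : 0 < damping κ ε d :=
    one_pos.trans_le (one_le_damping hε hd (by linarith [wavelength_pos hκ]))
  obtain ⟨hlow, hup⟩ := hbounds κ ε d hκ hε hd hεd hdδ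
  obtain ⟨hcoeff, hcoeff'⟩ := hv.norm_coeff0_mul_mem hκ hε hκε
  obtain ⟨hgrad, hgrad'⟩ := hv.gradL2Norm_mem hκ hε hd hκd
  have hcoeff_ge : √ε / (C * damping κ ε d) ≤ ‖coeff0 ε 0 v‖ := by
    rw [div_le_iff₀ (by positivity)]
    exact hcoeff.trans (by gcongr)
  have hcoeff_le : ‖coeff0 ε 0 v‖ ≤ 32 * √ε / damping κ ε d := by
    rw [le_div_iff₀ hD]
    linarith [mul_le_mul_of_nonneg_left hlow (norm_nonneg (coeff0 ε 0 v))]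
  rw [Real.sqrt_div hε.le]
  constructor
  · calc 1 / (2 * C) * (√ε / √d) / damping κ ε d = √ε / (C * damping κ ε d) / (2 * √d) := by
          field_simp
      _ ≤ gradL2Norm v (cavity ε d) := le_trans (by gcongr) hgrad
  · calc gradL2Norm v (cavity ε d) ≤ 2 * (32 * √ε / damping κ ε d) / √d :=
          hgrad'.trans (by gcongr)
      _ = 64 * (√ε / √d) / damping κ ε d := by ring

theorem theorem2p1 :
    ∃ δ C₁ C₂ : ℝ, 0 < δ ∧ 0 < C₁ ∧ 0 < C₂ ∧
      ∀ κ θ ε d : ℝ, 0 < κ → θ ∈ Set.Ioo (-(Real.pi / 2)) (Real.pi / 2) → 0 < ε → 0 < d →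
        ε ≤ δ * d → d ≤ δ * PECPMC.wavelength κ →
        ∀ v : PECPMC.Plane → ℂ, PECPMC.IsApproxSolution κ θ ε d v →
          (ε * Real.log (PECPMC.wavelength κ / ε) ≤ d →
            C₁ * Real.sqrt (ε / d) ≤ PECPMC.gradL2Norm v (PECPMC.cavity ε d)) ∧
          PECPMC.gradL2Norm v (PECPMC.cavity ε d) ≤ C₂ * Real.sqrt (ε / d) := by
  obtain ⟨δ, C₁, C₂, hδ, hδ₁, hC₁, hC₂, hgrad⟩ := theorem2p1_general
  refine ⟨δ, C₁ / 2, C₂, hδ, half_pos hC₁, hC₂, fun κ θ ε d hκ _ hε hd hεd hdδ v hv => ?_⟩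
  have hwave := PECPMC.wavelength_pos hκ
  have hd_le : d ≤ 1 / 8 * PECPMC.wavelength κ := hdδ.trans (by gcongr)
  have hD := PECPMC.one_le_damping hε hd (by nlinarith : ε ≤ PECPMC.wavelength κ)
  obtain ⟨hlow, hup⟩ := hgrad κ θ ε d hκ hε hd hεd hd_le v hv
  refine ⟨fun hlog => le_trans ?_ hlow, hup.trans (div_le_self (by positivity) hD)⟩
  rw [div_mul_eq_mul_div]
  exact div_le_div_of_nonneg_left (by positivity) (by linarith) (PECPMC.damping_le_two hd hlog)
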